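/- **Setting.** Let $d\in\mathbb N$, let $(\Omega,\mathcal F,\mathbb P)$ be a probability space, and let $(\mathbb R^d,+)$ act on $\Omega$ by $x\mapsto\tau_x$ such that $(x,\omega)\mapsto\tau_x\omega$ is product measurable and every $\tau_x$ preserves $\mathbb P$ (ergodicity is not assumed). For $f$ on $\Omega$ write $f_\omega(x)=f(\tau_x\omega)$. A measurable $g$ is the weak derivative $\partial_i f$ of a measurable $f$ if for $\mathbb P$-a.e. $\omega$ the functions $f_\omega,g_\omega$ are locally integrable and $g_\omega$ is the weak $i$-th partial derivative of $f_\omega$ on $\mathbb R^d$; $\nabla$ and $\Delta$ are formed from these derivatives. Let $\mathcal D(\partial_i)=\{f\in L^2:\partial_if \text{ exists and lies in } L^2\}$ and - $\mathbb D_{\mathrm w}=\bigcap_i\mathcal D(\partial_i)$, with $\|f\|_\nabla=\|f\|_2+\sum_i\|\partial_if\|_2$; - $\mathbb D_{\mathrm w}^2=\{f\in\mathbb D_{\mathrm w}:\partial_if\in\mathcal D(\partial_i)\ \forall i,\ \|f\|_\infty,\|\nabla f\|_\infty,\|\Delta f\|_\infty<\infty\}$; - $\mathbb D_{\mathrm s}=\{f\in\mathbb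 D_{\mathrm w}: f_\omega\in C^\infty(\mathbb R^d)\ \forall\omega\in\Omega,\ \sup_{\omega\in\Omega}|D^nf_\omega(0)|<\infty\ \forall n\ge0\}$; - $\mathbb U=\{u\in\mathbb D_{\mathrm w}^2:\exists c>0,\ u>c\ \mathbb P\text{-a.s.}\}$; - $\mathbb F_{\mathrm w}=\{f\in\mathbb D_{\mathrm w}:\mathbb E f=1,\ \exists c>0,\ f>c\ \mathbb P\text{-a.s.},\ \|f\|_\infty,\|\nabla f\|_\infty<\infty\}$ and $\mathbb F_{\mathrm w}^2=\mathbb F_{\mathrm w}\cap\mathbb D_{\mathrm w}^2$; - $\mathbb F_{\mathrm s}=\{f\in\mathbb D_{\mathrm s}:\mathbb E f=1,\ \exists c>0,\ f>c\}$; - $\Phi_y^{\mathrm s}=\{\phi\in(\mathbb D_{\mathrm s})^d:\nabla\cdot\phi=0\text{ for all }\omega\in\Omega,\ \mathbb E\phi=y\}$ for $y\in\mathbb R^d$; - $\mathfrak D$ the family of all $\mathbb D\subset\mathbb D_{\mathrm w}$ that are dense in $\mathbb D_{\mathrm w}$ with respect to $\|\cdot\|_\nabla$; - $\mathfrak F$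 the family of all $\mathbb F\subset\mathbb F_{\mathrm w}$ such that for every $f\in\mathbb F_{\mathrm w}$ there are $f_n\in\mathbb F$ and $c>0$ with $\|f_n-f\|_\nabla\to0$ and $\inf_nf_n>c$ $\mathbb P$-a.s. For $V\ge0$ in $L^2(\mathbb P)$, $\mathbb D\in\mathfrak D$, $f\in\mathbb F_{\mathrm w}$, $y\in\mathbb R^d\setminus\{0\}$ and $\eta\in S^{d-1}$ (regarded also as a constant vector field) put $$K(f)=\mathbb E\Big[\frac{|\nabla f|^2}{8f}+Vf\Big],\quad H(\eta,f)=\inf_{w\in\mathbb D}\mathbb E\big[|\eta-\nabla w|^2f\big],\quad J(f)=\inf_{\eta\in S^{d-1}}\frac{H(\eta,f)}{\langle y,\eta\rangle^2},$$ where directions $\eta\perp y$ are left out of the last infimum (the quotient is $+\infty$ there). Let further $$\Gamma_V(y)=2\inf_{f\in\mathbb F_{\mathrm s}}\Big[K(f)\,\inf_{\phi\in\Phi_y^{\mathrm s}}\int\frac{|\phi|^2}{2f}\,d\mathbb P\Big]^{1/2},\qquad \sigma(0)=-\sup_{f\in\mathbb F_{\mathrm w}^2}\inf_{u\in\mathbb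 U}\int\Big(\frac{\Delta u}{2u}-V\Big)f\,d\mathbb P .$$ **Proposition.** Let $V\in L^2(\mathbb P)$ be nonnegative, let $\mathbb F\in\mathfrak F$, $\mathbb D\in\mathfrak D$ and $y\in\mathbb R^d\setminus\{0\}$, and assume $\sigma(0)>0$. Then $\Gamma_V(y)$ is the unique nonnegative solution $l$ of $$0=\inf_{f\in\mathbb F}\big\{2K(f)-l^2J(f)\big\}.$$ -/

import Mathlib

open MeasureTheory Filter Topology
open scoped ENNReal

namespace LyapunovVar

/-- The space `ℝ^d` with the Euclidean norm. -/
abbrev Euc (d : ℕ) : Type := EuclideanSpace ℝ (Fin d)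

/-- The unit vector in the `i`-th coordinate direction. -/
noncomputable def unitVec {d : ℕ} (i : Fin d) : Euc d := EuclideanSpace.single i 1

section Spaces

variable {d : ℕ} {Ω : Type*} [AddAction (Euc d) Ω]

/-- The realisation `f_ω : x ↦ f (τ_x ω)` of a function `f` on `Ω`; the shift `τ_x` is the action
of `x ∈ ℝ^d`. -/
def realisation {E : Type*} (f : Ω → E) (ω : Ω) : Euc d → E := fun x => f (x +ᵥ ω)

/-- `v` is the weak partial derivative of `u` in direction `i` on `ℝ^d`. -/
def IsWeakPartialEuc (i : Fin d) (u v : Euc d → ℝ) : Prop :=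
  LocallyIntegrable u ∧ LocallyIntegrable v ∧
    ∀ φ : Euc d → ℝ, ContDiff ℝ (⊤ : ℕ∞) φ → HasCompactSupport φ →
      ∫ x, u x * fderiv ℝ φ x (unitVec i) = - ∫ x, v x * φ x

variable [MeasurableSpace Ω]

/-- `g` is a weak partial derivative of `f` in direction `i` on `Ω`: `g` is measurable and for
`P`-almost every `ω` the realisation `g_ω` is the weak partial derivative of `f_ω`. -/
def IsWeakPartial (P : Measure Ω) (i : Fin d) (f g : Ω → ℝ) : Prop :=
  Measurable g ∧ ∀ᵐ ω ∂P, IsWeakPartialEuc i (realisation f ω) (realisation g ω)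

/-- `f` is weakly differentiable in direction `i`. -/
def WeaklyDiff (P : Measure Ω) (i : Fin d) (f : Ω → ℝ) : Prop :=
  ∃ g, IsWeakPartial P i f g

open Classical in
/-- A version of the weak partial derivative `∂_i f` (and `0` if there is none). -/
noncomputable def weakPartial (P : Measure Ω) (i : Fin d) (f : Ω → ℝ) : Ω → ℝ :=
  if h : WeaklyDiff P i f then h.choose else 0

/-- The gradient `∇ f`, with respect to weak partial derivatives. -/
noncomputable def grad (P : Measure Ω) (f : Ω → ℝ) (ω : Ω) : Euc d :=
  WithLp.toLp 2 (fun i => weakPartial P i f ω)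

variable (d) in
/-- The Laplacian `Δ f = ∑ i, ∂_i (∂_i f)`, with respect to weak partial derivatives. -/
noncomputable def lapl (P : Measure Ω) (f : Ω → ℝ) (ω : Ω) : ℝ :=
  ∑ i : Fin d, weakPartial P i (weakPartial P i f) ω

/-- The domain `𝒟(∂_i)` of `∂_i` in `L²`. -/
def domPartial (P : Measure Ω) (i : Fin d) : Set (Ω → ℝ) :=
  {f | Measurable f ∧ MemLp f 2 P ∧ WeaklyDiff P i f ∧ MemLp (weakPartial P i f) 2 P}

variable (d) in
/-- `𝔻_w = ⋂ i, 𝒟(∂_i)`, the square integrable functions with square integrable weak gradient. -/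
def Dw (P : Measure Ω) : Set (Ω → ℝ) :=
  {f | Measurable f ∧ MemLp f 2 P ∧ ∀ i : Fin d, f ∈ domPartial P i}

variable (d) in
/-- The norm `‖f‖_∇ = ‖f‖₂ + ∑ i, ‖∂_i f‖₂`. -/
noncomputable def nablaNorm (P : Measure Ω) (f : Ω → ℝ) : ℝ≥0∞ :=
  eLpNorm f 2 P + ∑ i : Fin d, eLpNorm (weakPartial P i f) 2 P

variable (d) in
/-- `𝔻_w²`. -/
def Dw2 (P : Measure Ω) : Set (Ω → ℝ) :=
  {f | f ∈ Dw d P ∧ (∀ i : Fin d, weakPartial P i f ∈ domPartial P i) ∧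
    MemLp f ∞ P ∧ (∀ i : Fin d, MemLp (weakPartial P i f) ∞ P) ∧ MemLp (lapl d P f) ∞ P}

variable (d) in
/-- `𝔻_s`: all realisations are smooth (`C^∞`), and the derivative of every order `n ≥ 0` is bounded on
`Ω`; `D^n f (ω)` is the `n`-th derivative of `f_ω` at `0`. -/
def Ds (P : Measure Ω) : Set (Ω → ℝ) :=
  {f | f ∈ Dw d P ∧ (∀ ω, ContDiff ℝ (⊤ : ℕ∞) (realisation f ω : Euc d → ℝ)) ∧
    ∀ n : ℕ, ∃ C : ℝ, ∀ ω,
      ‖iteratedFDeriv ℝ n (realisation f ω : Euc d → ℝ) 0‖ ≤ C}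

variable (d) in
/-- `𝕌`: the functions in `𝔻_w²` that are bounded away from `0`, that is `exp (𝔻_w²)`. -/
def UU (P : Measure Ω) : Set (Ω → ℝ) :=
  {f | f ∈ Dw2 d P ∧ ∃ c > 0, ∀ᵐ ω ∂P, c < f ω}

variable (d) in
/-- The space `𝔽_w` of weakly differentiable probability densities. -/
def Fw (P : Measure Ω) : Set (Ω → ℝ) :=
  {f | f ∈ Dw d P ∧ ∫ ω, f ω ∂P = 1 ∧ (∃ c > 0, ∀ᵐ ω ∂P, c < f ω) ∧
    MemLp f ∞ P ∧ ∀ i : Fin d, MemLp (weakPartial P i f) ∞ P}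

variable (d) in
/-- `𝔽_w² = 𝔽_w ∩ 𝔻_w²`. -/
def Fw2 (P : Measure Ω) : Set (Ω → ℝ) := Fw d P ∩ Dw2 d P

variable (d) in
/-- The space `𝔽_s` of smooth probability densities. -/
def Fs (P : Measure Ω) : Set (Ω → ℝ) :=
  {f | f ∈ Ds d P ∧ ∫ ω, f ω ∂P = 1 ∧ ∃ c > 0, ∀ ω, c < f ω}

/-- The space `Φ_y^s` of smooth divergence-free vector fields with mean `y`; the divergence at `ω`
is that of the realisation `φ_ω` at `0`. -/
def PhiS (P : Measure Ω) (y : Euc d) : Set (Ω → Euc d) :=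
  {φ | (∀ i, (fun ω => φ ω i) ∈ Ds d P) ∧
    (∀ ω, ∑ i, fderiv ℝ (realisation (fun ω' => φ ω' i) ω : Euc d → ℝ) 0 (unitVec i) = 0) ∧
    ∫ ω, φ ω ∂P = y}

variable (d) in
/-- The family `𝔇` of the subsets of `𝔻_w` that are dense with respect to `‖·‖_∇`. -/
def DenseSpaces (P : Measure Ω) : Set (Set (Ω → ℝ)) :=
  {D | D ⊆ Dw d P ∧ ∀ f ∈ Dw d P, ∀ ε > 0, ∃ g ∈ D, nablaNorm d P (g - f) < ε}

variable (d) in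
/-- The family `𝔉` of the subsets `F` of `𝔽_w` such that every `f ∈ 𝔽_w` is the limit with respect
to `‖·‖_∇` of a sequence in `F` that is almost surely uniformly bounded away from `0`. -/
def DensityFamilies (P : Measure Ω) : Set (Set (Ω → ℝ)) :=
  {F | F ⊆ Fw d P ∧ ∀ f ∈ Fw d P, ∃ g : ℕ → Ω → ℝ, (∀ n, g n ∈ F) ∧
    Tendsto (fun n => nablaNorm d P (g n - f)) atTop (𝓝 0) ∧
    ∃ c > 0, ∀ᵐ ω ∂P, ∀ n, c < g n ω}

/-- `L^lam u = (1/2) Δ u + lam · ∇ u`, the generator of Brownian motion with drift `lam`. -/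
noncomputable def genL (P : Measure Ω) (lam : Euc d) (u : Ω → ℝ) (ω : Ω) : ℝ :=
  (1 / 2) * lapl d P u ω + inner ℝ lam (grad P u ω)

/-- `σ(lam) = - sup_{f ∈ 𝔽_w²} inf_{u ∈ 𝕌} ∫ (L^lam u / u - V) f dP`. -/
noncomputable def sigma (P : Measure Ω) (V : Ω → ℝ) (lam : Euc d) : EReal :=
  - ⨆ f ∈ Fw2 d P, ⨅ u ∈ UU d P,
      ((∫ ω, (genL P lam u ω / u ω - V ω) * f ω ∂P : ℝ) : EReal)

variable (d) in
/-- `K(f) = E[|∇ f|² / (8 f) + V f]`. -/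
noncomputable def K (P : Measure Ω) (V : Ω → ℝ) (f : Ω → ℝ) : ℝ :=
  ∫ ω, (‖(grad P f ω : Euc d)‖ ^ 2 / (8 * f ω) + V ω * f ω) ∂P

/-- `H(b, f) = inf_{w ∈ D} E[|b - ∇ w|² f]`. -/
noncomputable def H (P : Measure Ω) (D : Set (Ω → ℝ)) (b : Ω → Euc d) (f : Ω → ℝ) : ℝ :=
  ⨅ w : D, ∫ ω, ‖b ω - grad P (w : Ω → ℝ) ω‖ ^ 2 * f ω ∂P

/-- `J(f) = inf_{|η| = 1} H(η, f) / ⟨y, η⟩²`. As `H(η, f) > 0`, the quotient is `+∞` for `η`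
perpendicular to `y`; these `η` are left out. -/
noncomputable def J (P : Measure Ω) (D : Set (Ω → ℝ)) (y : Euc d) (f : Ω → ℝ) : ℝ :=
  ⨅ η : {η : Euc d // ‖η‖ = 1 ∧ inner ℝ y η ≠ 0},
    H P D (fun _ => (η : Euc d)) f / (inner ℝ y (η : Euc d)) ^ 2

/-- `Γ_V(y) = 2 inf_{f ∈ 𝔽_s} [K(f) · inf_{φ ∈ Φ_y^s} ∫ |φ|² / (2 f) dP]^{1/2}`. -/
noncomputable def Gam (P : Measure Ω) (V : Ω → ℝ) (y : Euc d) : ℝ :=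
  2 * ⨅ f : Fs d P, Real.sqrt (K d P V f *
    ⨅ φ : PhiS P y, ∫ ω, ‖(φ : Ω → Euc d) ω‖ ^ 2 / (2 * (f : Ω → ℝ) ω) ∂P)

end Spaces

end LyapunovVar

open scoped Convolution
set_option linter.unusedSectionVars false

/-! Write `Q(f)` for `minEnergy P y f`, the infimum of `∫ |φ|² / f` over smooth divergence-free `φ`
with mean `y`. The core is the duality `J(f) = 1 / Q(f)` for every `f ∈ 𝔽_w` (`J_eq_inv_minEnergy`).
Since `Γ_V(y)²` is the infimum of `2 K(f) Q(f)` over `𝔽_s`, the claim becomes: `inf (2K - l² / Q) =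
0` exactly when `l² = inf 2KQ`. This is elementary once `K` and `Q` are bounded away from zero
(`isGLB_sub_div_iff`).

The bound on `Q` is `‖y‖² ≤ Q(f)`. The bound on `K` is what `σ(0) > 0` provides: integrating `(Δu /
2u) f` by parts and completing a square bounds the integral below by `-∫ |∇f|² / (8f)`, so `-K(f)`
is at most the quantity whose supremum is `-σ(0)` (`exists_K_lower_bound`).

In the duality, one direction is Cauchy-Schwarz applied to `⟨y, η⟩ = E[φ · (η - ∇w)]`. The other
projects `f^{-1/2} y` onto the closure of `f^{-1/2}` times the mean-zero solenoidal fields; the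
residual yields nearly optimal `φ` and `w` simultaneously (`exists_dual_pair`). It rests on a
Helmholtz decomposition: a field orthogonal to all smooth solenoidal fields is an `L²` limit of
smooth gradients (`mem_closure_gradSub`). Since ergodicity is not available, that is shown by
proving the correlation `x ↦ ⟨φ, v ∘ τ_x⟩` constant and applying a mean ergodic argument, with
exactly invariant fields serving as solenoidal test fields.

Finally, `K` and each fixed energy `∫ |φ|² / f` are continuous along the approximations that define
`𝔉`, so the infimum of `KQ` is the same over `𝔽_s` and over any `F ∈ 𝔉` (`isGLB_Gam_sq`).
Mollification along orbits shows that `𝔽_s` itself belongs to `𝔉`. -/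

namespace LyapunovVar

/-! ### Test functions and weak partial derivatives on `ℝ^d`. -/

section TestFunctions

variable {d : ℕ}

/-- The `i`-th partial derivative of a function on `ℝ^d`. -/
noncomputable def dpart (i : Fin d) (ρ : Euc d → ℝ) (x : Euc d) : ℝ := fderiv ℝ ρ x (unitVec i)

/-- Smooth compactly supported functions on `ℝ^d`. -/
def IsTest (ρ : Euc d → ℝ) : Prop := ContDiff ℝ (⊤ : ℕ∞) ρ ∧ HasCompactSupport ρ

lemma contDiff_dpart {ρ : Euc d → ℝ} (hρ : ContDiff ℝ (⊤ : ℕ∞) ρ) (i : Fin d) :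
    ContDiff ℝ (⊤ : ℕ∞) (dpart i ρ) :=
  (hρ.fderiv_right (m := (⊤ : ℕ∞)) (by simp)).clm_apply contDiff_const

lemma IsTest.dpart {ρ : Euc d → ℝ} (hρ : IsTest ρ) (i : Fin d) : IsTest (dpart i ρ) :=
  ⟨contDiff_dpart hρ.1 i, hρ.2.fderiv_apply ℝ (unitVec i)⟩

lemma IsTest.continuous {ρ : Euc d → ℝ} (hρ : IsTest ρ) : Continuous ρ := hρ.1.continuous

lemma IsTest.integrable {ρ : Euc d → ℝ} (hρ : IsTest ρ) : Integrable ρ :=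
  hρ.continuous.integrable_of_hasCompactSupport hρ.2

lemma IsTest.comp_neg {ρ : Euc d → ℝ} (hρ : IsTest ρ) : IsTest (fun x => ρ (-x)) :=
  ⟨hρ.1.comp contDiff_neg, hρ.2.comp_homeomorph (Homeomorph.neg _)⟩

lemma dpart_comp_neg (i : Fin d) (ρ : Euc d → ℝ) (x : Euc d) :
    dpart i (fun x => ρ (-x)) x = - dpart i ρ (-x) := by
  have h := (ContinuousLinearEquiv.neg ℝ (M := Euc d)).comp_right_fderiv (f := ρ) (x := x)
  have h' := congrArg (fun L => L (unitVec i)) h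
  simpa [dpart, Function.comp_def] using h'

lemma IsTest.mul {ρ h : Euc d → ℝ} (hρ : IsTest ρ) (hh : ContDiff ℝ (⊤ : ℕ∞) h) :
    IsTest (fun x => ρ x * h x) :=
  ⟨hρ.1.mul hh, hρ.2.mul_right⟩

lemma dpart_mul {ρ h : Euc d → ℝ} (hρ : ContDiff ℝ (⊤ : ℕ∞) ρ) (hh : ContDiff ℝ (⊤ : ℕ∞) h)
    (i : Fin d) (x : Euc d) :
    dpart i (fun x => ρ x * h x) x = ρ x * dpart i h x + dpart i ρ x * h x := by
  have h1 := (hρ.differentiable (by simp)) x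
  have h2 := (hh.differentiable (by simp)) x
  unfold dpart
  rw [fderiv_fun_mul h1 h2]
  simp [mul_comm]

lemma IsTest.integral_dpart {ρ : Euc d → ℝ} (hρ : IsTest ρ) (i : Fin d) :
    ∫ x, LyapunovVar.dpart i ρ x = 0 := by
  -- Integration by parts with the constant `1` as the other factor.
  have h := integral_mul_fderiv_eq_neg_fderiv_mul_of_integrable (𝕜 := ℝ) (μ := (volume : Measure (Euc d)))
    (f := fun _ => (1 : ℝ)) (g := ρ) (v := unitVec i)
    (by simp) (by simp only [one_mul]; exact (hρ.dpart i).integrable)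
    (by simpa only [one_mul] using hρ.integrable) (fun _ _ => differentiableAt_const _)
    (fun x _ => hρ.1.differentiable (by simp) x)
  simpa [LyapunovVar.dpart] using h

lemma isWeakPartialEuc_of_contDiff {h : Euc d → ℝ} (hh : ContDiff ℝ (⊤ : ℕ∞) h) (i : Fin d) :
    IsWeakPartialEuc i h (dpart i h) := by
  refine ⟨hh.continuous.locallyIntegrable, (contDiff_dpart hh i).continuous.locallyIntegrable,
    fun φ h1 h2 => ?_⟩
  have hφ : IsTest φ := ⟨h1, h2⟩
  have h3 := (hφ.mul hh).integral_dpart i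
  simp_rw [dpart_mul h1 hh] at h3
  rw [integral_add (hφ.mul (contDiff_dpart hh i)).integrable ((hφ.dpart i).mul hh).integrable] at h3
  have e1 : ∫ x, h x * fderiv ℝ φ x (unitVec i) = ∫ x, LyapunovVar.dpart i φ x * h x := by
    congr 1; ext x; rw [mul_comm]; rfl
  have e2 : ∫ x, LyapunovVar.dpart i h x * φ x = ∫ x, φ x * LyapunovVar.dpart i h x := by
    congr 1; ext x; rw [mul_comm]
  rw [e1, e2]; linarith

lemma IsWeakPartialEuc.ae_eq {i : Fin d} {u u' v v' : Euc d → ℝ} (h : IsWeakPartialEuc i u v)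
    (h' : IsWeakPartialEuc i u' v') (hu : u =ᵐ[volume] u') : v =ᵐ[volume] v' := by
  refine ae_eq_of_integral_contDiff_smul_eq h.2.1 h'.2.1 fun g hg hg' => ?_
  have h1 := h.2.2 g hg hg'
  have h2 := h'.2.2 g hg hg'
  have h3 : ∫ x, u x * fderiv ℝ g x (unitVec i) = ∫ x, u' x * fderiv ℝ g x (unitVec i) :=
    integral_congr_ae (by filter_upwards [hu] with x hx; rw [hx])
  simp_rw [smul_eq_mul, mul_comm (g _)]
  linarith

lemma IsWeakPartialEuc.congr {i : Fin d} {u u' v v' : Euc d → ℝ} (h : IsWeakPartialEuc i u v)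
    (hu : u =ᵐ[volume] u') (hv : v =ᵐ[volume] v') : IsWeakPartialEuc i u' v' := by
  refine ⟨h.1.congr hu, h.2.1.congr hv, fun φ h1 h2 => ?_⟩
  have e1 : ∫ x, u x * fderiv ℝ φ x (unitVec i) = ∫ x, u' x * fderiv ℝ φ x (unitVec i) :=
    integral_congr_ae (by filter_upwards [hu] with x hx; rw [hx])
  have e2 : ∫ x, v x * φ x = ∫ x, v' x * φ x :=
    integral_congr_ae (by filter_upwards [hv] with x hx; rw [hx])
  rw [← e1, ← e2]
  exact h.2.2 φ h1 h2

lemma LocallyIntegrable.integrable_mul_test {u φ : Euc d → ℝ} (hu : LocallyIntegrable u)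
    (hφ : IsTest φ) : Integrable (fun x => u x * φ x) := by
  have := hu.integrable_smul_left_of_hasCompactSupport hφ.continuous hφ.2
  simpa [mul_comm] using this

lemma IsWeakPartialEuc.sub {i : Fin d} {u u' v v' : Euc d → ℝ} (h : IsWeakPartialEuc i u v)
    (h' : IsWeakPartialEuc i u' v') : IsWeakPartialEuc i (u - u') (v - v') := by
  refine ⟨h.1.sub h'.1, h.2.1.sub h'.2.1, fun φ h1 h2 => ?_⟩
  have hφ : IsTest φ := ⟨h1, h2⟩
  simp only [Pi.sub_apply, sub_mul]
  rw [integral_sub, integral_sub, h.2.2 φ h1 h2, h'.2.2 φ h1 h2]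
  · ring
  · exact LocallyIntegrable.integrable_mul_test h.2.1 hφ
  · exact LocallyIntegrable.integrable_mul_test h'.2.1 hφ
  · exact LocallyIntegrable.integrable_mul_test h.1 (hφ.dpart i)
  · exact LocallyIntegrable.integrable_mul_test h'.1 (hφ.dpart i)

end TestFunctions

/-! ### Transfer between `Ω` and its orbits; integration by parts on `Ω`. -/

section Shift

variable {d : ℕ} {Ω : Type*} [MeasurableSpace Ω] [AddAction (Euc d) Ω]
  [MeasurableVAdd₂ (Euc d) Ω] {P : Measure Ω} [IsProbabilityMeasure P]
  [VAddInvariantMeasure (Euc d) Ω P]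

lemma measurable_realisation {E : Type*} [MeasurableSpace E] {f : Ω → E} (hf : Measurable f)
    (ω : Ω) : Measurable (realisation f ω : Euc d → E) :=
  hf.comp (measurable_id.vadd_const ω)

lemma realisation_vadd {E : Type*} (f : Ω → E) (ω : Ω) (x y : Euc d) :
    realisation f (x +ᵥ ω) y = realisation f ω (y + x) := by
  simp [realisation, vadd_vadd]

/-- Each fibre map is a shift, which preserves `P`. This one map gives all exchanges between
integrals over `Ω` and along orbits; it is used with `e = id` and with `e = -id`. -/
lemma measurePreserving_skew {e : Euc d → Euc d} (he : Measurable e) :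
    MeasurePreserving (fun q : Euc d × Ω => (q.1, e q.1 +ᵥ q.2))
      (volume.prod P) (volume.prod P) := by
  refine MeasurePreserving.skew_product (f := id) (g := fun x ω => e x +ᵥ ω)
    (MeasurePreserving.id _) ?_ (.of_forall fun x => ?_)
  · exact (he.comp measurable_fst).vadd measurable_snd
  · exact (measurePreserving_vadd (e x) P).map_eq

lemma measurePreserving_snd_skew {e : Euc d → Euc d} (he : Measurable e) :
    Measure.QuasiMeasurePreserving (fun q : Euc d × Ω => e q.1 +ᵥ q.2) (volume.prod P) P :=
  Measure.quasiMeasurePreserving_snd.comp (measurePreserving_skew he).quasiMeasurePreserving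

lemma ae_ae_vadd {p : Ω → Prop} (h : ∀ᵐ ω ∂P, p ω) :
    ∀ᵐ ω ∂P, ∀ᵐ x : Euc d, p (x +ᵥ ω) := by
  have h1 := (measurePreserving_snd_skew (P := P) (d := d) measurable_id).ae h
  have h2 := (Measure.measurePreserving_swap (μ := P)
    (ν := (volume : Measure (Euc d)))).quasiMeasurePreserving.ae h1
  exact Measure.ae_ae_of_ae_prod h2

lemma ae_of_vadd (x : Euc d) {p : Ω → Prop} (h : ∀ᵐ ω ∂P, p (x +ᵥ ω)) : ∀ᵐ ω ∂P, p ω := by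
  have := (measurePreserving_vadd (-x) P).quasiMeasurePreserving.ae h
  simpa [vadd_vadd] using this

lemma ae_vadd (x : Euc d) {p : Ω → Prop} (h : ∀ᵐ ω ∂P, p ω) : ∀ᵐ ω ∂P, p (x +ᵥ ω) :=
  (measurePreserving_vadd x P).quasiMeasurePreserving.ae h

/-- By Fubini some single shift `x` satisfies `p (x +ᵥ ω)` almost surely, and that shift can be
undone because it preserves `P`. Statements about Lebesgue-almost every point of an orbit thus
return to `Ω`. -/
lemma ae_of_ae_ae_vadd {p : Ω → Prop} (hp : MeasurableSet {ω | p ω})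
    (h : ∀ᵐ ω ∂P, ∀ᵐ x : Euc d, p (x +ᵥ ω)) : ∀ᵐ ω ∂P, p ω := by
  have h1 : ∀ᵐ x : Euc d, ∀ᵐ ω ∂P, p (x +ᵥ ω) := by
    refine (Measure.ae_ae_comm ?_).1 h
    exact (measurable_snd.vadd measurable_fst) hp
  obtain ⟨x, hx⟩ := h1.exists
  exact ae_of_vadd x hx

lemma integral_vadd (x : Euc d) (F : Ω → ℝ) : ∫ ω, F (x +ᵥ ω) ∂P = ∫ ω, F ω ∂P :=
  (measurePreserving_vadd x P).integral_comp (measurableEmbedding_const_vadd x) F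

lemma integrable_mul_skew {e : Euc d → Euc d} (he : Measurable e) {ρ : Euc d → ℝ}
    (hρ : Integrable ρ) {F : Ω → ℝ} (hF : Integrable F P) :
    Integrable (fun q : Euc d × Ω => ρ q.1 * F (e q.1 +ᵥ q.2)) (volume.prod P) :=
  (measurePreserving_skew he).integrable_comp_of_integrable (hρ.mul_prod hF)

/-- After Fubini the integral over `Ω` no longer depends on `x`, by invariance of `P`. -/
lemma integral_integral_mul_skew {e : Euc d → Euc d} (he : Measurable e) {ρ : Euc d → ℝ}
    (hρ : Integrable ρ) {F : Ω → ℝ} (hF : Integrable F P) :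
    ∫ ω, (∫ x, ρ x * F (e x +ᵥ ω)) ∂P = (∫ x, ρ x) * ∫ ω, F ω ∂P := by
  rw [integral_integral_swap (f := fun ω x => ρ x * F (e x +ᵥ ω))
    (integrable_mul_skew he hρ hF).swap]
  simp_rw [integral_const_mul, integral_vadd, integral_mul_const]

lemma ae_locallyIntegrable {F : Ω → ℝ} (hF : Integrable F P) :
    ∀ᵐ ω ∂P, LocallyIntegrable (realisation F ω : Euc d → ℝ) := by
  have h : ∀ n : ℕ, ∀ᵐ ω ∂P, IntegrableOn (realisation F ω : Euc d → ℝ) (Metric.closedBall 0 n) := by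
    intro n
    have h1 := integrable_mul_skew (P := P) (d := d) (e := id)
      (ρ := (Metric.closedBall (0 : Euc d) n).indicator 1) measurable_id
      ((integrable_indicator_iff measurableSet_closedBall).2
        (integrableOn_const (by exact measure_closedBall_lt_top.ne))) hF
    filter_upwards [h1.prod_left_ae] with ω hω
    rw [← integrable_indicator_iff measurableSet_closedBall]
    refine hω.congr (.of_forall fun x => ?_)
    by_cases hx : x ∈ Metric.closedBall (0 : Euc d) n <;> simp [hx, realisation]
  filter_upwards [ae_all_iff.2 h] with ω hω
  rw [locallyIntegrable_iff]
  intro k hk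
  obtain ⟨r, hr⟩ := hk.isBounded.subset_closedBall 0
  obtain ⟨n, hn⟩ := exists_nat_ge r
  exact (hω n).mono_set (hr.trans (Metric.closedBall_subset_closedBall hn))

/-! ### Weak derivatives -/

lemma IsWeakPartial.ae_eq {i : Fin d} {f f' g g' : Ω → ℝ} (h : IsWeakPartial P i f g)
    (h' : IsWeakPartial P i f' g') (hf : f =ᵐ[P] f') : g =ᵐ[P] g' := by
  refine ae_of_ae_ae_vadd (d := d) (measurableSet_eq_fun h.1 h'.1) ?_
  filter_upwards [h.2, h'.2, ae_ae_vadd (d := d) hf] with ω h1 h2 h3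
  exact h1.ae_eq h2 h3

lemma IsWeakPartial.congr {i : Fin d} {f f' g g' : Ω → ℝ} (h : IsWeakPartial P i f g)
    (hf : f =ᵐ[P] f') (hg : g =ᵐ[P] g') (hg' : Measurable g') : IsWeakPartial P i f' g' := by
  refine ⟨hg', ?_⟩
  filter_upwards [h.2, ae_ae_vadd (d := d) hf, ae_ae_vadd (d := d) hg] with ω h1 h2 h3
  exact h1.congr h2 h3

lemma WeaklyDiff.isWeakPartial {i : Fin d} {f : Ω → ℝ} (h : WeaklyDiff P i f) :
    IsWeakPartial P i f (weakPartial P i f) := by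
  rw [weakPartial, dif_pos h]
  exact h.choose_spec

lemma IsWeakPartial.weakPartial_ae_eq {i : Fin d} {f g : Ω → ℝ} (h : IsWeakPartial P i f g) :
    weakPartial P i f =ᵐ[P] g :=
  (WeaklyDiff.isWeakPartial ⟨g, h⟩).ae_eq h (ae_eq_refl f)

lemma measurable_weakPartial (i : Fin d) (f : Ω → ℝ) : Measurable (weakPartial P i f) := by
  unfold weakPartial
  split_ifs with h
  · exact h.choose_spec.1
  · exact measurable_zero

lemma IsWeakPartial.sub {i : Fin d} {f f' g g' : Ω → ℝ} (h : IsWeakPartial P i f g)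
    (h' : IsWeakPartial P i f' g') : IsWeakPartial P i (f - f') (g - g') := by
  refine ⟨h.1.sub h'.1, ?_⟩
  filter_upwards [h.2, h'.2] with ω h1 h2
  exact h1.sub h2

/-- The classical partial derivative at `ω`, that is of the realisation at `0`. -/
noncomputable def pd (i : Fin d) (h : Ω → ℝ) (ω : Ω) : ℝ := dpart i (realisation h ω) 0

lemma realisation_pd (i : Fin d) (h : Ω → ℝ) (ω : Ω) :
    (realisation (pd i h) ω : Euc d → ℝ) = dpart i (realisation h ω) := by
  ext x
  have : (realisation h (x +ᵥ ω) : Euc d → ℝ) = fun y => realisation h ω (y + x) := by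
    ext y; exact realisation_vadd h ω x y
  simp only [realisation, pd, dpart]
  change fderiv ℝ (realisation h (x +ᵥ ω)) 0 (unitVec i) = _
  rw [this, fderiv_comp_add_right]
  simp

lemma pd_add (i : Fin d) {f g : Ω → ℝ}
    (hf : ∀ ω, ContDiff ℝ (⊤ : ℕ∞) (realisation f ω : Euc d → ℝ))
    (hg : ∀ ω, ContDiff ℝ (⊤ : ℕ∞) (realisation g ω : Euc d → ℝ)) :
    pd i (f + g) = pd i f + pd i g := by
  ext ω
  have : (realisation (f + g) ω : Euc d → ℝ) = realisation f ω + realisation g ω := rfl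
  simp only [pd, dpart, this, Pi.add_apply]
  rw [fderiv_add ((hf ω).differentiable (by simp) 0) ((hg ω).differentiable (by simp) 0)]
  rfl

lemma pd_smul (i : Fin d) (c : ℝ) {f : Ω → ℝ}
    (hf : ∀ ω, ContDiff ℝ (⊤ : ℕ∞) (realisation f ω : Euc d → ℝ)) :
    pd i (c • f) = c • pd i f := by
  ext ω
  have : (realisation (c • f) ω : Euc d → ℝ) = c • realisation f ω := rfl
  simp only [pd, dpart, this, Pi.smul_apply]
  rw [fderiv_const_smul ((hf ω).differentiable (by simp) 0)]
  rfl

lemma measurable_pd (i : Fin d) {h : Ω → ℝ} (hm : Measurable h)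
    (hh : ∀ ω, ContDiff ℝ (⊤ : ℕ∞) (realisation h ω : Euc d → ℝ)) : Measurable (pd i h) := by
  -- The derivative is the pointwise limit of difference quotients with step `1 / (n + 1)`, each of
  -- them measurable.
  refine measurable_of_tendsto_metrizable (f := fun (n : ℕ) ω =>
    ((n : ℝ) + 1) * (h (((n : ℝ) + 1)⁻¹ • (unitVec i : Euc d) +ᵥ ω) - h ω)) (fun n => ?_) ?_
  · exact ((hm.comp (measurable_const_vadd _)).sub hm).const_mul _
  · rw [tendsto_pi_nhds]
    intro ω
    have h1 := ((hh ω).differentiable (by simp) 0).hasFDerivAt.hasLineDerivAt (unitVec i)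
    have h2 := h1.tendsto_slope_zero_right
    have h3 : Tendsto (fun n : ℕ => ((n : ℝ) + 1)⁻¹) atTop (𝓝[>] 0) := by
      refine tendsto_nhdsWithin_iff.2 ⟨?_, .of_forall fun n => ?_⟩
      · simpa [one_div] using tendsto_one_div_add_atTop_nhds_zero_nat (𝕜 := ℝ)
      · simp only [Set.mem_Ioi]; positivity
    refine (h2.comp h3).congr fun n => ?_
    simp [realisation]

lemma isWeakPartial_pd (i : Fin d) {h : Ω → ℝ} (hm : Measurable h)
    (hh : ∀ ω, ContDiff ℝ (⊤ : ℕ∞) (realisation h ω : Euc d → ℝ)) :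
    IsWeakPartial P i h (pd i h) :=
  ⟨measurable_pd i hm hh, .of_forall fun ω => by
    rw [realisation_pd]; exact isWeakPartialEuc_of_contDiff (hh ω) i⟩

lemma exists_test_integral_one : ∃ χ : Euc d → ℝ, IsTest χ ∧ ∫ x, χ x = 1 := by
  let b : ContDiffBump (0 : Euc d) := ⟨1, 2, one_pos, one_lt_two⟩
  exact ⟨b.normed volume, ⟨b.contDiff_normed, b.hasCompactSupport_normed⟩, b.integral_normed⟩

/-- Integration by parts on `Ω` against a bounded smooth function. -/
lemma IsWeakPartial.integral_mul {i : Fin d} {f g h : Ω → ℝ} (hfg : IsWeakPartial P i f g)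
    (hf : Integrable f P) (hg : Integrable g P) (hm : Measurable h)
    (hh : ∀ ω, ContDiff ℝ (⊤ : ℕ∞) (realisation h ω : Euc d → ℝ)) {C : ℝ}
    (hC : ∀ ω, |h ω| ≤ C) (hC' : ∀ ω, |pd i h ω| ≤ C) :
    ∫ ω, g ω * h ω ∂P = - ∫ ω, f ω * pd i h ω ∂P := by
  -- Test the orbitwise identity with `χ` times the realisation of `h` and integrate over `Ω`. The
  -- terms carrying `χ` get the factor `∫ χ = 1`; the term carrying `∂_i χ` gets the factor `0`.
  obtain ⟨χ, hχ, hχ1⟩ := exists_test_integral_one (d := d)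
  have hp := measurable_pd i hm hh
  have i1 : Integrable (fun ω => g ω * h ω) P :=
    hg.mul_bdd hm.aestronglyMeasurable (.of_forall fun ω => hC ω)
  have i2 : Integrable (fun ω => f ω * h ω) P :=
    hf.mul_bdd hm.aestronglyMeasurable (.of_forall fun ω => hC ω)
  have i3 : Integrable (fun ω => f ω * pd i h ω) P :=
    hf.mul_bdd hp.aestronglyMeasurable (.of_forall fun ω => hC' ω)
  have e1 := integral_integral_mul_skew (d := d) measurable_id hχ.integrable i1
  have e2 := integral_integral_mul_skew (d := d) measurable_id (hχ.dpart i).integrable i2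
  have e3 := integral_integral_mul_skew (d := d) measurable_id hχ.integrable i3
  rw [hχ1, one_mul] at e1 e3
  rw [hχ.integral_dpart, zero_mul] at e2
  rw [← e1, ← e3]
  have j2 := integrable_mul_skew (P := P) (d := d) measurable_id (hχ.dpart i).integrable i2
  have j3 := integrable_mul_skew (P := P) (d := d) measurable_id hχ.integrable i3
  have k2 := j2.swap.integral_prod_left
  have k3 := j3.swap.integral_prod_left
  simp only [Function.comp_def, Prod.swap] at k2 k3
  have key : ∀ᵐ ω ∂P, ∫ x, χ x * (g (id x +ᵥ ω) * h (id x +ᵥ ω)) =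
      - ((∫ x, χ x * (f (id x +ᵥ ω) * pd i h (id x +ᵥ ω))) +
        ∫ x, dpart i χ x * (f (id x +ᵥ ω) * h (id x +ᵥ ω))) := by
    filter_upwards [hfg.2] with ω hω
    have h1 := hω.2.2 _ (hχ.mul (hh ω)).1 (hχ.mul (hh ω)).2
    have h2 : ∀ x, fderiv ℝ (fun x => χ x * realisation h ω x) x (unitVec i) =
      χ x * dpart i (realisation h ω) x + dpart i χ x * realisation h ω x :=
      fun x => dpart_mul hχ.1 (hh ω) i x
    simp_rw [h2, ← realisation_pd, mul_add] at h1
    rw [integral_add] at h1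
    · simp only [realisation] at h1
      simp only [id]
      rw [show ∫ x, χ x * (g (x +ᵥ ω) * h (x +ᵥ ω)) = ∫ x, g (x +ᵥ ω) * (χ x * h (x +ᵥ ω)) from
        by congr 1; ext x; ring]
      rw [eq_comm, neg_eq_iff_eq_neg, ← h1]
      congr 1 <;> (congr 1; ext x; ring)
    · simp_rw [realisation_pd]
      exact LocallyIntegrable.integrable_mul_test hω.1 (hχ.mul (contDiff_dpart (hh ω) i))
    · exact LocallyIntegrable.integrable_mul_test hω.1 ((hχ.dpart i).mul (hh ω))
  rw [integral_congr_ae key, integral_neg, integral_add k3 k2, e2, add_zero]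

end Shift

/-! ### Derivatives of convolutions with bounded functions. -/

section ConvolutionBounds

variable {d : ℕ}

lemma locallyIntegrable_of_bounded {h : Euc d → ℝ} (hm : Measurable h) {M : ℝ}
    (hM : ∀ x, |h x| ≤ M) : LocallyIntegrable h :=
  (locallyIntegrable_const M).mono hm.aestronglyMeasurable
    (.of_forall fun x => by simpa using (hM x).trans (le_abs_self M))

/-- All derivatives fall on the kernel, so the constant depends on `h` only through `M`. The kernel
is vector-valued because the induction replaces `ρ` by `fderiv ℝ ρ`. -/
lemma exists_norm_iteratedFDeriv_convolution_le (n : ℕ) (M : ℝ) :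
    ∀ {E F : Type} [NormedAddCommGroup E] [NormedSpace ℝ E] [NormedAddCommGroup F] [NormedSpace ℝ F]
      (L : E →L[ℝ] ℝ →L[ℝ] F) {ρ : Euc d → E}, ContDiff ℝ (⊤ : ℕ∞) ρ → HasCompactSupport ρ →
      ∃ C : ℝ, ∀ h : Euc d → ℝ, Measurable h → (∀ x, |h x| ≤ M) →
        ∀ x, ‖iteratedFDeriv ℝ n (ρ ⋆[L, volume] h) x‖ ≤ C := by
  induction n with
  | zero =>
    intro E F _ _ _ _ L ρ hρ hρ'
    refine ⟨∫ t, ‖L‖ * ‖ρ t‖ * M, fun h hm hM x => ?_⟩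
    rw [norm_iteratedFDeriv_zero, convolution_def]
    have hi : Integrable (fun t => ‖L‖ * ‖ρ t‖ * M) :=
      ((hρ.continuous.integrable_of_hasCompactSupport hρ').norm.const_mul _).mul_const _
    refine norm_integral_le_of_norm_le hi (.of_forall fun t => ?_)
    refine (L.le_opNorm₂ _ _).trans ?_
    gcongr
    exact hM _
  | succ n ih =>
    intro E F _ _ _ _ L ρ hρ hρ'
    obtain ⟨C, hC⟩ := ih (L.precompL (Euc d)) (ρ := fderiv ℝ ρ)
      (hρ.fderiv_right (m := (⊤ : ℕ∞)) (by simp)) (hρ'.fderiv ℝ)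
    refine ⟨C, fun h hm hM x => ?_⟩
    rw [← norm_iteratedFDeriv_fderiv]
    have : fderiv ℝ (ρ ⋆[L, volume] h) = (fderiv ℝ ρ ⋆[L.precompL (Euc d), volume] h) := by
      ext1 y
      exact (hρ'.hasFDerivAt_convolution_left L (hρ.of_le (by simp))
        (locallyIntegrable_of_bounded hm hM) y).fderiv
    rw [this]
    exact hC h hm hM x

lemma dpart_convolution {ρ h : Euc d → ℝ} (hρ : IsTest ρ) (hh : LocallyIntegrable h) (i : Fin d) :
    dpart i (ρ ⋆[ContinuousLinearMap.lsmul ℝ ℝ, volume] h) =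
      (dpart i ρ ⋆[ContinuousLinearMap.lsmul ℝ ℝ, volume] h) := by
  ext x
  unfold dpart
  rw [(hρ.2.hasFDerivAt_convolution_left (ContinuousLinearMap.lsmul ℝ ℝ) (hρ.1.of_le (by simp))
    hh x).fderiv]
  have hi := (hρ.2.fderiv ℝ).convolutionExists_left ((ContinuousLinearMap.lsmul ℝ ℝ :
    ℝ →L[ℝ] ℝ →L[ℝ] ℝ).precompL (Euc d)) (hρ.1.continuous_fderiv (by simp)) hh x
  rw [convolution_def, ContinuousLinearMap.integral_apply hi]
  rfl

end ConvolutionBounds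

/-! ### The smooth class `𝔻_s`: closure properties and examples. -/

section Smooth

variable {d : ℕ} {Ω : Type*} [MeasurableSpace Ω] [AddAction (Euc d) Ω]
  [MeasurableVAdd₂ (Euc d) Ω] {P : Measure Ω} [IsProbabilityMeasure P]
  [VAddInvariantMeasure (Euc d) Ω P]

lemma norm_unitVec (i : Fin d) : ‖(unitVec i : Euc d)‖ = 1 := by simp [unitVec]

lemma memLp_of_abs_le {f : Ω → ℝ} (hf : Measurable f) {C : ℝ} (hC : ∀ ω, |f ω| ≤ C) (p : ℝ≥0∞) :
    MemLp f p P :=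
  MemLp.of_bound hf.aestronglyMeasurable C (.of_forall fun ω => hC ω)

lemma abs_pd_le (i : Fin d) {f : Ω → ℝ} {C : ℝ} {ω : Ω}
    (hC : ‖iteratedFDeriv ℝ 1 (realisation f ω : Euc d → ℝ) 0‖ ≤ C) : |pd i f ω| ≤ C := by
  rw [← norm_iteratedFDeriv_fderiv, norm_iteratedFDeriv_zero] at hC
  unfold pd dpart
  rw [← Real.norm_eq_abs]
  refine (ContinuousLinearMap.le_opNorm _ _).trans ?_
  rw [norm_unitVec, mul_one]
  exact hC

lemma weakPartial_ae_eq_pd (i : Fin d) {f : Ω → ℝ} (hm : Measurable f)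
    (hf : ∀ ω, ContDiff ℝ (⊤ : ℕ∞) (realisation f ω : Euc d → ℝ)) :
    weakPartial P i f =ᵐ[P] pd i f :=
  (isWeakPartial_pd i hm hf).weakPartial_ae_eq

/-- Bounded functions are square integrable under a probability measure and classical partials are
weak ones, so membership in `𝔻_w` comes for free. -/
lemma mem_Ds_of {f : Ω → ℝ} (hm : Measurable f)
    (hf : ∀ ω, ContDiff ℝ (⊤ : ℕ∞) (realisation f ω : Euc d → ℝ))
    (hC : ∀ n : ℕ, ∃ C : ℝ, ∀ ω, ‖iteratedFDeriv ℝ n (realisation f ω : Euc d → ℝ) 0‖ ≤ C) :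
    f ∈ Ds d P := by
  have h2 : MemLp f 2 P := by
    obtain ⟨C, hC⟩ := hC 0
    refine memLp_of_abs_le hm (C := C) (fun ω => ?_) 2
    simpa [realisation] using hC ω
  refine ⟨⟨hm, h2, fun i => ⟨hm, h2, ⟨_, isWeakPartial_pd i hm hf⟩, ?_⟩⟩, hf, hC⟩
  obtain ⟨C, hC⟩ := hC 1
  exact (memLp_of_abs_le (measurable_pd i hm hf) (fun ω => abs_pd_le i (hC ω)) 2).ae_eq
    (weakPartial_ae_eq_pd i hm hf).symm

section DsApi
variable {f : Ω → ℝ} (hf : f ∈ Ds d P)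
include hf

lemma measurable_of_mem_Ds : Measurable f := hf.1.1

lemma contDiff_of_mem_Ds (ω : Ω) : ContDiff ℝ (⊤ : ℕ∞) (realisation f ω : Euc d → ℝ) := hf.2.1 ω

lemma exists_bound_of_mem_Ds : ∃ C : ℝ, ∀ ω, |f ω| ≤ C := by
  obtain ⟨C, hC⟩ := hf.2.2 0
  exact ⟨C, fun ω => by simpa [realisation] using hC ω⟩

lemma exists_bound_pd_of_mem_Ds (i : Fin d) : ∃ C : ℝ, ∀ ω, |pd i f ω| ≤ C := by
  obtain ⟨C, hC⟩ := hf.2.2 1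
  exact ⟨C, fun ω => abs_pd_le i (hC ω)⟩

lemma weakPartial_of_mem_Ds (i : Fin d) : weakPartial P i f =ᵐ[P] pd i f :=
  weakPartial_ae_eq_pd i (measurable_of_mem_Ds hf) (contDiff_of_mem_Ds hf)

lemma pd_mem_Ds (i : Fin d) : pd i f ∈ Ds d P := by
  have hs : ∀ ω, ContDiff ℝ (⊤ : ℕ∞) (realisation (pd i f) ω : Euc d → ℝ) := fun ω => by
    rw [realisation_pd]; exact contDiff_dpart (contDiff_of_mem_Ds hf ω) i
  refine mem_Ds_of (measurable_pd i hf.1.1 hf.2.1) hs fun n => ?_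
  obtain ⟨C, hC⟩ := hf.2.2 (n + 1)
  refine ⟨C, fun ω => ?_⟩
  rw [realisation_pd]
  -- The partial derivative is the full derivative followed by evaluation at a unit vector, of norm
  -- at most one; order `n` is controlled by order `n + 1`.
  let A : (Euc d →L[ℝ] ℝ) →L[ℝ] ℝ := ContinuousLinearMap.apply ℝ ℝ (unitVec i)
  have hA : ‖A‖ ≤ 1 := ContinuousLinearMap.opNorm_le_bound _ zero_le_one fun L => by
    have := L.le_opNorm (unitVec i)
    rw [norm_unitVec] at this
    simpa [A] using this
  have e : dpart i (realisation f ω) = A ∘ fderiv ℝ (realisation f ω : Euc d → ℝ) := rfl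
  have hs' : ContDiff ℝ (⊤ : ℕ∞) (fderiv ℝ (realisation f ω : Euc d → ℝ)) :=
    (hf.2.1 ω).fderiv_right (m := (⊤ : ℕ∞)) (by simp)
  have h1 := A.norm_iteratedFDeriv_comp_left (f := fderiv ℝ (realisation f ω : Euc d → ℝ))
    (N := (⊤ : ℕ∞)) (n := n) (x := 0) hs'.contDiffAt (by exact_mod_cast le_top)
  rw [e]
  refine h1.trans ?_
  rw [norm_iteratedFDeriv_fderiv]
  calc _ ≤ 1 * ‖iteratedFDeriv ℝ (n + 1) (realisation f ω : Euc d → ℝ) 0‖ := by gcongr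
    _ ≤ C := by rw [one_mul]; exact hC ω

end DsApi

lemma add_mem_Ds {f g : Ω → ℝ} (hf : f ∈ Ds d P) (hg : g ∈ Ds d P) : f + g ∈ Ds d P := by
  refine mem_Ds_of (hf.1.1.add hg.1.1) (fun ω => (hf.2.1 ω).add (hg.2.1 ω)) fun n => ?_
  obtain ⟨C, hC⟩ := hf.2.2 n
  obtain ⟨C', hC'⟩ := hg.2.2 n
  refine ⟨C + C', fun ω => ?_⟩
  have e : (realisation (f + g) ω : Euc d → ℝ) = realisation f ω + realisation g ω := rfl
  rw [e, iteratedFDeriv_add (((hf.2.1 ω).of_le (by exact_mod_cast le_top)))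
    (((hg.2.1 ω).of_le (by exact_mod_cast le_top)))]
  exact (norm_add_le _ _).trans (add_le_add (hC ω) (hC' ω))

lemma smul_mem_Ds (c : ℝ) {f : Ω → ℝ} (hf : f ∈ Ds d P) : c • f ∈ Ds d P := by
  refine mem_Ds_of (hf.1.1.const_smul c) (fun ω => (hf.2.1 ω).const_smul c) fun n => ?_
  obtain ⟨C, hC⟩ := hf.2.2 n
  refine ⟨‖c‖ * C, fun ω => ?_⟩
  have e : (realisation (c • f) ω : Euc d → ℝ) = c • realisation f ω := rfl
  rw [e, iteratedFDeriv_const_smul_apply ((hf.2.1 ω).contDiffAt.of_le (by exact_mod_cast le_top)),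
    norm_smul]
  gcongr
  exact hC ω

/-- Realisations are constant. Without ergodicity these functions need not be constant on `Ω`; they
enter the Helmholtz decomposition as components of solenoidal fields. -/
lemma mem_Ds_of_invariant {f : Ω → ℝ} (hm : Measurable f) {C : ℝ} (hC : ∀ ω, |f ω| ≤ C)
    (hf : ∀ (x : Euc d) ω, f (x +ᵥ ω) = f ω) : f ∈ Ds d P := by
  have e : ∀ ω, (realisation f ω : Euc d → ℝ) = fun _ => f ω := fun ω => funext fun x => hf x ω
  refine mem_Ds_of hm (fun ω => by rw [e]; exact contDiff_const) fun n => ?_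
  rcases n with _ | n
  · exact ⟨C, fun ω => by simpa [realisation] using hC ω⟩
  · refine ⟨0, fun ω => ?_⟩
    rw [e, iteratedFDeriv_const_of_ne (by simp)]
    simp

lemma const_mem_Ds (c : ℝ) : (fun _ => c : Ω → ℝ) ∈ Ds d P :=
  mem_Ds_of_invariant measurable_const (fun _ => le_refl |c|) fun _ _ => rfl

lemma zero_mem_Ds : (0 : Ω → ℝ) ∈ Ds d P := const_mem_Ds 0

/-! ### Averages along the action -/

/-- The convolution of `f` with `ρ` along the action. -/
noncomputable def avg (ρ : Euc d → ℝ) (f : Ω → ℝ) (ω : Ω) : ℝ := ∫ x, ρ x * f (-x +ᵥ ω)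

/-- The sign in `-x +ᵥ ω` is what makes this an ordinary convolution on each orbit. -/
lemma realisation_avg (ρ : Euc d → ℝ) (f : Ω → ℝ) (ω : Ω) :
    (realisation (avg ρ f) ω : Euc d → ℝ) =
      (ρ ⋆[ContinuousLinearMap.lsmul ℝ ℝ, volume] realisation f ω) := by
  ext y
  simp [realisation, avg, convolution_def, vadd_vadd, neg_add_eq_sub]

lemma measurable_avg {ρ : Euc d → ℝ} (hρ : Measurable ρ) {f : Ω → ℝ} (hf : Measurable f) :
    Measurable (avg ρ f) := by
  have : StronglyMeasurable (fun q : Ω × Euc d => ρ q.2 * f (-q.2 +ᵥ q.1)) := by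
    refine Measurable.stronglyMeasurable ?_
    exact (hρ.comp measurable_snd).mul (hf.comp ((measurable_snd.neg).vadd measurable_fst))
  exact this.integral_prod_right'.measurable

lemma pd_avg {ρ : Euc d → ℝ} (hρ : IsTest ρ) {f : Ω → ℝ} (hf : Measurable f) {C : ℝ}
    (hC : ∀ ω, |f ω| ≤ C) (i : Fin d) : pd i (avg ρ f) = avg (dpart i ρ) f := by
  ext ω
  have h := dpart_convolution hρ (locallyIntegrable_of_bounded (measurable_realisation hf ω)
    fun x => hC _) i
  rw [← realisation_avg, ← realisation_avg] at h
  simpa [realisation, pd] using congrFun h 0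

lemma avg_mem_Ds {ρ : Euc d → ℝ} (hρ : IsTest ρ) {f : Ω → ℝ} (hf : Measurable f) {C : ℝ}
    (hC : ∀ ω, |f ω| ≤ C) : avg ρ f ∈ Ds d P := by
  refine mem_Ds_of (measurable_avg hρ.continuous.measurable hf) (fun ω => ?_) fun n => ?_
  · rw [realisation_avg]
    exact hρ.2.contDiff_convolution_left _ hρ.1
      (locallyIntegrable_of_bounded (measurable_realisation hf ω) fun x => hC _)
  · obtain ⟨C', hC'⟩ := exists_norm_iteratedFDeriv_convolution_le n C
      (ContinuousLinearMap.lsmul ℝ ℝ) hρ.1 hρ.2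
    refine ⟨C', fun ω => ?_⟩
    rw [realisation_avg]
    exact hC' _ (measurable_realisation hf ω) (fun x => hC _) 0

end Smooth

/-! ### Averages along the action as operators on `L²`, and smooth approximation. -/

section Average

variable {d : ℕ} {Ω : Type*} [MeasurableSpace Ω] [AddAction (Euc d) Ω]
  [MeasurableVAdd₂ (Euc d) Ω] {P : Measure Ω} [IsProbabilityMeasure P]
  [VAddInvariantMeasure (Euc d) Ω P]

lemma measurable_neg_euc : Measurable (fun x : Euc d => -x) := measurable_neg

lemma avg_congr {ρ : Euc d → ℝ} {f f' : Ω → ℝ} (h : f =ᵐ[P] f') : avg ρ f =ᵐ[P] avg ρ f' := by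
  filter_upwards [ae_ae_vadd (d := d) h] with ω hω
  have h1 := (Measure.measurePreserving_neg (volume : Measure (Euc d))).quasiMeasurePreserving.ae hω
  exact integral_congr_ae (by filter_upwards [h1] with x hx; rw [hx])

lemma integral_avg {ρ : Euc d → ℝ} (hρ : IsTest ρ) {f : Ω → ℝ} (hf : Integrable f P) :
    ∫ ω, avg ρ f ω ∂P = (∫ x, ρ x) * ∫ ω, f ω ∂P :=
  integral_integral_mul_skew measurable_neg_euc hρ.integrable hf

lemma integrable_avg {ρ : Euc d → ℝ} (hρ : IsTest ρ) {f : Ω → ℝ} (hf : Integrable f P) :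
    Integrable (avg ρ f) P :=
  (integrable_mul_skew (P := P) measurable_neg_euc hρ.integrable hf).swap.integral_prod_left

lemma memLp_vadd (x : Euc d) {f : Ω → ℝ} {p : ℝ≥0∞} (hf : MemLp f p P) :
    MemLp (fun ω => f (x +ᵥ ω)) p P :=
  hf.comp_measurePreserving (measurePreserving_vadd x P)

/-- The product is dominated by `g² + f²`, and the shifted `f²` has the same integral as `f²`. This
licenses Fubini for the pairings below. -/
lemma integrable_pairing {ρ : Euc d → ℝ} (hρ : IsTest ρ) {f g : Ω → ℝ} (hf : MemLp f 2 P)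
    (hg : MemLp g 2 P) :
    Integrable (fun q : Euc d × Ω => ρ q.1 * (g q.2 * f (-q.1 +ᵥ q.2))) (volume.prod P) := by
  have h1 := (integrable_mul_skew (P := P) (d := d) measurable_neg_euc hρ.integrable
    hf.integrable_sq).norm
  have h2 := (hρ.integrable.mul_prod hg.integrable_sq).norm
  have m := hρ.continuous.aestronglyMeasurable (μ := (volume : Measure (Euc d)))
  refine (h1.add h2).mono' ?_ (.of_forall fun q => ?_)
  · refine (m.comp_quasiMeasurePreserving Measure.quasiMeasurePreserving_fst).mul
      ((hg.1.comp_quasiMeasurePreserving Measure.quasiMeasurePreserving_snd).mul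
      (hf.1.comp_quasiMeasurePreserving (measurePreserving_snd_skew measurable_neg_euc)))
  · simp only [Pi.add_apply, norm_mul, ← mul_add, norm_pow]
    gcongr
    nlinarith [sq_nonneg (‖g q.2‖ - ‖f (-q.1 +ᵥ q.2)‖), sq_nonneg ‖g q.2‖,
      sq_nonneg ‖f (-q.1 +ᵥ q.2)‖]

lemma integrable_mul_avg {ρ : Euc d → ℝ} (hρ : IsTest ρ) {f g : Ω → ℝ} (hf : MemLp f 2 P)
    (hg : MemLp g 2 P) : Integrable (fun ω => g ω * avg ρ f ω) P := by
  have := (integrable_pairing hρ hf hg).swap.integral_prod_left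
  refine this.congr (.of_forall fun ω => ?_)
  simp only [Function.comp_def, Prod.swap, avg]
  rw [← integral_const_mul]
  congr 1; ext x; ring

lemma integral_mul_avg {ρ : Euc d → ℝ} (hρ : IsTest ρ) {f g : Ω → ℝ} (hf : MemLp f 2 P)
    (hg : MemLp g 2 P) :
    ∫ ω, g ω * avg ρ f ω ∂P = ∫ x, ρ x * ∫ ω, g ω * f (-x +ᵥ ω) ∂P := by
  have h1 := integral_integral_swap (f := fun x ω => ρ x * (g ω * f (-x +ᵥ ω)))
    (integrable_pairing hρ hf hg)
  simp_rw [integral_const_mul] at h1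
  rw [h1]
  congr 1; ext ω
  rw [avg, ← integral_const_mul]
  congr 1; ext x; ring

/-- The adjoint of averaging is averaging with the reflected kernel: substitute `x ↦ -x` and move
the shift to the other factor by invariance. -/
lemma integral_mul_avg_comm {ρ : Euc d → ℝ} (hρ : IsTest ρ) {f g : Ω → ℝ} (hf : MemLp f 2 P)
    (hg : MemLp g 2 P) :
    ∫ ω, g ω * avg ρ f ω ∂P = ∫ ω, f ω * avg (fun x => ρ (-x)) g ω ∂P := by
  rw [integral_mul_avg hρ hf hg, integral_mul_avg hρ.comp_neg hg hf, ← integral_neg_eq_self]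
  congr 1; ext x
  congr 1
  rw [neg_neg, ← integral_vadd (-x)]
  congr 1; ext ω
  rw [vadd_vadd, add_neg_cancel, zero_vadd, mul_comm]

/-- The weak derivative of the realisation is tested against `x ↦ ρ (-x)`; the sign from the
reflection cancels the one from integration by parts. -/
lemma IsWeakPartial.avg_dpart {i : Fin d} {f g : Ω → ℝ} (h : IsWeakPartial P i f g)
    {ρ : Euc d → ℝ} (hρ : IsTest ρ) : avg (dpart i ρ) f =ᵐ[P] avg ρ g := by
  filter_upwards [h.2] with ω hω
  have h1 := hω.2.2 _ hρ.comp_neg.1 hρ.comp_neg.2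
  have e : ∀ x, fderiv ℝ (fun x => ρ (-x)) x (unitVec i) = - dpart i ρ (-x) :=
    fun x => dpart_comp_neg i ρ x
  simp_rw [e, mul_neg, integral_neg, neg_inj] at h1
  rw [← integral_neg_eq_self, ← integral_neg_eq_self (fun x => realisation g ω x * _)] at h1
  simpa [avg, realisation, mul_comm] using h1

/-! ### Mollification -/

/-- A sequence of bump functions shrinking to the origin. -/
noncomputable def bump (d : ℕ) (n : ℕ) : ContDiffBump (0 : Euc d) :=
  ⟨1 / ((n : ℝ) + 1), 2 * (1 / ((n : ℝ) + 1)), by positivity, by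
    have : (0 : ℝ) < 1 / ((n : ℝ) + 1) := by positivity
    linarith⟩

/-- A sequence of mollifiers. -/
noncomputable def moll (d : ℕ) (n : ℕ) : Euc d → ℝ := (bump d n).normed volume

lemma isTest_moll (n : ℕ) : IsTest (moll d n) :=
  ⟨(bump d n).contDiff_normed, (bump d n).hasCompactSupport_normed⟩

lemma moll_nonneg (n : ℕ) (x : Euc d) : 0 ≤ moll d n x := (bump d n).nonneg_normed x

lemma integral_moll (n : ℕ) : ∫ x, moll d n x = 1 := (bump d n).integral_normed

lemma tendsto_bump_rOut : Tendsto (fun n => (bump d n).rOut) atTop (𝓝 0) := by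
  simpa [bump] using (tendsto_one_div_add_atTop_nhds_zero_nat (𝕜 := ℝ)).const_mul 2

/-- Lebesgue differentiation on almost every orbit, transferred back to `Ω`. -/
lemma tendsto_avg_moll {f : Ω → ℝ} (hm : Measurable f) (hf : Integrable f P) :
    ∀ᵐ ω ∂P, Tendsto (fun n => avg (moll d n) f ω) atTop (𝓝 (f ω)) := by
  refine ae_of_ae_ae_vadd (d := d) ?_ ?_
  · exact measurableSet_tendsto_fun
      (fun n => measurable_avg (isTest_moll n).continuous.measurable hm) hm
  · filter_upwards [ae_locallyIntegrable (d := d) hf] with ω hω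
    -- The bumps have outer radius twice the inner one; this fixed ratio is the `K`.
    have := ContDiffBump.ae_convolution_tendsto_right_of_locallyIntegrable (φ := bump d)
      (K := 2) tendsto_bump_rOut (.of_forall fun n => by simp [bump]) hω
    filter_upwards [this] with x hx
    refine hx.congr fun n => ?_
    exact (congrFun (realisation_avg (moll d n) f ω) x).symm

lemma avg_moll_mem_Icc {f : Ω → ℝ} (hm : Measurable f) {a b : ℝ} (hf : ∀ ω, f ω ∈ Set.Icc a b)
    (n : ℕ) (ω : Ω) : avg (moll d n) f ω ∈ Set.Icc a b := by
  have i1 := (isTest_moll (d := d) n).integrable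
  have i2 : Integrable (fun x : Euc d => moll d n x * f (-x +ᵥ ω)) := by
    refine i1.mul_bdd (c := max |a| |b|) ?_ (.of_forall fun x => ?_)
    · exact (hm.comp (measurable_neg.vadd_const ω)).aestronglyMeasurable
    · exact abs_le_max_abs_abs (hf _).1 (hf _).2
  constructor
  · calc a = ∫ x, moll d n x * a := by rw [integral_mul_const, integral_moll, one_mul]
      _ ≤ _ := integral_mono (i1.mul_const a) i2 fun x =>
        mul_le_mul_of_nonneg_left (hf _).1 (moll_nonneg n x)
  · calc _ ≤ ∫ x, moll d n x * b := integral_mono i2 (i1.mul_const b) fun x =>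
        mul_le_mul_of_nonneg_left (hf _).2 (moll_nonneg n x)
      _ = b := by rw [integral_mul_const, integral_moll, one_mul]

/-- Truncation to the interval `[a, b]`. -/
noncomputable def clip (a b : ℝ) (f : Ω → ℝ) (ω : Ω) : ℝ := max a (min b (f ω))

lemma measurable_clip (a b : ℝ) {f : Ω → ℝ} (hf : Measurable f) : Measurable (clip a b f) :=
  measurable_const.max (measurable_const.min hf)

lemma clip_mem {a b : ℝ} (hab : a ≤ b) (f : Ω → ℝ) (ω : Ω) : clip a b f ω ∈ Set.Icc a b :=
  ⟨le_max_left _ _, max_le hab (min_le_left _ _)⟩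

lemma clip_eq {a b : ℝ} {f : Ω → ℝ} {ω : Ω} (h : f ω ∈ Set.Icc a b) : clip a b f ω = f ω := by
  simp [clip, h.1, h.2]

lemma exists_ae_bound {f : Ω → ℝ} (hf : MemLp f ∞ P) : ∃ C : ℝ, 0 ≤ C ∧ ∀ᵐ ω ∂P, |f ω| ≤ C := by
  refine ⟨(eLpNorm f ∞ P).toReal, ENNReal.toReal_nonneg, ?_⟩
  have h := ae_le_eLpNormEssSup (f := f) (μ := P)
  have h2 := hf.2
  rw [← eLpNorm_exponent_top] at h
  filter_upwards [h] with ω hω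
  have := ENNReal.toReal_mono h2.ne hω
  simpa using this

/-- A bounded function with bounded weak gradient is approximated by smooth ones. -/
lemma exists_smooth_approx {f : Ω → ℝ} (hf : f ∈ Dw d P) (hb : MemLp f ∞ P)
    (hb' : ∀ i : Fin d, MemLp (weakPartial P i f) ∞ P) {c : ℝ} (hc : ∀ᵐ ω ∂P, c ≤ f ω) :
    ∃ (u : ℕ → Ω → ℝ) (C : ℝ), (∀ n, u n ∈ Ds d P) ∧ (∀ n ω, c ≤ u n ω) ∧ (∀ n ω, |u n ω| ≤ C) ∧
      (∀ n, ∫ ω, u n ω ∂P = ∫ ω, f ω ∂P) ∧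
      (∀ᵐ ω ∂P, Tendsto (fun n => u n ω) atTop (𝓝 (f ω))) ∧
      ∀ i : Fin d, (∀ n, ∀ᵐ ω ∂P, |pd i (u n) ω| ≤ C) ∧
        ∀ᵐ ω ∂P, Tendsto (fun n => pd i (u n) ω) atTop (𝓝 (weakPartial P i f ω)) := by
  obtain ⟨C₀, hC₀, hfC⟩ := exists_ae_bound hb
  choose B hB0 hB using fun i => exists_ae_bound (hb' i)
  set C := max C₀ |c| + ∑ i, B i with hC
  have hBn : 0 ≤ ∑ i, B i := Finset.sum_nonneg fun i _ => hB0 i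
  have hC0C : C₀ ≤ C := by linarith [le_max_left C₀ |c|]
  have hcC : |c| ≤ C := by linarith [le_max_right C₀ |c|]
  have hBC : ∀ i, B i ≤ C := fun i => by
    linarith [le_max_left C₀ |c|, Finset.single_le_sum (fun j _ => hB0 j) (Finset.mem_univ i)]
  have hC0 : 0 ≤ C := hC₀.trans hC0C
  -- Clipping turns the almost sure bounds into bounds at every `ω`, as `𝔻_s` requires, and changes
  -- `f` only on a null set.
  set f' := clip c C f
  have hf'm : Measurable f' := measurable_clip c C hf.1
  have hf'I : ∀ ω, f' ω ∈ Set.Icc c C := clip_mem ((le_abs_self c).trans hcC) f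
  have hf' : f' =ᵐ[P] f := by
    filter_upwards [hc, hfC] with ω h1 h2
    exact clip_eq ⟨h1, (le_abs_self _).trans (h2.trans hC0C)⟩
  have hbd : ∀ x, x ∈ Set.Icc c C → |x| ≤ C := fun x hx =>
    abs_le.2 ⟨by linarith [neg_abs_le c, hx.1], hx.2⟩
  have hfi : Integrable f P := hf.2.1.integrable one_le_two
  refine ⟨fun n => avg (moll d n) f', C, fun n => avg_mem_Ds (isTest_moll n) hf'm
    (fun ω => hbd _ (hf'I ω)), fun n ω => (avg_moll_mem_Icc hf'm hf'I n ω).1,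
    fun n ω => hbd _ (avg_moll_mem_Icc hf'm hf'I n ω), fun n => ?_, ?_, fun i => ?_⟩
  · rw [integral_congr_ae (avg_congr hf'), integral_avg (isTest_moll n) hfi, integral_moll,
      one_mul]
  · filter_upwards [tendsto_avg_moll (d := d) hf.1 hfi,
      ae_all_iff.2 fun n => avg_congr (ρ := moll d n) hf'] with ω h1 h2
    exact h1.congr fun n => (h2 n).symm
  · set g := weakPartial P i f
    set g' := clip (-C) C g
    have hgm : Measurable g := measurable_weakPartial i f
    have hg'm : Measurable g' := measurable_clip _ _ hgm
    have hg'I : ∀ ω, g' ω ∈ Set.Icc (-C) C := clip_mem (by linarith) g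
    have hg' : g' =ᵐ[P] g := by
      filter_upwards [hB i] with ω h2
      exact clip_eq (abs_le.1 (h2.trans (hBC i)))
    have hgi : Integrable g P := (hf.2.2 i).2.2.2.integrable one_le_two
    -- The classical derivative of the mollification is the mollification of the weak derivative, so
    -- it inherits the bound and the almost sure convergence.
    have key : ∀ n, pd i (avg (moll d n) f') =ᵐ[P] avg (moll d n) g' := fun n => by
      rw [pd_avg (isTest_moll n) hf'm (fun ω => hbd _ (hf'I ω))]
      exact (avg_congr hf').trans
        (((hf.2.2 i).2.2.1.isWeakPartial.avg_dpart (isTest_moll n)).trans (avg_congr hg').symm)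
    refine ⟨fun n => ?_, ?_⟩
    · filter_upwards [key n] with ω h1
      rw [h1]
      exact abs_le.2 (avg_moll_mem_Icc hg'm hg'I n ω)
    · filter_upwards [tendsto_avg_moll (d := d) hgm hgi, ae_all_iff.2 key,
        ae_all_iff.2 fun n => avg_congr (ρ := moll d n) hg'] with ω h1 h2 h3
      exact h1.congr fun n => ((h2 n).trans (h3 n)).symm

end Average

/-! ### `L²` convergence of products and quotients. -/

section SquareIntegrable

variable {Ω : Type*} [MeasurableSpace Ω] {P : Measure Ω} [IsProbabilityMeasure P]

lemma eLpNorm_two_eq {h : Ω → ℝ} (hh : MemLp h 2 P) :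
    eLpNorm h 2 P = ENNReal.ofReal (Real.sqrt (∫ ω, h ω ^ 2 ∂P)) := by
  rw [hh.eLpNorm_eq_integral_rpow_norm (by norm_num) (by norm_num), Real.sqrt_eq_rpow]
  simp

lemma tendsto_eLpNorm_two_iff {h : ℕ → Ω → ℝ} (hh : ∀ n, MemLp (h n) 2 P) :
    Tendsto (fun n => eLpNorm (h n) 2 P) atTop (𝓝 0) ↔
      Tendsto (fun n => ∫ ω, h n ω ^ 2 ∂P) atTop (𝓝 0) := by
  simp_rw [fun n => eLpNorm_two_eq (hh n)]
  constructor
  · intro h1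
    have h2 := (ENNReal.tendsto_toReal ENNReal.zero_ne_top).comp h1
    have h3 := h2.pow 2
    simpa [Function.comp_def, Real.sqrt_nonneg, Real.sq_sqrt (integral_nonneg fun ω => sq_nonneg _)]
      using h3
  · intro h1
    have := ENNReal.tendsto_ofReal ((Real.continuous_sqrt.tendsto 0).comp h1)
    simpa [Function.comp_def] using this

lemma integral_abs_mul_le {f g : Ω → ℝ} (hf : MemLp f 2 P) (hg : MemLp g 2 P) :
    ∫ ω, |f ω| * |g ω| ∂P ≤ Real.sqrt (∫ ω, f ω ^ 2 ∂P) * Real.sqrt (∫ ω, g ω ^ 2 ∂P) := by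
  have := integral_mul_norm_le_Lp_mul_Lq (μ := P) (f := f) (g := g) (p := 2) (q := 2)
    (by constructor <;> norm_num) (by simpa using hf) (by simpa using hg)
  simpa [Real.sqrt_eq_rpow] using this

lemma integrable_mul_of_memLp {f g : Ω → ℝ} (hf : MemLp f 2 P) (hg : MemLp g 2 P) :
    Integrable (fun ω => f ω * g ω) P := hf.integrable_mul hg

lemma tendsto_integral_abs_mul {h : ℕ → Ω → ℝ} {W : Ω → ℝ} (hW : MemLp W 2 P)
    (hh : ∀ n, MemLp (h n) 2 P)
    (h0 : Tendsto (fun n => ∫ ω, h n ω ^ 2 ∂P) atTop (𝓝 0)) :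
    Tendsto (fun n => ∫ ω, |W ω| * |h n ω| ∂P) atTop (𝓝 0) := by
  have h1 : Tendsto (fun n => Real.sqrt (∫ ω, W ω ^ 2 ∂P) * Real.sqrt (∫ ω, h n ω ^ 2 ∂P)) atTop
      (𝓝 0) := by
    simpa [Function.comp_def] using ((Real.continuous_sqrt.tendsto 0).comp h0).const_mul
      (Real.sqrt (∫ ω, W ω ^ 2 ∂P))
  exact squeeze_zero (fun n => integral_nonneg fun ω => by positivity)
    (fun n => integral_abs_mul_le hW (hh n)) h1

lemma tendsto_integral_abs {h : ℕ → Ω → ℝ} (hh : ∀ n, MemLp (h n) 2 P)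
    (h0 : Tendsto (fun n => ∫ ω, h n ω ^ 2 ∂P) atTop (𝓝 0)) :
    Tendsto (fun n => ∫ ω, |h n ω| ∂P) atTop (𝓝 0) := by
  simpa using tendsto_integral_abs_mul (memLp_const (1 : ℝ)) hh h0

lemma tendsto_integral_of_abs_sub_le {F : ℕ → Ω → ℝ} {F₀ : Ω → ℝ} {B : ℕ → Ω → ℝ}
    (hF : ∀ n, Integrable (F n) P) (hF₀ : Integrable F₀ P) (hB : ∀ n, Integrable (B n) P)
    (h : ∀ n, ∀ᵐ ω ∂P, |F n ω - F₀ ω| ≤ B n ω)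
    (h0 : Tendsto (fun n => ∫ ω, B n ω ∂P) atTop (𝓝 0)) :
    Tendsto (fun n => ∫ ω, F n ω ∂P) atTop (𝓝 (∫ ω, F₀ ω ∂P)) := by
  rw [tendsto_iff_norm_sub_tendsto_zero]
  refine squeeze_zero (fun n => norm_nonneg _) (fun n => ?_) h0
  rw [← integral_sub (hF n) hF₀]
  exact norm_integral_le_of_norm_le (hB n) (h n)

lemma integrable_sq_div {a s : Ω → ℝ} (ha : MemLp a 2 P) (hs : AEStronglyMeasurable s P)
    {c : ℝ} (hc : 0 < c) (h : ∀ᵐ ω ∂P, c < s ω) : Integrable (fun ω => a ω ^ 2 / s ω) P := by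
  simp_rw [div_eq_mul_inv]
  refine ha.integrable_sq.mul_bdd (c := c⁻¹) hs.aemeasurable.inv.aestronglyMeasurable ?_
  filter_upwards [h] with ω hω
  rw [norm_inv, Real.norm_of_nonneg (hc.trans hω).le]
  exact inv_anti₀ hc hω.le

lemma abs_sq_div_sub_le {a b s t c B : ℝ} (hc : 0 < c) (hs : c < s) (ht : c < t) (hB : |b| ≤ B) :
    |a ^ 2 / s - b ^ 2 / t| ≤
      c⁻¹ * ((a - b) ^ 2 + 2 * B * |a - b|) + B ^ 2 / c ^ 2 * |s - t| := by
  have hs0 := hc.trans hs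
  have ht0 := hc.trans ht
  have hB0 := (abs_nonneg b).trans hB
  -- The numerator difference is expanded around `b`, so that only `b` has to be bounded, not `a`.
  have e : a ^ 2 / s - b ^ 2 / t = s⁻¹ * ((a - b) ^ 2 + 2 * b * (a - b)) +
      b ^ 2 * ((s * t)⁻¹ * (t - s)) := by
    field_simp; ring
  rw [e]
  refine (abs_add_le _ _).trans (add_le_add ?_ ?_)
  · rw [abs_mul, abs_of_pos (inv_pos.2 hs0)]
    refine mul_le_mul (inv_anti₀ hc hs.le) ?_ (abs_nonneg _) (by positivity)
    refine (abs_add_le _ _).trans ?_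
    rw [abs_of_nonneg (sq_nonneg (a - b)), abs_mul, abs_mul, abs_two]
    gcongr
  · rw [abs_mul, abs_mul, abs_of_nonneg (sq_nonneg b), abs_of_pos (by positivity : 0 < (s * t)⁻¹),
      abs_sub_comm t s, ← mul_assoc]
    gcongr
    rw [div_eq_mul_inv]
    refine mul_le_mul (sq_le_sq' (by linarith [abs_le.1 hB]) (abs_le.1 hB).2) ?_ (by positivity)
      (by positivity)
    refine inv_anti₀ (by positivity) ?_
    rw [sq]; exact mul_le_mul hs.le ht.le hc.le hs0.le

/-- Only the limit `a₀` has to be bounded; the `a n` need just `L²` convergence. This matches `𝔉`,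
whose approximating gradients have no common bound, and uses its uniform lower bound for the
denominators. -/
lemma tendsto_integral_sq_div {a s : ℕ → Ω → ℝ} {a₀ s₀ : Ω → ℝ} (ha : ∀ n, MemLp (a n) 2 P)
    (ha₀ : MemLp a₀ ∞ P) (hs : ∀ n, MemLp (s n) 2 P) (hs₀ : MemLp s₀ 2 P)
    {c : ℝ} (hc : 0 < c) (hsc : ∀ n, ∀ᵐ ω ∂P, c < s n ω) (hsc₀ : ∀ᵐ ω ∂P, c < s₀ ω)
    (h1 : Tendsto (fun n => ∫ ω, (a n ω - a₀ ω) ^ 2 ∂P) atTop (𝓝 0))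
    (h2 : Tendsto (fun n => ∫ ω, (s n ω - s₀ ω) ^ 2 ∂P) atTop (𝓝 0)) :
    Tendsto (fun n => ∫ ω, a n ω ^ 2 / s n ω ∂P) atTop (𝓝 (∫ ω, a₀ ω ^ 2 / s₀ ω ∂P)) := by
  obtain ⟨B, hB0, hB⟩ := exists_ae_bound ha₀
  have ha₀' : MemLp a₀ 2 P := ha₀.mono_exponent le_top
  have da : ∀ n, MemLp (fun ω => a n ω - a₀ ω) 2 P := fun n => (ha n).sub ha₀'
  have ds : ∀ n, MemLp (fun ω => s n ω - s₀ ω) 2 P := fun n => (hs n).sub hs₀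
  have i1 := fun n => (da n).integrable_sq
  have i2 : ∀ n, Integrable (fun ω => |a n ω - a₀ ω|) P :=
    fun n => ((da n).integrable one_le_two).abs
  have i3 : ∀ n, Integrable (fun ω => |s n ω - s₀ ω|) P :=
    fun n => ((ds n).integrable one_le_two).abs
  have i4 : ∀ n, Integrable (fun ω => c⁻¹ * ((a n ω - a₀ ω) ^ 2 + 2 * B * |a n ω - a₀ ω|)) P :=
    fun n => ((i1 n).add ((i2 n).const_mul _)).const_mul _
  refine tendsto_integral_of_abs_sub_le (B := fun n ω => c⁻¹ * ((a n ω - a₀ ω) ^ 2 +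
    2 * B * |a n ω - a₀ ω|) + B ^ 2 / c ^ 2 * |s n ω - s₀ ω|)
    (fun n => integrable_sq_div (ha n) (hs n).1 hc (hsc n)) (integrable_sq_div ha₀' hs₀.1 hc hsc₀)
    (fun n => (i4 n).add ((i3 n).const_mul _))
    (fun n => ?_) ?_
  · filter_upwards [hsc n, hsc₀, hB] with ω x1 x2 x3
    exact abs_sq_div_sub_le hc x1 x2 x3
  · have e : ∀ n, ∫ ω, (c⁻¹ * ((a n ω - a₀ ω) ^ 2 + 2 * B * |a n ω - a₀ ω|) +
        B ^ 2 / c ^ 2 * |s n ω - s₀ ω|) ∂P = c⁻¹ * (∫ ω, (a n ω - a₀ ω) ^ 2 ∂P +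
        2 * B * ∫ ω, |a n ω - a₀ ω| ∂P) + B ^ 2 / c ^ 2 * ∫ ω, |s n ω - s₀ ω| ∂P := fun n => by
      rw [integral_add (i4 n) ((i3 n).const_mul _),
        integral_const_mul, integral_const_mul, integral_add (i1 n) ((i2 n).const_mul _),
        integral_const_mul]
    simp_rw [e]
    simpa using ((h1.add ((tendsto_integral_abs da h1).const_mul (2 * B))).const_mul c⁻¹).add
      ((tendsto_integral_abs ds h2).const_mul (B ^ 2 / c ^ 2))

lemma tendsto_integral_sq_of_bounded {h : ℕ → Ω → ℝ} {h₀ : Ω → ℝ}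
    (hm : ∀ n, AEStronglyMeasurable (h n) P) (hm₀ : AEStronglyMeasurable h₀ P) {C : ℝ}
    (hC : ∀ n, ∀ᵐ ω ∂P, |h n ω| ≤ C)
    (hl : ∀ᵐ ω ∂P, Tendsto (fun n => h n ω) atTop (𝓝 (h₀ ω))) :
    Tendsto (fun n => ∫ ω, (h n ω - h₀ ω) ^ 2 ∂P) atTop (𝓝 0) := by
  have := tendsto_integral_of_dominated_convergence (μ := P) (F := fun n ω => (h n ω - h₀ ω) ^ 2)
    (f := fun _ => 0) (fun _ => (2 * C) ^ 2) (fun n => ((hm n).sub hm₀).pow 2)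
    (integrable_const _) (fun n => ?_) ?_
  · simpa using this
  · filter_upwards [hl, ae_all_iff.2 hC] with ω h1 h2
    have h3 : |h₀ ω| ≤ C := le_of_tendsto h1.abs (.of_forall h2)
    rw [norm_pow, Real.norm_eq_abs]
    have := abs_sub (h n ω) (h₀ ω)
    gcongr
    linarith [h2 n]
  · filter_upwards [hl] with ω h1
    simpa using (h1.sub_const (h₀ ω)).pow 2

end SquareIntegrable

/-! ### Densities, continuity of `K`, and its positive lower bound. -/

section Densities

variable {d : ℕ} {Ω : Type*} [MeasurableSpace Ω] [AddAction (Euc d) Ω]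
  [MeasurableVAdd₂ (Euc d) Ω] {P : Measure Ω} [IsProbabilityMeasure P]
  [VAddInvariantMeasure (Euc d) Ω P]

lemma isWeakPartial_of_mem_Dw {f : Ω → ℝ} (hf : f ∈ Dw d P) (i : Fin d) :
    IsWeakPartial P i f (weakPartial P i f) := (hf.2.2 i).2.2.1.isWeakPartial

lemma memLp_weakPartial_of_mem_Dw {f : Ω → ℝ} (hf : f ∈ Dw d P) (i : Fin d) :
    MemLp (weakPartial P i f) 2 P := (hf.2.2 i).2.2.2

lemma weakPartial_sub_ae {f g : Ω → ℝ} (hf : f ∈ Dw d P) (hg : g ∈ Dw d P) (i : Fin d) :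
    weakPartial P i (g - f) =ᵐ[P] fun ω => weakPartial P i g ω - weakPartial P i f ω :=
  ((isWeakPartial_of_mem_Dw hg i).sub (isWeakPartial_of_mem_Dw hf i)).weakPartial_ae_eq

lemma tendsto_nablaNorm_iff {f : Ω → ℝ} {g : ℕ → Ω → ℝ} (hf : f ∈ Dw d P)
    (hg : ∀ n, g n ∈ Dw d P) :
    Tendsto (fun n => nablaNorm d P (g n - f)) atTop (𝓝 0) ↔
      Tendsto (fun n => ∫ ω, (g n ω - f ω) ^ 2 ∂P) atTop (𝓝 0) ∧ ∀ i : Fin d,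
        Tendsto (fun n => ∫ ω, (weakPartial P i (g n) ω - weakPartial P i f ω) ^ 2 ∂P) atTop
          (𝓝 0) := by
  have a1 : Tendsto (fun n => eLpNorm (g n - f) 2 P) atTop (𝓝 0) ↔
      Tendsto (fun n => ∫ ω, (g n ω - f ω) ^ 2 ∂P) atTop (𝓝 0) :=
    tendsto_eLpNorm_two_iff fun n => (hg n).2.1.sub hf.2.1
  have a2 : ∀ i : Fin d, Tendsto (fun n => eLpNorm (weakPartial P i (g n - f)) 2 P) atTop (𝓝 0) ↔
      Tendsto (fun n => ∫ ω, (weakPartial P i (g n) ω - weakPartial P i f ω) ^ 2 ∂P) atTop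
        (𝓝 0) := fun i => by
    simp_rw [fun n => eLpNorm_congr_ae (p := 2) (weakPartial_sub_ae hf (hg n) i)]
    exact tendsto_eLpNorm_two_iff fun n =>
      (memLp_weakPartial_of_mem_Dw (hg n) i).sub (memLp_weakPartial_of_mem_Dw hf i)
  simp_rw [← a1, ← a2]
  constructor
  · intro h
    refine ⟨tendsto_of_tendsto_of_tendsto_of_le_of_le tendsto_const_nhds h (fun _ => zero_le)
      fun n => le_self_add, fun i => ?_⟩
    refine tendsto_of_tendsto_of_tendsto_of_le_of_le tendsto_const_nhds h (fun _ => zero_le)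
      fun n => ?_
    exact (Finset.single_le_sum (f := fun i : Fin d => eLpNorm (weakPartial P i (g n - f)) 2 P)
      (fun _ _ => zero_le) (Finset.mem_univ i)).trans le_add_self
  · rintro ⟨h1, h2⟩
    simpa [nablaNorm] using h1.add (tendsto_finsetSum Finset.univ fun i _ => h2 i)

lemma Fs_subset_Fw : Fs d P ⊆ Fw d P := by
  rintro f ⟨h1, h2, c, hc, h3⟩
  obtain ⟨C, hC⟩ := exists_bound_of_mem_Ds h1
  refine ⟨h1.1, h2, ⟨c, hc, .of_forall h3⟩, memLp_of_abs_le h1.1.1 hC _, fun i => ?_⟩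
  obtain ⟨C', hC'⟩ := exists_bound_pd_of_mem_Ds h1 i
  exact (memLp_of_abs_le (measurable_pd i h1.1.1 h1.2.1) hC' _).ae_eq
    (weakPartial_of_mem_Ds h1 i).symm

lemma weakPartial_weakPartial_of_mem_Ds {f : Ω → ℝ} (hf : f ∈ Ds d P) (i : Fin d) :
    IsWeakPartial P i (weakPartial P i f) (pd i (pd i f)) := by
  have h := pd_mem_Ds hf i
  have h' := pd_mem_Ds h i
  exact (isWeakPartial_pd i h.1.1 h.2.1).congr (weakPartial_of_mem_Ds hf i).symm (ae_eq_refl _)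
    h'.1.1

lemma Fs_subset_Fw2 : Fs d P ⊆ Fw2 d P := by
  intro f hf
  have hw := Fs_subset_Fw hf
  refine ⟨hw, hw.1, fun i => ?_, hw.2.2.2.1, hw.2.2.2.2, ?_⟩
  · have h := weakPartial_weakPartial_of_mem_Ds hf.1 i
    exact ⟨measurable_weakPartial i f, memLp_weakPartial_of_mem_Dw hw.1 i, ⟨_, h⟩,
      ((pd_mem_Ds (pd_mem_Ds hf.1 i) i).1.2.1).ae_eq h.weakPartial_ae_eq.symm⟩
  · have : ∀ i ∈ (Finset.univ : Finset (Fin d)),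
        MemLp (weakPartial P i (weakPartial P i f)) ∞ P := fun i _ => by
      have h' := pd_mem_Ds (pd_mem_Ds hf.1 i) i
      obtain ⟨C, hC⟩ := exists_bound_of_mem_Ds h'
      exact (memLp_of_abs_le h'.1.1 hC _).ae_eq
        (weakPartial_weakPartial_of_mem_Ds hf.1 i).weakPartial_ae_eq.symm
    exact memLp_finsetSum _ this

lemma one_mem_Fs : (fun _ => 1 : Ω → ℝ) ∈ Fs d P :=
  ⟨const_mem_Ds 1, by simp, 1 / 2, by norm_num, fun _ => by norm_num⟩

/-- The smooth densities form an admissible family. -/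
lemma Fs_mem_DensityFamilies : Fs d P ∈ DensityFamilies d P := by
  refine ⟨Fs_subset_Fw, fun f hf => ?_⟩
  obtain ⟨hD, h1, ⟨c, hc, hcf⟩, hb, hb'⟩ := hf
  obtain ⟨u, C, hu, huc, huC, hu1, hul, hui⟩ := exists_smooth_approx hD hb hb'
    (hcf.mono fun ω h => h.le)
  -- The approximants satisfy only `c ≤ u n`; halving restores the strict inequality.
  have hc2 : c / 2 < c := half_lt_self hc
  refine ⟨u, fun n => ⟨hu n, (hu1 n).trans h1, c / 2, half_pos hc, fun ω => hc2.trans_le (huc n ω)⟩,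
    (tendsto_nablaNorm_iff hD fun n => (hu n).1).2 ⟨?_, fun i => ?_⟩,
    c / 2, half_pos hc, .of_forall fun ω n => hc2.trans_le (huc n ω)⟩
  · exact tendsto_integral_sq_of_bounded (fun n => (hu n).1.2.1.1) hD.2.1.1
      (fun n => .of_forall (huC n)) hul
  · refine tendsto_integral_sq_of_bounded (C := C)
      (fun n => (memLp_weakPartial_of_mem_Dw (hu n).1 i).1)
      (memLp_weakPartial_of_mem_Dw hD i).1 (fun n => ?_) ?_
    · filter_upwards [(hui i).1 n, weakPartial_of_mem_Ds (hu n) i] with ω h1 h2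
      rwa [h2]
    · filter_upwards [(hui i).2, ae_all_iff.2 fun n => weakPartial_of_mem_Ds (hu n) i] with ω h1 h2
      exact h1.congr fun n => (h2 n).symm

lemma K_eq {V f : Ω → ℝ} (hV : MemLp V 2 P) (hf : f ∈ Fw d P) :
    K d P V f = (1 / 8) * ∑ i : Fin d, ∫ ω, weakPartial P i f ω ^ 2 / f ω ∂P +
      ∫ ω, V ω * f ω ∂P := by
  obtain ⟨hD, h1, ⟨c, hc, hcf⟩, hb, hb'⟩ := hf
  have i1 : ∀ i ∈ (Finset.univ : Finset (Fin d)),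
      Integrable (fun ω => weakPartial P i f ω ^ 2 / f ω) P := fun i _ =>
    integrable_sq_div (memLp_weakPartial_of_mem_Dw hD i) hD.2.1.1 hc hcf
  have i2 : Integrable (fun ω => V ω * f ω) P := integrable_mul_of_memLp hV hD.2.1
  rw [← integral_finsetSum _ i1, ← integral_const_mul, ← integral_add _ i2]
  · unfold K
    congr 1; ext ω
    rw [EuclideanSpace.real_norm_sq_eq]
    simp only [grad]
    rw [Finset.sum_div, Finset.mul_sum]
    congr 2; ext i
    rw [mul_comm (8 : ℝ), ← div_div]; ring
  · exact (integrable_finsetSum _ i1).const_mul _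

lemma tendsto_K {V f : Ω → ℝ} {g : ℕ → Ω → ℝ} (hV : MemLp V 2 P) (hf : f ∈ Fw d P)
    (hg : ∀ n, g n ∈ Fw d P) (h0 : Tendsto (fun n => nablaNorm d P (g n - f)) atTop (𝓝 0))
    {c : ℝ} (hc : 0 < c) (hgc : ∀ᵐ ω ∂P, ∀ n, c < g n ω) :
    Tendsto (fun n => K d P V (g n)) atTop (𝓝 (K d P V f)) := by
  simp_rw [fun n => K_eq hV (hg n), K_eq hV hf]
  obtain ⟨h1, h2⟩ := (tendsto_nablaNorm_iff hf.1 fun n => (hg n).1).1 h0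
  obtain ⟨hD, -, ⟨c', hc', hcf⟩, hb, hb'⟩ := hf
  have m : ∀ n, MemLp (fun ω => g n ω - f ω) 2 P := fun n => (hg n).1.2.1.sub hD.2.1
  refine ((tendsto_finsetSum _ fun i _ => ?_).const_mul _).add ?_
  · refine tendsto_integral_sq_div (c := min c c') (fun n => memLp_weakPartial_of_mem_Dw (hg n).1 i)
      (hb' i) (fun n => (hg n).1.2.1) hD.2.1 (lt_min hc hc') (fun n => ?_) ?_ (h2 i) h1
    · filter_upwards [hgc] with ω h using (min_le_left _ _).trans_lt (h n)
    · filter_upwards [hcf] with ω h using (min_le_right _ _).trans_lt h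
  · refine tendsto_integral_of_abs_sub_le (B := fun n ω => |V ω| * |g n ω - f ω|)
      (fun n => integrable_mul_of_memLp hV (hg n).1.2.1) (integrable_mul_of_memLp hV hD.2.1)
      (fun n => integrable_mul_of_memLp hV.abs (m n).abs) (fun n => .of_forall fun ω => ?_)
      (tendsto_integral_abs_mul hV m h1)
    rw [← mul_sub, abs_mul]

/-! ### The lower bound on `K` -/

lemma pd_div (i : Fin d) {f u : Ω → ℝ}
    (hf : ∀ ω, ContDiff ℝ (⊤ : ℕ∞) (realisation f ω : Euc d → ℝ))
    (hu : ∀ ω, ContDiff ℝ (⊤ : ℕ∞) (realisation u ω : Euc d → ℝ)) (hu0 : ∀ ω, u ω ≠ 0) (ω : Ω) :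
    pd i (fun ω => f ω / u ω) ω = (pd i f ω * u ω - f ω * pd i u ω) / u ω ^ 2 := by
  have h1 := ((hf ω).differentiable (by simp) 0)
  have h2 := ((hu ω).differentiable (by simp) 0)
  have e : (realisation (fun ω => f ω / u ω) ω : Euc d → ℝ) =
    fun x => realisation f ω x / realisation u ω x := rfl
  unfold pd dpart
  have h3 : (realisation u ω : Euc d → ℝ) 0 ≠ 0 := by simpa [realisation] using hu0 ω
  have h5 : DifferentiableAt ℝ (fun x : Euc d => realisation f ω x / realisation u ω x) 0 := by
    simpa only [div_eq_mul_inv] using h1.fun_mul (h2.fun_inv h3)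
  have h4 := (h1.hasFDerivAt.hasLineDerivAt (unitVec i)).div
    (h2.hasFDerivAt.hasLineDerivAt (unitVec i)) (by simpa using h3)
  have h6 := (h5.hasFDerivAt.hasLineDerivAt (unitVec i)).unique h4
  rw [e, h6]
  simp [realisation]

/-- Integrating by parts turns the right side into `-½ ∫ ∂u ∂(f / u)`, and completing the square in
`∂u` bounds this below by `-⅛ ∫ (∂f)² / f`. This is the one-coordinate form of the lower bound on
the functional in `σ(0)`. -/
lemma half_integral_ge {f u : Ω → ℝ} (hf : f ∈ Fs d P) (hu : u ∈ UU d P) (i : Fin d) :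
    -∫ ω, (1 / 8) * (weakPartial P i f ω ^ 2 / f ω) ∂P ≤
      ∫ ω, (1 / 2) * (weakPartial P i (weakPartial P i u) ω * (f ω / u ω)) ∂P ∧
    Integrable (fun ω => weakPartial P i (weakPartial P i u) ω * (f ω / u ω)) P := by
  obtain ⟨hfD, -, cf, hcf, hfc⟩ := hf
  obtain ⟨⟨huD, hu2, hub, hub', -⟩, c, hc, huc⟩ := hu
  -- The quotient `f / u` need not be smooth, so the integration by parts is done with `f / v n` and
  -- passed to the limit by dominated convergence.
  obtain ⟨v, C, hv, hvc, hvC, -, hvl, hvi⟩ := exists_smooth_approx huD hub hub'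
    (huc.mono fun ω h => h.le)
  obtain ⟨A, hA⟩ := exists_bound_of_mem_Ds hfD
  obtain ⟨A', hA'⟩ := exists_bound_pd_of_mem_Ds hfD i
  obtain ⟨B, hB0, hB⟩ := exists_ae_bound (hub' i)
  have hfm := measurable_of_mem_Ds hfD
  have hfs := contDiff_of_mem_Ds hfD
  have hv0 : ∀ n ω, 0 < v n ω := fun n ω => hc.trans_le (hvc n ω)
  set a := weakPartial P i u
  set a' := weakPartial P i a
  have ham : Measurable a := measurable_weakPartial i u
  have ham' : Measurable a' := measurable_weakPartial i a
  have hA0 : ∀ ω : Ω, 0 ≤ A := fun ω => (abs_nonneg _).trans (hA ω)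
  have hA0' : ∀ ω : Ω, 0 ≤ A' := fun ω => (abs_nonneg _).trans (hA' ω)
  have hC0 : ∀ ω : Ω, 0 ≤ C := fun ω => (abs_nonneg _).trans (hvC 0 ω)
  have ha' : Integrable a' P := (hu2 i).2.2.2.integrable one_le_two
  have ha : Integrable a P := (hu2 i).2.1.integrable one_le_two
  have hq : ∀ n ω, |f ω / v n ω| ≤ A / c := fun n ω => by
    rw [abs_div, abs_of_pos (hv0 n ω)]
    exact div_le_div₀ (hA0 ω) (hA ω) hc (hvc n ω)
  have hpd : ∀ n ω, pd i (fun ω => f ω / v n ω) ω =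
      (pd i f ω * v n ω - f ω * pd i (v n) ω) / v n ω ^ 2 := fun n ω =>
    pd_div i hfs (contDiff_of_mem_Ds (hv n)) (fun ω => (hv0 n ω).ne') ω
  have hpdb : ∀ n ω D, |pd i (v n) ω| ≤ D →
      |pd i (fun ω => f ω / v n ω) ω| ≤ (A' * C + A * D) / c ^ 2 := fun n ω D hD => by
    have := hA0 ω; have := hA0' ω; have := hC0 ω
    have hD0 : 0 ≤ D := (abs_nonneg _).trans hD
    rw [hpd, abs_div, abs_of_pos (pow_pos (hv0 n ω) 2)]
    refine div_le_div₀ (by positivity) ?_ (by positivity) (pow_le_pow_left₀ hc.le (hvc n ω) 2)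
    refine (abs_sub _ _).trans ?_
    rw [abs_mul, abs_mul]
    gcongr
    exacts [hA' ω, hvC n ω, hA ω]
  have ibp : ∀ n, ∫ ω, a' ω * (f ω / v n ω) ∂P = -∫ ω, a ω * pd i (fun ω => f ω / v n ω) ω ∂P := by
    intro n
    obtain ⟨D, hD⟩ := exists_bound_pd_of_mem_Ds (hv n) i
    refine (hu2 i).2.2.1.isWeakPartial.integral_mul ha ha' (hfm.div (measurable_of_mem_Ds (hv n)))
      (fun ω => (hfs ω).div (contDiff_of_mem_Ds (hv n) ω) fun x => (hv0 n _).ne')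
      (C := max (A / c) ((A' * C + A * D) / c ^ 2)) (fun ω => (hq n ω).trans (le_max_left _ _))
      (fun ω => (hpdb n ω D (hD ω)).trans (le_max_right _ _))
  have l1 : Tendsto (fun n => ∫ ω, a' ω * (f ω / v n ω) ∂P) atTop
      (𝓝 (∫ ω, a' ω * (f ω / u ω) ∂P)) := by
    refine tendsto_integral_of_dominated_convergence (fun ω => |a' ω| * (A / c))
      (fun n => (ham'.mul (hfm.div (measurable_of_mem_Ds (hv n)))).aestronglyMeasurable)
      (ha'.abs.mul_const _) (fun n => .of_forall fun ω => ?_) ?_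
    · rw [norm_mul]
      exact mul_le_mul_of_nonneg_left (hq n ω) (norm_nonneg _)
    · filter_upwards [hvl, huc] with ω h1 h2
      exact (tendsto_const_nhds.div h1 (hc.trans h2).ne').const_mul _
  have l2 : Tendsto (fun n => ∫ ω, a ω * pd i (fun ω => f ω / v n ω) ω ∂P) atTop
      (𝓝 (∫ ω, a ω * ((pd i f ω * u ω - f ω * a ω) / u ω ^ 2) ∂P)) := by
    refine tendsto_integral_of_dominated_convergence (fun ω => |a ω| * ((A' * C + A * C) / c ^ 2))
      (fun n => ?_) (ha.abs.mul_const _) (fun n => ?_) ?_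
    · exact (ham.mul (measurable_pd i (hfm.div (measurable_of_mem_Ds (hv n)))
        (fun ω => (hfs ω).div (contDiff_of_mem_Ds (hv n) ω)
          fun x => (hv0 n _).ne'))).aestronglyMeasurable
    · filter_upwards [(hvi i).1 n] with ω h1
      rw [norm_mul]
      exact mul_le_mul_of_nonneg_left (hpdb n ω C h1) (norm_nonneg _)
    · filter_upwards [hvl, huc, (hvi i).2] with ω h1 h2 h3
      simp_rw [hpd]
      exact (((h1.const_mul _).sub (h3.const_mul _)).div (h1.pow 2)
        (pow_pos (hc.trans h2) 2).ne').const_mul _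
  have key : ∫ ω, a' ω * (f ω / u ω) ∂P =
      -∫ ω, a ω * ((pd i f ω * u ω - f ω * a ω) / u ω ^ 2) ∂P :=
    tendsto_nhds_unique l1 (by simpa only [ibp] using l2.neg)
  have hfw : MemLp (weakPartial P i f) 2 P := memLp_weakPartial_of_mem_Dw hfD.1 i
  have j1 : Integrable (fun ω => (1 / 8) * (weakPartial P i f ω ^ 2 / f ω)) P :=
    (integrable_sq_div hfw hfD.1.2.1.1 hcf (.of_forall hfc)).const_mul _
  have hubd : ∃ D, ∀ᵐ ω ∂P, |u ω| ≤ D := by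
    obtain ⟨D, -, hD⟩ := exists_ae_bound hub; exact ⟨D, hD⟩
  have j3 : Integrable (fun ω => a' ω * (f ω / u ω)) P := by
    refine ha'.mul_bdd (c := A / c) (hfm.div huD.1).aestronglyMeasurable ?_
    filter_upwards [huc] with ω h1
    rw [norm_div, Real.norm_of_nonneg (hc.trans h1).le]
    exact div_le_div₀ (hA0 ω) (hA ω) hc h1.le
  refine ⟨?_, j3⟩
  have j2 : Integrable (fun ω => a ω * ((pd i f ω * u ω - f ω * a ω) / u ω ^ 2)) P := by
    obtain ⟨D, hD⟩ := hubd
    refine ha.mul_bdd (c := (A' * D + A * B) / c ^ 2) ?_ ?_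
    · exact ((((measurable_pd i hfm hfs).mul huD.1).sub (hfm.mul ham)).div
        (huD.1.pow_const 2)).aestronglyMeasurable
    · filter_upwards [huc, hD, hB] with ω h1 h2 h3
      have := hA0 ω; have := hA0' ω
      have hD0 : 0 ≤ D := (abs_nonneg _).trans h2
      rw [Real.norm_eq_abs, abs_div, abs_of_pos (pow_pos (hc.trans h1) 2)]
      refine div_le_div₀ (by positivity) ?_ (by positivity) (pow_le_pow_left₀ hc.le h1.le 2)
      refine (abs_sub _ _).trans ?_
      rw [abs_mul, abs_mul]
      gcongr
      exacts [hA' ω, hA ω]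
  rw [integral_const_mul (1 / 2 : ℝ), key, mul_neg, ← integral_const_mul]
  refine neg_le_neg (integral_mono_ae (j2.const_mul _) j1 ?_)
  filter_upwards [huc, weakPartial_of_mem_Ds hfD i] with ω h1 h2
  have hu0 : 0 < u ω := hc.trans h1
  have hf0 : 0 < f ω := hcf.trans (hfc ω)
  simp only [h2]
  have e : 1 / 8 * (pd i f ω ^ 2 / f ω) -
      1 / 2 * (a ω * ((pd i f ω * u ω - f ω * a ω) / u ω ^ 2)) =
      (2 * f ω * a ω - pd i f ω * u ω) ^ 2 / (8 * f ω * u ω ^ 2) := by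
    field_simp; ring
  have : 0 ≤ (2 * f ω * a ω - pd i f ω * u ω) ^ 2 / (8 * f ω * u ω ^ 2) := by positivity
  linarith

lemma neg_K_le {V f u : Ω → ℝ} (hV : MemLp V 2 P) (hf : f ∈ Fs d P) (hu : u ∈ UU d P) :
    -K d P V f ≤ ∫ ω, (genL P (0 : Euc d) u ω / u ω - V ω) * f ω ∂P := by
  rw [K_eq hV (Fs_subset_Fw hf), neg_add, Finset.mul_sum, ← Finset.sum_neg_distrib]
  have i1 : ∀ i ∈ (Finset.univ : Finset (Fin d)), Integrable (fun ω =>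
      (1 / 2) * (weakPartial P i (weakPartial P i u) ω * (f ω / u ω))) P :=
    fun i _ => (half_integral_ge hf hu i).2.const_mul _
  have e : ∫ ω, (genL P (0 : Euc d) u ω / u ω - V ω) * f ω ∂P =
      ∑ i : Fin d, ∫ ω, (1 / 2) * (weakPartial P i (weakPartial P i u) ω * (f ω / u ω)) ∂P -
        ∫ ω, V ω * f ω ∂P := by
    rw [← integral_finsetSum _ i1, ← integral_sub (integrable_finsetSum _ i1)
      (integrable_mul_of_memLp hV hf.1.1.2.1)]
    congr 1; ext ω
    simp only [genL, lapl, inner_zero_left, add_zero]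
    rw [← Finset.mul_sum, ← Finset.sum_mul]
    ring
  rw [e, sub_eq_add_neg]
  gcongr with i
  rw [← integral_const_mul]
  exact (half_integral_ge hf hu i).1

/-- Choose `0 < κ < σ(0)`. For smooth `f` the number `-K(f)` lies below the infimum over `u`, hence
below `-σ(0) < -κ`. Continuity of `K` extends the bound to `𝔽_w`. -/
lemma exists_K_lower_bound {V : Ω → ℝ} (hV : MemLp V 2 P) (hσ : 0 < sigma P V (0 : Euc d)) :
    ∃ κ > 0, ∀ f ∈ Fw d P, κ ≤ K d P V f := by
  obtain ⟨κ, hκ0, hκ⟩ := EReal.lt_iff_exists_real_btwn.1 hσ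
  have hs : ∀ f ∈ Fs d P, κ ≤ K d P V f := by
    intro f hf
    have h1 : (⨆ f ∈ Fw2 d P, ⨅ u ∈ UU d P,
        ((∫ ω, (genL P (0 : Euc d) u ω / u ω - V ω) * f ω ∂P : ℝ) : EReal)) < -(κ : EReal) :=
      EReal.lt_neg_comm.1 hκ
    have h2 : ((-K d P V f : ℝ) : EReal) ≤ ⨅ u ∈ UU d P,
        ((∫ ω, (genL P (0 : Euc d) u ω / u ω - V ω) * f ω ∂P : ℝ) : EReal) :=
      le_iInf₂ fun u hu => EReal.coe_le_coe_iff.2 (neg_K_le hV hf hu)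
    have h3 := (h2.trans (le_iSup₂ (f := fun f (_ : f ∈ Fw2 d P) => ⨅ u ∈ UU d P,
        ((∫ ω, (genL P (0 : Euc d) u ω / u ω - V ω) * f ω ∂P : ℝ) : EReal)) f
        (Fs_subset_Fw2 hf))).trans_lt h1
    have h4 : -K d P V f < -κ := by exact_mod_cast h3
    linarith
  refine ⟨κ, by exact_mod_cast hκ0, fun f hf => ?_⟩
  obtain ⟨g, hg, hgf, c, hc, hgc⟩ := Fs_mem_DensityFamilies.2 f hf
  exact ge_of_tendsto (tendsto_K hV hf (fun n => Fs_subset_Fw (hg n)) hgf hc hgc)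
    (.of_forall fun n => hs _ (hg n))

end Densities

/-! ### Functions on `ℝ^d` with vanishing distributional gradient. -/

section Euclidean

variable {d : ℕ}

lemma dpart_comm {ρ : Euc d → ℝ} (hρ : ContDiff ℝ (⊤ : ℕ∞) ρ) (i j : Fin d) :
    dpart i (dpart j ρ) = dpart j (dpart i ρ) := by
  have h2 : Differentiable ℝ (fderiv ℝ ρ) :=
    (hρ.fderiv_right (m := (⊤ : ℕ∞)) (by simp)).differentiable (by simp)
  have key : ∀ (a b : Fin d) (x : Euc d), dpart a (dpart b ρ) x =
      fderiv ℝ (fderiv ℝ ρ) x (unitVec a) (unitVec b) := fun a b x => by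
    have e : dpart b ρ = fun x => fderiv ℝ ρ x (unitVec b) := rfl
    rw [dpart, e, fderiv_clm_apply (h2 x) (differentiableAt_const _)]
    simp
  ext x
  rw [key, key]
  exact (hρ.contDiffAt.isSymmSndFDerivAt (by
    simp only [minSmoothness_of_isRCLikeNormedField]
    exact WithTop.coe_le_coe.2 (le_top (a := (2 : ℕ∞))))) _ _

lemma clm_eq_zero {L : Euc d →L[ℝ] ℝ} (h : ∀ i, L (unitVec i) = 0) : L = 0 := by
  have : (L : Euc d →ₗ[ℝ] ℝ) = 0 := (EuclideanSpace.basisFun (Fin d) ℝ).toBasis.ext fun i => by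
    simpa [unitVec] using h i
  ext x
  exact congrArg (fun M : Euc d →ₗ[ℝ] ℝ => M x) this

/-- A continuous function with vanishing distributional gradient is constant. -/
lemma eq_of_integral_dpart_mul_eq_zero {c : Euc d → ℝ} (hc : Continuous c)
    (h : ∀ ρ, IsTest ρ → ∀ i : Fin d, ∫ x, dpart i ρ x * c x = 0) (x y : Euc d) : c x = c y := by
  have hn : ∀ n, (moll d n ⋆[ContinuousLinearMap.lsmul ℝ ℝ, volume] c) x =
      (moll d n ⋆[ContinuousLinearMap.lsmul ℝ ℝ, volume] c) y := by
    intro n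
    have hm := isTest_moll (d := d) n
    have hd : Differentiable ℝ (moll d n ⋆[ContinuousLinearMap.lsmul ℝ ℝ, volume] c) :=
      (hm.2.contDiff_convolution_left _ hm.1 hc.locallyIntegrable).differentiable (by simp)
    refine is_const_of_fderiv_eq_zero hd (fun z => clm_eq_zero fun i => ?_) x y
    have h1 := congrFun (dpart_convolution hm hc.locallyIntegrable i) z
    rw [convolution_eq_swap] at h1
    refine h1.trans ?_
    -- The derivative of the mollified function at `z` is, up to sign, the hypothesis for the
    -- reflected mollifier centred at `z`.
    have ht : IsTest (fun t => moll d n (-t + z)) := by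
      refine ⟨hm.1.comp (contDiff_neg.add contDiff_const), ?_⟩
      exact hm.2.comp_homeomorph ((Homeomorph.neg _).trans (Homeomorph.addRight z))
    have h2 := h _ ht i
    have e : ∀ t, dpart i (fun t => moll d n (-t + z)) t = - dpart i (moll d n) (z - t) := by
      intro t
      have := dpart_comp_neg i (fun t => moll d n (t + z)) t
      rw [this, dpart, fderiv_comp_add_right, neg_add_eq_sub]
      rfl
    simp_rw [e, neg_mul, integral_neg, neg_eq_zero] at h2
    exact h2
  have l := fun z => ContDiffBump.convolution_tendsto_right_of_continuous (μ := volume)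
    (tendsto_bump_rOut (d := d)) hc z
  exact tendsto_nhds_unique (l x) ((l y).congr fun n => (hn n).symm)

end Euclidean

/-! ### A mean ergodic argument in Hilbert space. -/

section Hilbert

variable {X G : Type*} [NormedAddCommGroup X] [InnerProductSpace ℝ X] [CompleteSpace X]
  [AddCommGroup G]

/-- If `⟨φ, U x v⟩` does not depend on `x` and `v` is orthogonal to all invariant vectors, then
`φ` is orthogonal to `v`. -/
lemma inner_eq_zero_of_orbit {U : G → X →ₗᵢ[ℝ] X} (hU : ∀ x y v, U (x + y) v = U x (U y v))
    (hU0 : ∀ v, U 0 v = v) {φ v : X} (hφ : ∀ x, inner ℝ φ (U x v) = inner ℝ φ v)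
    (hv : ∀ r, (∀ x, U x r = r) → inner ℝ v r = 0) : inner ℝ φ v = 0 := by
  -- By `hφ`, the vector `φ` annihilates `M`, so it suffices that `v ∈ M`. The component `r` of `v`
  -- orthogonal to `M` turns out to be invariant, hence orthogonal to `v`, hence zero.
  set M := (Submodule.span ℝ (Set.range fun x => U x v - v)).topologicalClosure with hM
  have : CompleteSpace M := (Submodule.isClosed_topologicalClosure _).completeSpace_coe
  have hgen : ∀ x, U x v - v ∈ M := fun x =>
    Submodule.le_topologicalClosure _ (Submodule.subset_span ⟨x, rfl⟩)
  have hUM : ∀ y, ∀ m ∈ M, U y m ∈ M := by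
    intro y
    have : M ≤ M.comap (U y).toLinearMap := by
      refine Submodule.topologicalClosure_minimal _ (Submodule.span_le.2 ?_) ?_
      · rintro _ ⟨x, rfl⟩
        have e : U y (U x v - v) = (U (y + x) v - v) - (U y v - v) := by
          rw [map_sub, hU]; abel
        change U y (U x v - v) ∈ M
        rw [e]
        exact M.sub_mem (hgen _) (hgen _)
      · exact (Submodule.isClosed_topologicalClosure _).preimage (U y).continuous
    exact fun m hm => this hm
  set m := M.starProjection v
  have hm : m ∈ M := Submodule.starProjection_apply_mem _ _
  set r := v - m
  have hr : ∀ a ∈ M, inner ℝ a r = 0 := fun a ha =>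
    (Submodule.mem_orthogonal _ _).1 (Submodule.sub_starProjection_mem_orthogonal v) a ha
  have hinv : ∀ y, U y r = r := by
    intro y
    have h1 : U y r - r ∈ M := by
      have e : U y r - r = (U y v - v) - (U y m - m) := by
        simp only [r, map_sub]; abel
      rw [e]
      exact M.sub_mem (hgen y) (M.sub_mem (hUM y m hm) hm)
    -- Since `U (-y)` inverts `U y` and preserves `M`, the isometry `U y` also preserves the
    -- orthogonal complement.
    have h2 : ∀ a ∈ M, inner ℝ a (U y r) = 0 := fun a ha => by
      have e : a = U y (U (-y) a) := by rw [← hU, add_neg_cancel, hU0]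
      rw [e, (U y).inner_map_map]
      exact hr _ (hUM _ _ ha)
    have h3 : inner ℝ (U y r - r) (U y r - r) = 0 := by
      rw [inner_sub_right, h2 _ h1, hr _ h1, sub_zero]
    exact sub_eq_zero.1 (inner_self_eq_zero.1 h3)
  have h0 : r = 0 := by
    have h1 := hv r hinv
    have h2 : inner ℝ r r = 0 := by
      have : inner ℝ (v - m) r = 0 := by rw [inner_sub_left, h1, hr m hm, sub_zero]
      exact this
    exact inner_self_eq_zero.1 h2
  have hvM : v ∈ M := by
    rw [sub_eq_zero.1 h0]; exact hm
  have hle : M ≤ (LinearMap.ker (innerSL ℝ φ : X →L[ℝ] ℝ).toLinearMap) := by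
    refine Submodule.topologicalClosure_minimal _ (Submodule.span_le.2 ?_)
      (innerSL ℝ φ).isClosed_ker
    rintro _ ⟨x, rfl⟩
    simp [inner_sub_right, hφ]
  simpa using hle hvM

end Hilbert

/-! ### Density of `𝔻_s` in `L²` and continuity of correlations. -/

section Helmholtz

variable {d : ℕ} {Ω : Type*} [MeasurableSpace Ω] [AddAction (Euc d) Ω]
  [MeasurableVAdd₂ (Euc d) Ω] {P : Measure Ω} [IsProbabilityMeasure P]
  [VAddInvariantMeasure (Euc d) Ω P]

lemma abs_clip_le (n : ℕ) (f : Ω → ℝ) (ω : Ω) : |clip (-(n : ℝ)) n f ω| ≤ n :=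
  abs_le.2 (clip_mem (by linarith [(Nat.cast_nonneg n : (0 : ℝ) ≤ n)]) f ω)

lemma abs_clip_le_abs (n : ℕ) (f : Ω → ℝ) (ω : Ω) : |clip (-(n : ℝ)) n f ω| ≤ |f ω| := by
  have hn : (0 : ℝ) ≤ n := Nat.cast_nonneg n
  unfold clip
  rcases abs_cases (f ω) with ⟨h, h'⟩ | ⟨h, h'⟩ <;> rw [h, abs_le] <;> constructor <;>
    rcases max_cases (-(n : ℝ)) (min n (f ω)) with ⟨a, a'⟩ | ⟨a, a'⟩ <;>
    rcases min_cases (n : ℝ) (f ω) with ⟨b, b'⟩ | ⟨b, b'⟩ <;> linarith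

lemma tendsto_clip (f : Ω → ℝ) (ω : Ω) :
    Tendsto (fun n : ℕ => clip (-(n : ℝ)) n f ω) atTop (𝓝 (f ω)) := by
  obtain ⟨N, hN⟩ := exists_nat_ge |f ω|
  refine tendsto_const_nhds.congr' ?_
  filter_upwards [eventually_ge_atTop N] with n hn
  refine (clip_eq (abs_le.1 (hN.trans ?_))).symm
  exact_mod_cast hn

/-- The smooth functions are dense in `L²`. -/
lemma exists_mem_Ds_integral_sq_lt {f : Ω → ℝ} (hm : Measurable f) (hf : MemLp f 2 P) {ε : ℝ}
    (hε : 0 < ε) : ∃ h ∈ Ds d P, ∫ ω, (f ω - h ω) ^ 2 ∂P < ε := by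
  have l1 : Tendsto (fun n : ℕ => ∫ ω, (f ω - clip (-(n : ℝ)) n f ω) ^ 2 ∂P) atTop (𝓝 0) := by
    have := tendsto_integral_of_dominated_convergence (μ := P)
      (F := fun (n : ℕ) ω => (f ω - clip (-(n : ℝ)) n f ω) ^ 2) (f := fun _ => 0)
      (fun ω => (2 * |f ω|) ^ 2)
      (fun n => ((hm.sub (measurable_clip _ _ hm)).pow_const 2).aestronglyMeasurable)
      ((hf.abs.const_mul 2).integrable_sq) (fun n => .of_forall fun ω => ?_)
      (.of_forall fun ω => ?_)
    · simpa using this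
    · rw [norm_pow, Real.norm_eq_abs]
      gcongr
      linarith [abs_sub (f ω) (clip (-(n : ℝ)) n f ω), abs_clip_le_abs n f ω]
    · simpa using ((tendsto_clip f ω).const_sub (f ω)).pow 2
  -- Truncate, then mollify. Each squared error is below `ε / 4` because the square of a sum costs a
  -- factor two.
  obtain ⟨n, hn⟩ := (l1.eventually (gt_mem_nhds (by positivity : (0 : ℝ) < ε / 4))).exists
  set k := clip (-(n : ℝ)) n f
  have hk : Measurable k := measurable_clip _ _ hm
  have hkb : ∀ ω, |k ω| ≤ n := abs_clip_le n f
  have hkI : ∀ ω, k ω ∈ Set.Icc (-(n : ℝ)) n := fun ω => abs_le.1 (hkb ω)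
  have hk2 : MemLp k 2 P := memLp_of_abs_le hk hkb 2
  have hD : ∀ m, avg (moll d m) k ∈ Ds d P := fun m => avg_mem_Ds (isTest_moll m) hk hkb
  have l2 := tendsto_integral_sq_of_bounded (P := P) (h := fun m => avg (moll d m) k) (h₀ := k)
    (C := n) (fun m => (hD m).1.2.1.1) hk.aestronglyMeasurable
    (fun m => .of_forall fun ω => abs_le.2 (avg_moll_mem_Icc hk hkI m ω))
    (tendsto_avg_moll hk (hk2.integrable one_le_two))
  obtain ⟨m, hm'⟩ := (l2.eventually (gt_mem_nhds (by positivity : (0 : ℝ) < ε / 4))).exists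
  refine ⟨_, hD m, ?_⟩
  have i1 : Integrable (fun ω => (f ω - k ω) ^ 2) P := (hf.sub hk2).integrable_sq
  have i2 : Integrable (fun ω => (avg (moll d m) k ω - k ω) ^ 2) P :=
    ((hD m).1.2.1.sub hk2).integrable_sq
  calc ∫ ω, (f ω - avg (moll d m) k ω) ^ 2 ∂P
      ≤ ∫ ω, (2 * (f ω - k ω) ^ 2 + 2 * (avg (moll d m) k ω - k ω) ^ 2) ∂P := by
        refine integral_mono (hf.sub (hD m).1.2.1).integrable_sq
          ((i1.const_mul 2).add (i2.const_mul 2)) fun ω => ?_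
        beta_reduce
        nlinarith [sq_nonneg ((f ω - k ω) + (avg (moll d m) k ω - k ω))]
    _ = 2 * ∫ ω, (f ω - k ω) ^ 2 ∂P + 2 * ∫ ω, (avg (moll d m) k ω - k ω) ^ 2 ∂P := by
        rw [integral_add (i1.const_mul 2) (i2.const_mul 2), integral_const_mul, integral_const_mul]
    _ < ε := by linarith

/-- For smooth `f` this is dominated convergence; in general the correlation is a uniform limit of
such functions, as Cauchy-Schwarz and invariance bound the error independently of `x`. -/
lemma continuous_integral_mul_vadd {f g : Ω → ℝ} (hm : Measurable f) (hf : MemLp f 2 P)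
    (hg : MemLp g 2 P) : Continuous (fun x : Euc d => ∫ ω, g ω * f (-x +ᵥ ω) ∂P) := by
  refine continuous_of_uniform_approx_of_continuous fun u hu => ?_
  obtain ⟨ε, hε, hεu⟩ := Metric.mem_uniformity_dist.1 hu
  set N := Real.sqrt (∫ ω, g ω ^ 2 ∂P)
  have hN : 0 ≤ N := Real.sqrt_nonneg _
  obtain ⟨h, hh, hh'⟩ := exists_mem_Ds_integral_sq_lt (d := d) hm hf
    (ε := (ε / (N + 1)) ^ 2) (by positivity)
  have hd : MemLp (fun ω => f ω - h ω) 2 P := hf.sub hh.1.2.1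
  refine ⟨fun x => ∫ ω, g ω * h (-x +ᵥ ω) ∂P, ?_, fun x => hεu ?_⟩
  · obtain ⟨C, hC⟩ := exists_bound_of_mem_Ds hh
    refine continuous_of_dominated (bound := fun ω => |g ω| * C) (fun x => ?_)
      (fun x => .of_forall fun ω => ?_) ((hg.integrable one_le_two).abs.mul_const C)
      (.of_forall fun ω => ?_)
    · exact hg.1.mul (hh.1.1.comp (measurable_const_vadd _)).aestronglyMeasurable
    · rw [norm_mul]; exact mul_le_mul_of_nonneg_left (hC _) (norm_nonneg _)
    · exact continuous_const.mul ((hh.2.1 ω).continuous.comp continuous_neg)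
  · have hdx : MemLp (fun ω => f (-x +ᵥ ω) - h (-x +ᵥ ω)) 2 P := memLp_vadd (-x) hd
    rw [Real.dist_eq, ← integral_sub (integrable_mul_of_memLp hg (memLp_vadd (-x) hf))
      (integrable_mul_of_memLp hg (memLp_vadd (-x) hh.1.2.1))]
    calc |∫ ω, (g ω * f (-x +ᵥ ω) - g ω * h (-x +ᵥ ω)) ∂P|
        ≤ ∫ ω, |g ω| * |f (-x +ᵥ ω) - h (-x +ᵥ ω)| ∂P := by
          refine abs_integral_le_integral_abs.trans_eq ?_
          congr 1; ext ω; rw [← mul_sub, abs_mul]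
      _ ≤ N * Real.sqrt (∫ ω, (f (-x +ᵥ ω) - h (-x +ᵥ ω)) ^ 2 ∂P) := integral_abs_mul_le hg hdx
      _ = N * Real.sqrt (∫ ω, (f ω - h ω) ^ 2 ∂P) := by
          rw [integral_vadd (-x) (fun ω => (f ω - h ω) ^ 2)]
      _ ≤ N * (ε / (N + 1)) := by
          gcongr
          exact Real.sqrt_le_iff.2 ⟨by positivity, hh'.le⟩
      _ < ε := by
          rw [← mul_div_assoc, div_lt_iff₀ (by positivity)]
          nlinarith

end Helmholtz

/-! ### Functions invariant up to null sets. -/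

section Invariant

variable {d : ℕ} {Ω : Type*} [MeasurableSpace Ω] [AddAction (Euc d) Ω]
  [MeasurableVAdd₂ (Euc d) Ω] {P : Measure Ω} [IsProbabilityMeasure P]
  [VAddInvariantMeasure (Euc d) Ω P]

/-- A bounded function that is invariant up to null sets has an exactly invariant version. -/
lemma exists_invariant_version {f : Ω → ℝ} (hm : Measurable f) {C : ℝ} (hC : ∀ ω, |f ω| ≤ C)
    (hf : ∀ x : Euc d, ∀ᵐ ω ∂P, f (x +ᵥ ω) = f ω) :
    ∃ h : Ω → ℝ, Measurable h ∧ (∀ ω, |h ω| ≤ C) ∧ (∀ (x : Euc d) ω, h (x +ᵥ ω) = h ω) ∧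
      h =ᵐ[P] f := by
  set G := avg (moll d 0) f
  have hGD : G ∈ Ds d P := avg_mem_Ds (isTest_moll 0) hm hC
  have hGf : G =ᵐ[P] f := by
    have h1 : ∀ᵐ ω ∂P, ∀ᵐ x : Euc d, f (-x +ᵥ ω) = f ω := by
      refine (Measure.ae_ae_comm ?_).1 (.of_forall fun x => hf (-x))
      exact measurableSet_eq_fun (hm.comp (measurable_fst.neg.vadd measurable_snd))
        (hm.comp measurable_snd)
    filter_upwards [h1] with ω hω
    have : G ω = ∫ x, moll d 0 x * f ω :=
      integral_congr_ae (by filter_upwards [hω] with x hx; rw [hx])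
    rw [this, integral_mul_const, integral_moll, one_mul]
  -- Continuity of `G` along orbits reduces the condition to a countable dense set of shifts, so `S`
  -- is measurable and of full measure; it is exactly invariant, and so is `G` cut off outside `S`.
  set S := {ω : Ω | ∀ x : Euc d, G (x +ᵥ ω) = G ω} with hS
  have hS' : S = {ω : Ω | ∀ n : ℕ, G (TopologicalSpace.denseSeq (Euc d) n +ᵥ ω) = G ω} := by
    ext ω
    refine ⟨fun h n => h _, fun h x => ?_⟩
    have e : (realisation G ω : Euc d → ℝ) = fun _ => G ω := by
      refine Continuous.ext_on (TopologicalSpace.denseRange_denseSeq (Euc d))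
        (contDiff_of_mem_Ds hGD ω).continuous continuous_const ?_
      rintro _ ⟨n, rfl⟩
      exact h n
    exact congrFun e x
  have hSm : MeasurableSet S := by
    rw [hS', Set.ofPred_forall]
    exact MeasurableSet.iInter fun n =>
      measurableSet_eq_fun (hGD.1.1.comp (measurable_const_vadd _)) hGD.1.1
  have hSinv : ∀ (x : Euc d) ω, x +ᵥ ω ∈ S ↔ ω ∈ S := by
    have h1 : ∀ (x : Euc d) ω, ω ∈ S → x +ᵥ ω ∈ S := fun x ω h y => by
      rw [vadd_vadd, h, h]
    refine fun x ω => ⟨fun h => ?_, h1 x ω⟩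
    simpa [vadd_vadd] using h1 (-x) _ h
  have hSae : ∀ᵐ ω ∂P, ω ∈ S := by
    rw [hS']
    refine ae_all_iff.2 fun n => ?_
    filter_upwards [hGf, ae_vadd (TopologicalSpace.denseSeq (Euc d) n) hGf,
      hf (TopologicalSpace.denseSeq (Euc d) n)] with ω h1 h2 h3
    rw [h1, h2, h3]
  have hGC : ∀ ω, |G ω| ≤ C := fun ω =>
    abs_le.2 (avg_moll_mem_Icc hm (fun ω => abs_le.1 (hC ω)) 0 ω)
  refine ⟨S.indicator G, hGD.1.1.indicator hSm, fun ω => ?_, fun x ω => ?_, ?_⟩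
  · by_cases h : ω ∈ S
    · simpa [h] using hGC ω
    · simpa [h] using (abs_nonneg _).trans (hC ω)
  · by_cases h : ω ∈ S
    · rw [Set.indicator_of_mem h, Set.indicator_of_mem ((hSinv x ω).2 h), h]
    · rw [Set.indicator_of_notMem h, Set.indicator_of_notMem (mt (hSinv x ω).1 h)]
  · filter_upwards [hSae, hGf] with ω h1 h2
    rw [Set.indicator_of_mem h1, h2]

/-- Truncations of `f` are bounded and have exactly invariant versions, to which `h0` applies;
dominated convergence removes the truncation. -/
lemma integral_mul_eq_zero_of_invariant {f g : Ω → ℝ} (hm : Measurable f) (hf2 : MemLp f 2 P)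
    (hg : MemLp g 2 P) (hf : ∀ x : Euc d, ∀ᵐ ω ∂P, f (x +ᵥ ω) = f ω)
    (h0 : ∀ h : Ω → ℝ, Measurable h → (∃ C : ℝ, ∀ ω, |h ω| ≤ C) →
      (∀ (x : Euc d) ω, h (x +ᵥ ω) = h ω) → ∫ ω, g ω * h ω ∂P = 0) :
    ∫ ω, g ω * f ω ∂P = 0 := by
  have hn : ∀ n : ℕ, ∫ ω, g ω * clip (-(n : ℝ)) n f ω ∂P = 0 := fun n => by
    obtain ⟨h, h1, h2, h3, h4⟩ := exists_invariant_version (P := P) (d := d)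
      (measurable_clip (-(n : ℝ)) n hm) (abs_clip_le n f)
      (fun x => (hf x).mono fun ω hω => by simp only [clip, hω])
    rw [← h0 h h1 ⟨_, h2⟩ h3]
    exact integral_congr_ae (by filter_upwards [h4] with ω hω; rw [hω])
  have l := tendsto_integral_of_dominated_convergence (μ := P)
    (F := fun (n : ℕ) ω => g ω * clip (-(n : ℝ)) n f ω) (f := fun ω => g ω * f ω)
    (fun ω => |g ω * f ω|) (fun n => hg.1.mul (measurable_clip _ _ hm).aestronglyMeasurable)
    (integrable_mul_of_memLp hg hf2).abs
    (fun n => .of_forall fun ω => by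
      rw [norm_mul, abs_mul]
      exact mul_le_mul_of_nonneg_left (abs_clip_le_abs n f ω) (norm_nonneg _))
    (.of_forall fun ω => (tendsto_clip f ω).const_mul _)
  simp_rw [hn] at l
  exact tendsto_nhds_unique l tendsto_const_nhds

end Invariant

/-! ### Orthogonality as weak curl-freeness and weak divergence-freeness. -/

section Helmholtz

variable {d : ℕ} {Ω : Type*} [MeasurableSpace Ω] [AddAction (Euc d) Ω]
  [MeasurableVAdd₂ (Euc d) Ω] {P : Measure Ω} [IsProbabilityMeasure P]
  [VAddInvariantMeasure (Euc d) Ω P]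

lemma abs_indicator_one_le (A : Set Ω) (ω : Ω) : |A.indicator (fun _ => (1 : ℝ)) ω| ≤ 1 := by
  by_cases h : ω ∈ A <;> simp [h]

/-- Mollifying the indicator of `A` produces a function in `𝔻_s`. Almost sure identities between
averages can thus be checked set by set using smooth test fields. -/
lemma setIntegral_avg_dpart {A : Set Ω} (hA : MeasurableSet A) {f : Ω → ℝ} (hf : MemLp f 2 P)
    {ρ : Euc d → ℝ} (hρ : IsTest ρ) (i : Fin d) :
    ∫ ω in A, avg (dpart i ρ) f ω ∂P =
      - ∫ ω, f ω * pd i (avg (fun x => ρ (-x)) (A.indicator fun _ => 1)) ω ∂P := by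
  have h1 : Measurable (A.indicator fun _ => (1 : ℝ)) := measurable_const.indicator hA
  have h2 : MemLp (A.indicator fun _ => (1 : ℝ)) 2 P :=
    memLp_of_abs_le h1 (abs_indicator_one_le A) 2
  rw [pd_avg hρ.comp_neg h1 (abs_indicator_one_le A)]
  have e : dpart i (fun x => ρ (-x)) = fun x => - dpart i ρ (-x) := funext (dpart_comp_neg i ρ)
  have e2 : ∀ ω, avg (fun x => - dpart i ρ (-x)) (A.indicator fun _ => 1) ω =
      - avg (fun x => dpart i ρ (-x)) (A.indicator fun _ => 1) ω := fun ω => by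
    simp only [avg, neg_mul, integral_neg]
  simp_rw [e, e2, mul_neg, integral_neg, neg_neg]
  rw [← integral_mul_avg_comm (hρ.dpart i) hf h2, ← integral_indicator hA]
  congr 1; ext ω
  by_cases h : ω ∈ A <;> simp [h]

lemma pd_comm_avg {A : Set Ω} (hA : MeasurableSet A) {ρ : Euc d → ℝ} (hρ : IsTest ρ)
    (i j : Fin d) : pd i (pd j (avg ρ (A.indicator fun _ => 1))) =
      pd j (pd i (avg ρ (A.indicator fun _ => 1))) := by
  have h1 : Measurable (A.indicator fun _ => (1 : ℝ)) := measurable_const.indicator hA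
  have h2 := abs_indicator_one_le A
  rw [pd_avg hρ h1 h2, pd_avg hρ h1 h2, pd_avg (hρ.dpart j) h1 h2, pd_avg (hρ.dpart i) h1 h2,
    dpart_comm hρ.1]

/-- Fields orthogonal to the smooth solenoidal fields are weakly curl-free. -/
lemma avg_dpart_comm_of_orthogonal {v : Fin d → Ω → ℝ} (hv : ∀ j, MemLp (v j) 2 P)
    (h : ∀ s : Fin d → Ω → ℝ, (∀ j, s j ∈ Ds d P) → (∀ ω, ∑ j, pd j (s j) ω = 0) →
      ∑ j, ∫ ω, v j ω * s j ω ∂P = 0) {ρ : Euc d → ℝ} (hρ : IsTest ρ) (i j : Fin d) :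
    avg (dpart i ρ) (v j) =ᵐ[P] avg (dpart j ρ) (v i) := by
  refine Integrable.ae_eq_of_forall_setIntegral_eq _ _
    (integrable_avg (hρ.dpart i) ((hv j).integrable one_le_two))
    (integrable_avg (hρ.dpart j) ((hv i).integrable one_le_two)) fun A hA _ => ?_
  rw [setIntegral_avg_dpart hA (hv j) hρ, setIntegral_avg_dpart hA (hv i) hρ, neg_inj]
  set w := avg (fun x => ρ (-x)) (A.indicator fun _ => (1 : ℝ))
  have hw : w ∈ Ds d P := avg_mem_Ds hρ.comp_neg (measurable_const.indicator hA)
    (abs_indicator_one_le A)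
  have hcomm : pd i (pd j w) = pd j (pd i w) := pd_comm_avg hA hρ.comp_neg i j
  -- The test field has `∂_i w` in slot `j` and `-∂_j w` in slot `i`; it is divergence-free because
  -- the partials commute.
  let a : Fin d → ℝ := fun k => if k = j then 1 else 0
  let b : Fin d → ℝ := fun k => if k = i then -1 else 0
  have hs : ∀ k, a k • pd i w + b k • pd j w ∈ Ds d P := fun k =>
    add_mem_Ds (smul_mem_Ds _ (pd_mem_Ds hw i)) (smul_mem_Ds _ (pd_mem_Ds hw j))
  have h1 := h (fun k => a k • pd i w + b k • pd j w) hs fun ω => by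
    have e : ∀ k, pd k (a k • pd i w + b k • pd j w) ω =
        a k * pd k (pd i w) ω + b k * pd k (pd j w) ω := fun k => by
      rw [pd_add k (contDiff_of_mem_Ds (smul_mem_Ds _ (pd_mem_Ds hw i)))
        (contDiff_of_mem_Ds (smul_mem_Ds (P := P) _ (pd_mem_Ds hw j))),
        pd_smul k _ (contDiff_of_mem_Ds (pd_mem_Ds hw i)),
        pd_smul k _ (contDiff_of_mem_Ds (pd_mem_Ds hw j))]
      rfl
    simp_rw [e]
    simp [a, b, Finset.sum_add_distrib, hcomm]
  have i1 : ∀ k l, Integrable (fun ω => v k ω * pd l w ω) P := fun k l =>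
    integrable_mul_of_memLp (hv k) (pd_mem_Ds hw l).1.2.1
  have e2 : ∀ k, ∫ ω, v k ω * (a k • pd i w + b k • pd j w) ω ∂P =
      a k * ∫ ω, v k ω * pd i w ω ∂P + b k * ∫ ω, v k ω * pd j w ω ∂P := fun k => by
    rw [← integral_const_mul, ← integral_const_mul,
      ← integral_add ((i1 k i).const_mul _) ((i1 k j).const_mul _)]
    congr 1; ext ω
    simp only [Pi.add_apply, Pi.smul_apply, smul_eq_mul]
    ring
  simp_rw [e2] at h1
  simp [a, b, Finset.sum_add_distrib] at h1
  linarith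

/-- Fields orthogonal to the smooth gradients are weakly divergence-free. -/
lemma sum_avg_dpart_of_orthogonal {φ : Fin d → Ω → ℝ} (hφ : ∀ j, MemLp (φ j) 2 P)
    (h : ∀ w ∈ Ds d P, ∑ j : Fin d, ∫ ω, φ j ω * pd j w ω ∂P = 0) {ρ : Euc d → ℝ}
    (hρ : IsTest ρ) : (fun ω => ∑ j, avg (dpart j ρ) (φ j) ω) =ᵐ[P] 0 := by
  have hi : ∀ j ∈ (Finset.univ : Finset (Fin d)), Integrable (avg (dpart j ρ) (φ j)) P :=
    fun j _ => integrable_avg (hρ.dpart j) ((hφ j).integrable one_le_two)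
  refine Integrable.ae_eq_of_forall_setIntegral_eq _ _ (integrable_finsetSum _ hi)
    (integrable_zero _ _ _) fun A hA _ => ?_
  rw [integral_finsetSum _ fun j hj => (hi j hj).integrableOn]
  simp_rw [fun j => setIntegral_avg_dpart hA (hφ j) hρ j]
  rw [Finset.sum_neg_distrib, h _ (avg_mem_Ds hρ.comp_neg (measurable_const.indicator hA)
    (abs_indicator_one_le A))]
  simp

/-- The correlation has zero distributional gradient: `∂_i` falls on `v j`, weak curl-freeness turns
`∂_i v_j` into `∂_j v_i`, and passing `∂_j` to `φ j` produces the divergence of `φ`, which vanishes.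
-/
lemma sum_integral_vadd_const {φ v : Fin d → Ω → ℝ} (hφ : ∀ j, MemLp (φ j) 2 P)
    (hv : ∀ j, MemLp (v j) 2 P) (hvm : ∀ j, Measurable (v j))
    (h1 : ∀ w ∈ Ds d P, ∑ j : Fin d, ∫ ω, φ j ω * pd j w ω ∂P = 0)
    (h2 : ∀ s : Fin d → Ω → ℝ, (∀ j, s j ∈ Ds d P) → (∀ ω, ∑ j, pd j (s j) ω = 0) →
      ∑ j, ∫ ω, v j ω * s j ω ∂P = 0) (x : Euc d) :
    ∑ j, ∫ ω, φ j ω * v j (x +ᵥ ω) ∂P = ∑ j, ∫ ω, φ j ω * v j ω ∂P := by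
  set c : Euc d → ℝ := fun x => ∑ j, ∫ ω, φ j ω * v j (-x +ᵥ ω) ∂P
  have hc : Continuous c := continuous_finsetSum _ fun j _ =>
    continuous_integral_mul_vadd (hvm j) (hv j) (hφ j)
  have h0 : ∀ ρ, IsTest ρ → ∀ i : Fin d, ∫ x, dpart i ρ x * c x = 0 := by
    intro ρ hρ i
    have e1 : ∫ x, dpart i ρ x * c x = ∑ j, ∫ ω, φ j ω * avg (dpart i ρ) (v j) ω ∂P := by
      simp_rw [fun j => integral_mul_avg (hρ.dpart i) (hv j) (hφ j)]
      rw [← integral_finsetSum]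
      · simp only [c, Finset.mul_sum]
      · intro j _
        have := LocallyIntegrable.integrable_mul_test (continuous_integral_mul_vadd (hvm j) (hv j) (hφ j)).locallyIntegrable (hρ.dpart i)
        simpa only [mul_comm] using this
    have e2 : ∀ j, ∫ ω, φ j ω * avg (dpart i ρ) (v j) ω ∂P =
        - ∫ ω, v i ω * avg (dpart j fun x => ρ (-x)) (φ j) ω ∂P := fun j => by
      rw [integral_congr_ae (g := fun ω => φ j ω * avg (dpart j ρ) (v i) ω)
        (by filter_upwards [avg_dpart_comm_of_orthogonal hv h2 hρ i j] with ω hω; rw [hω]),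
        integral_mul_avg_comm (hρ.dpart j) (hv i) (hφ j), ← integral_neg]
      congr 1; ext ω
      rw [← mul_neg]
      congr 1
      rw [avg, avg, ← integral_neg]
      congr 1; ext y
      rw [dpart_comp_neg]
      ring
    rw [e1]
    simp_rw [e2]
    rw [Finset.sum_neg_distrib, ← integral_finsetSum _ fun j _ =>
      integrable_mul_avg (hρ.comp_neg.dpart j) (hφ j) (hv i), neg_eq_zero]
    simp_rw [← Finset.mul_sum]
    rw [integral_congr_ae (g := fun _ => 0)]
    · simp
    · filter_upwards [sum_avg_dpart_of_orthogonal hφ h1 hρ.comp_neg] with ω hω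
      rw [hω]; simp
  have := eq_of_integral_dpart_mul_eq_zero hc h0 (-x) 0
  simpa [c] using this

end Helmholtz

/-! ### The Hilbert space of vector fields and the Helmholtz decomposition. -/

section VectorFields

variable {d : ℕ} {Ω : Type*} [MeasurableSpace Ω] [AddAction (Euc d) Ω]
  [MeasurableVAdd₂ (Euc d) Ω] {P : Measure Ω} [IsProbabilityMeasure P]
  [VAddInvariantMeasure (Euc d) Ω P]

variable (d) in
/-- The Hilbert space of square integrable vector fields. -/
noncomputable abbrev VecLp (P : Measure Ω) := Lp (Euc d) 2 P

lemma memLp_coord (a : VecLp d P) (j : Fin d) : MemLp (fun ω => a ω j) 2 P :=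
  (Lp.memLp a).eval_piLp j

lemma measurable_coord (a : VecLp d P) (j : Fin d) : Measurable (fun ω => a ω j) :=
  (EuclideanSpace.proj (𝕜 := ℝ) j).continuous.measurable.comp (Lp.stronglyMeasurable a).measurable

lemma inner_eq_sum {a b : VecLp d P} {φ v : Fin d → Ω → ℝ}
    (ha : ∀ j, (fun ω => a ω j) =ᵐ[P] φ j) (hb : ∀ j, (fun ω => b ω j) =ᵐ[P] v j) :
    inner ℝ a b = ∑ j, ∫ ω, φ j ω * v j ω ∂P := by
  rw [L2.inner_def, ← integral_finsetSum]
  · refine integral_congr_ae ?_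
    filter_upwards [ae_all_iff.2 ha, ae_all_iff.2 hb] with ω h1 h2
    simp only [PiLp.inner_apply, RCLike.inner_apply, conj_trivial]
    refine Finset.sum_congr rfl fun j _ => ?_
    rw [← h1, ← h2, mul_comm]
  · exact fun j _ => (integrable_mul_of_memLp (memLp_coord a j) (memLp_coord b j)).congr
      ((ha j).mul (hb j))

lemma coord_add (a b : VecLp d P) (j : Fin d) :
    (fun ω => (a + b) ω j) =ᵐ[P] (fun ω => a ω j) + fun ω => b ω j := by
  filter_upwards [Lp.coeFn_add a b] with ω h
  rw [h]; rfl

lemma coord_sub (a b : VecLp d P) (j : Fin d) :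
    (fun ω => (a - b) ω j) =ᵐ[P] (fun ω => a ω j) - fun ω => b ω j := by
  filter_upwards [Lp.coeFn_sub a b] with ω h
  rw [h]; rfl

lemma coord_smul (c : ℝ) (a : VecLp d P) (j : Fin d) :
    (fun ω => (c • a) ω j) =ᵐ[P] c • fun ω => a ω j := by
  filter_upwards [Lp.coeFn_smul c a] with ω h
  rw [h]; rfl

lemma coord_zero (j : Fin d) : (fun ω => (0 : VecLp d P) ω j) =ᵐ[P] 0 := by
  filter_upwards [Lp.coeFn_zero (Euc d) 2 P] with ω h
  rw [h]; rfl

/-- The vector field with given components. -/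
noncomputable def vecLp (s : Fin d → Ω → ℝ) (hs : ∀ j, MemLp (s j) 2 P) : VecLp d P :=
  (MemLp.of_eval_piLp (f := fun ω => WithLp.toLp 2 fun j => s j ω) hs).toLp _

lemma coeFn_vecLp (s : Fin d → Ω → ℝ) (hs : ∀ j, MemLp (s j) 2 P) :
    vecLp s hs =ᵐ[P] fun ω => WithLp.toLp 2 fun j => s j ω := MemLp.coeFn_toLp _

lemma coord_vecLp (s : Fin d → Ω → ℝ) (hs : ∀ j, MemLp (s j) 2 P) (j : Fin d) :
    (fun ω => vecLp s hs ω j) =ᵐ[P] s j := by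
  filter_upwards [coeFn_vecLp s hs] with ω h
  simp [h]

lemma pd_zero (i : Fin d) : pd i (0 : Ω → ℝ) = 0 := by
  ext ω
  have e : (realisation (0 : Ω → ℝ) ω : Euc d → ℝ) = fun _ => 0 := rfl
  simp [pd, dpart, e]

lemma pd_of_invariant (i : Fin d) {h : Ω → ℝ} (hh : ∀ (x : Euc d) ω, h (x +ᵥ ω) = h ω) :
    pd i h = 0 := by
  ext ω
  have e : (realisation h ω : Euc d → ℝ) = fun _ => h ω := funext fun x => hh x ω
  simp [pd, dpart, e]

variable (d P) in
/-- The gradients of smooth functions. -/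
noncomputable def gradSub : Submodule ℝ (VecLp d P) where
  carrier := {a | ∃ w ∈ Ds d P, ∀ j, (fun ω => a ω j) =ᵐ[P] pd j w}
  zero_mem' := ⟨0, zero_mem_Ds, fun j => by rw [pd_zero]; exact coord_zero j⟩
  add_mem' := by
    rintro a b ⟨w, hw, h⟩ ⟨w', hw', h'⟩
    refine ⟨w + w', add_mem_Ds hw hw', fun j => (coord_add a b j).trans ?_⟩
    rw [pd_add j (contDiff_of_mem_Ds hw) (contDiff_of_mem_Ds hw')]
    exact (h j).add (h' j)
  smul_mem' := by
    rintro c a ⟨w, hw, h⟩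
    refine ⟨c • w, smul_mem_Ds c hw, fun j => (coord_smul c a j).trans ?_⟩
    rw [pd_smul j c (contDiff_of_mem_Ds hw)]
    exact (h j).const_smul c

variable (d P) in
/-- The smooth solenoidal fields. -/
noncomputable def solSub : Submodule ℝ (VecLp d P) where
  carrier := {a | ∃ s : Fin d → Ω → ℝ, (∀ j, s j ∈ Ds d P) ∧ (∀ ω, ∑ j, pd j (s j) ω = 0) ∧
    ∀ j, (fun ω => a ω j) =ᵐ[P] s j}
  zero_mem' := ⟨fun _ => 0, fun _ => zero_mem_Ds, by simp [pd_zero], fun j => coord_zero j⟩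
  add_mem' := by
    rintro a b ⟨s, hs, hs0, h⟩ ⟨s', hs', hs0', h'⟩
    refine ⟨fun j => s j + s' j, fun j => add_mem_Ds (hs j) (hs' j), fun ω => ?_,
      fun j => (coord_add a b j).trans ((h j).add (h' j))⟩
    simp_rw [fun j => pd_add j (contDiff_of_mem_Ds (hs j)) (contDiff_of_mem_Ds (hs' j)),
      Pi.add_apply, Finset.sum_add_distrib, hs0, hs0', add_zero]
  smul_mem' := by
    rintro c a ⟨s, hs, hs0, h⟩
    refine ⟨fun j => c • s j, fun j => smul_mem_Ds c (hs j), fun ω => ?_,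
      fun j => (coord_smul c a j).trans ((h j).const_smul c)⟩
    simp_rw [fun j => pd_smul j c (contDiff_of_mem_Ds (hs j)), Pi.smul_apply, smul_eq_mul,
      ← Finset.mul_sum, hs0, mul_zero]

/-- The action of `ℝ^d` on vector fields. -/
noncomputable def shift (x : Euc d) : VecLp d P →ₗᵢ[ℝ] VecLp d P :=
  Lp.compMeasurePreservingₗᵢ ℝ (fun ω => x +ᵥ ω) (measurePreserving_vadd x P)

lemma coeFn_shift (x : Euc d) (a : VecLp d P) : shift x a =ᵐ[P] fun ω => a (x +ᵥ ω) :=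
  Lp.coeFn_compMeasurePreserving a (measurePreserving_vadd x P)

/-- Fields orthogonal to smooth gradients and fields orthogonal to smooth solenoidal fields are
orthogonal to each other. -/
theorem inner_eq_zero_of_mem_orthogonal {φ v : VecLp d P} (hφ : φ ∈ (gradSub d P)ᗮ)
    (hv : v ∈ (solSub d P)ᗮ) : inner ℝ φ v = 0 := by
  have hφ' : ∀ w ∈ Ds d P, ∑ j : Fin d, ∫ ω, φ ω j * pd j w ω ∂P = 0 := fun w hw => by
    have hm : ∀ j : Fin d, MemLp (pd j w) 2 P := fun j => (pd_mem_Ds hw j).1.2.1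
    have := (Submodule.mem_orthogonal' _ _).1 hφ (vecLp (fun j => pd j w) hm)
      ⟨w, hw, coord_vecLp _ hm⟩
    rwa [inner_eq_sum (fun j => ae_eq_refl _) (coord_vecLp _ hm)] at this
  have hv' : ∀ s : Fin d → Ω → ℝ, (∀ j, s j ∈ Ds d P) → (∀ ω, ∑ j, pd j (s j) ω = 0) →
      ∑ j, ∫ ω, v ω j * s j ω ∂P = 0 := fun s hs hs0 => by
    have hm : ∀ j : Fin d, MemLp (s j) 2 P := fun j => (hs j).1.2.1
    have := (Submodule.mem_orthogonal' _ _).1 hv (vecLp s hm) ⟨s, hs, hs0, coord_vecLp _ hm⟩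
    rwa [inner_eq_sum (fun j => ae_eq_refl _) (coord_vecLp _ hm)] at this
  -- Constancy of the correlation is the orbit hypothesis. The remaining one, `v` orthogonal to
  -- invariant fields, holds componentwise because an invariant function in one slot is solenoidal.
  refine inner_eq_zero_of_orbit (U := fun x : Euc d => shift x) (fun x y a => ?_) (fun a => ?_)
    (fun x => ?_) (fun r hr => ?_)
  · refine Lp.ext ?_
    have h2 := ae_vadd (P := P) x (coeFn_shift y a)
    filter_upwards [coeFn_shift (x + y) a, coeFn_shift x (shift y a), h2] with ω h1 h2 h3
    rw [h1, h2, h3, vadd_vadd, add_comm]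
  · refine Lp.ext ?_
    filter_upwards [coeFn_shift (0 : Euc d) a] with ω h1
    rw [h1, zero_vadd]
  · rw [inner_eq_sum (φ := fun j ω => φ ω j) (v := fun j ω => v (x +ᵥ ω) j)
      (fun j => ae_eq_refl _) (fun j => (coeFn_shift x v).mono fun ω h => by simp only [h]),
      inner_eq_sum (φ := fun j ω => φ ω j) (v := fun j ω => v ω j)
      (fun j => ae_eq_refl _) (fun j => ae_eq_refl _)]
    exact sum_integral_vadd_const (memLp_coord φ) (memLp_coord v) (measurable_coord v) hφ' hv' x
  · rw [inner_eq_sum (φ := fun j ω => v ω j) (v := fun j ω => r ω j)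
      (fun j => ae_eq_refl _) (fun j => ae_eq_refl _)]
    refine Finset.sum_eq_zero fun j _ => ?_
    refine integral_mul_eq_zero_of_invariant (d := d) (measurable_coord r j) (memLp_coord r j)
      (memLp_coord v j) (fun x => ?_) fun h hm ⟨C, hC⟩ hinv => ?_
    · have := coeFn_shift x r
      rw [hr x] at this
      filter_upwards [this] with ω h
      rw [← h]
    · have hD : h ∈ Ds d P := mem_Ds_of_invariant hm hC hinv
      have h1 := hv' (fun k => if k = j then h else 0)
        (fun k => by split_ifs; exacts [hD, zero_mem_Ds]) (fun ω => by
          refine Finset.sum_eq_zero fun k _ => ?_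
          split_ifs
          · rw [pd_of_invariant k hinv]; rfl
          · rw [pd_zero]; rfl)
      rw [Finset.sum_eq_single j (fun k _ hk => by simp [hk]) (by simp)] at h1
      simpa using h1

/-- The mutual orthogonality says that `g` lies in the double orthogonal complement of the
gradients. -/
lemma mem_closure_gradSub {g : VecLp d P} (hg : g ∈ (solSub d P)ᗮ) :
    g ∈ (gradSub d P).topologicalClosure := by
  rw [← Submodule.orthogonal_orthogonal_eq_closure]
  exact (Submodule.mem_orthogonal _ _).2 fun φ hφ => inner_eq_zero_of_mem_orthogonal hφ hg

/-! ### Multiplication operators -/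

/-- Multiplication by a bounded function. -/
noncomputable def mulOp {g : Ω → ℝ} (hg : MemLp g ∞ P) : VecLp d P →L[ℝ] VecLp d P :=
  (ContinuousLinearMap.lsmul ℝ ℝ : ℝ →L[ℝ] Euc d →L[ℝ] Euc d).holderL P ∞ 2 2 (hg.toLp g)

lemma coeFn_mulOp {g : Ω → ℝ} (hg : MemLp g ∞ P) (a : VecLp d P) :
    mulOp hg a =ᵐ[P] fun ω => g ω • a ω := by
  have h := ContinuousLinearMap.coeFn_holder (r := 2)
    (ContinuousLinearMap.lsmul ℝ ℝ : ℝ →L[ℝ] Euc d →L[ℝ] Euc d) (hg.toLp g) a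
  filter_upwards [h, hg.coeFn_toLp] with ω h1 h2
  rw [h2] at h1
  exact h1

lemma inner_mulOp {g : Ω → ℝ} (hg : MemLp g ∞ P) (a b : VecLp d P) :
    inner ℝ (mulOp hg a) b = inner ℝ a (mulOp hg b) := by
  rw [L2.inner_def, L2.inner_def]
  refine integral_congr_ae ?_
  filter_upwards [coeFn_mulOp hg a, coeFn_mulOp hg b] with ω h1 h2
  rw [h1, h2, real_inner_smul_left, real_inner_smul_right]

lemma mulOp_mulOp {g h : Ω → ℝ} (hg : MemLp g ∞ P) (hh : MemLp h ∞ P)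
    (e : ∀ᵐ ω ∂P, g ω * h ω = 1) (a : VecLp d P) : mulOp hg (mulOp hh a) = a := by
  refine Lp.ext ?_
  filter_upwards [coeFn_mulOp hg (mulOp hh a), coeFn_mulOp hh a, e] with ω h1 h2 h3
  rw [h1, h2, smul_smul, h3, one_smul]

lemma norm_sq_mulOp {g : Ω → ℝ} (hg : MemLp g ∞ P) {a : VecLp d P} {φ : Ω → Euc d}
    (ha : a =ᵐ[P] φ) : ‖mulOp hg a‖ ^ 2 = ∫ ω, g ω ^ 2 * ‖φ ω‖ ^ 2 ∂P := by
  rw [← real_inner_self_eq_norm_sq, L2.inner_def]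
  refine integral_congr_ae ?_
  filter_upwards [coeFn_mulOp hg a, ha] with ω h1 h2
  rw [h1, h2, real_inner_self_eq_norm_sq, norm_smul, mul_pow, Real.norm_eq_abs, sq_abs]

variable (P) in
/-- The constant vector fields. -/
noncomputable def constField : Euc d →L[ℝ] VecLp d P := Lp.constL 2 P ℝ

lemma coeFn_constField (η : Euc d) : constField P η =ᵐ[P] fun _ => η := Lp.coeFn_const 2 P η

lemma constField_mem_solSub (η : Euc d) : constField P η ∈ solSub d P := by
  refine ⟨fun j _ => η j, fun j => const_mem_Ds _, fun ω => ?_, fun j => ?_⟩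
  · refine Finset.sum_eq_zero fun j _ => ?_
    rw [pd_of_invariant j fun _ _ => rfl]; rfl
  · filter_upwards [coeFn_constField (P := P) η] with ω h
    rw [h]

lemma inner_constField (η : Euc d) {a : VecLp d P} {φ : Ω → Euc d} (ha : a =ᵐ[P] φ) :
    inner ℝ (constField P η) a = inner ℝ η (∫ ω, φ ω ∂P) := by
  have hφ : Integrable φ P := ((Lp.memLp a).ae_eq ha).integrable one_le_two
  rw [← integral_inner hφ, L2.inner_def]
  refine integral_congr_ae ?_
  filter_upwards [coeFn_constField (P := P) η, ha] with ω h1 h2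
  rw [h1, h2]

lemma inner_constField_constField (η ξ : Euc d) :
    inner ℝ (constField P η) (constField P ξ) = inner ℝ η ξ := by
  rw [inner_constField η (coeFn_constField ξ)]
  simp

/-- Constant fields are solenoidal and finite-dimensional, so solenoidal fields split orthogonally
into constants and mean-zero ones. Subtracting the projection of `u` onto constants removes the part
not yet controlled. -/
lemma exists_constField_of_orthogonal {u : VecLp d P}
    (hu : u ∈ (solSub d P ⊓ (LinearMap.range (constField P : Euc d →L[ℝ] VecLp d P).toLinearMap)ᗮ)ᗮ) :
    ∃ ξ : Euc d, u - constField P ξ ∈ (solSub d P)ᗮ := by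
  set C := LinearMap.range (constField P : Euc d →L[ℝ] VecLp d P).toLinearMap
  have hC : C ≤ solSub d P := by
    rintro _ ⟨η, rfl⟩
    exact constField_mem_solSub η
  obtain ⟨ξ, hξ⟩ : C.starProjection u ∈ C := Submodule.starProjection_apply_mem _ _
  refine ⟨ξ, (Submodule.mem_orthogonal _ _).2 fun s hs => ?_⟩
  have h1 : s - C.starProjection s ∈ solSub d P ⊓ Cᗮ :=
    ⟨(solSub d P).sub_mem hs (hC (Submodule.starProjection_apply_mem _ _)),
      Submodule.sub_starProjection_mem_orthogonal s⟩
  have h2 := (Submodule.mem_orthogonal _ _).1 hu _ h1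
  have h3 : constField P ξ = C.starProjection u := hξ
  rw [h3, inner_sub_right, ← Submodule.inner_starProjection_left_eq_right, ← inner_sub_left]
  exact h2

end VectorFields

/-! ### Duality between solenoidal energies and weighted gradient distances. -/

section Duality

variable {d : ℕ} {Ω : Type*} [MeasurableSpace Ω] [AddAction (Euc d) Ω]
  [MeasurableVAdd₂ (Euc d) Ω] {P : Measure Ω} [IsProbabilityMeasure P]
  [VAddInvariantMeasure (Euc d) Ω P]

lemma memLp_sqrt {f : Ω → ℝ} (hf : f ∈ Fw d P) : MemLp (fun ω => Real.sqrt (f ω)) ∞ P := by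
  obtain ⟨C, -, hC⟩ := exists_ae_bound hf.2.2.2.1
  refine memLp_top_of_bound (Real.continuous_sqrt.measurable.comp hf.1.1).aestronglyMeasurable
    (Real.sqrt C) ?_
  filter_upwards [hC] with ω h
  rw [Real.norm_of_nonneg (Real.sqrt_nonneg _)]
  exact Real.sqrt_le_sqrt ((le_abs_self _).trans h)

lemma memLp_inv_sqrt {f : Ω → ℝ} (hf : f ∈ Fw d P) :
    MemLp (fun ω => (Real.sqrt (f ω))⁻¹) ∞ P := by
  obtain ⟨c, hc, hcf⟩ := hf.2.2.1
  refine memLp_top_of_bound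
    (Real.continuous_sqrt.measurable.comp hf.1.1).inv.aestronglyMeasurable (Real.sqrt c)⁻¹ ?_
  filter_upwards [hcf] with ω h
  rw [Real.norm_of_nonneg (inv_nonneg.2 (Real.sqrt_nonneg _))]
  exact inv_anti₀ (Real.sqrt_pos.2 hc) (Real.sqrt_le_sqrt h.le)

lemma ae_pos_of_mem_Fw {f : Ω → ℝ} (hf : f ∈ Fw d P) : ∀ᵐ ω ∂P, 0 < f ω := by
  obtain ⟨c, hc, hcf⟩ := hf.2.2.1
  filter_upwards [hcf] with ω h using hc.trans h

/-- The energy `∫ |φ|² / f`. -/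
noncomputable def energy (P : Measure Ω) (f : Ω → ℝ) (φ : Ω → Euc d) : ℝ :=
  ∫ ω, ‖φ ω‖ ^ 2 / f ω ∂P

/-- The weighted distance `∫ |η - ∇ w|² f`. -/
noncomputable def wdist (P : Measure Ω) (η : Euc d) (f w : Ω → ℝ) : ℝ :=
  ∫ ω, ‖η - grad P w ω‖ ^ 2 * f ω ∂P

lemma norm_sq_inv_sqrt {f : Ω → ℝ} (hf : f ∈ Fw d P) {a : VecLp d P} {φ : Ω → Euc d}
    (ha : a =ᵐ[P] φ) : ‖mulOp (memLp_inv_sqrt hf) a‖ ^ 2 = energy P f φ := by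
  rw [norm_sq_mulOp _ ha]
  refine integral_congr_ae ?_
  filter_upwards [ae_pos_of_mem_Fw hf] with ω h
  rw [inv_pow, Real.sq_sqrt h.le, div_eq_inv_mul]

/-- The weak gradient as a square integrable vector field. -/
noncomputable def gradField {w : Ω → ℝ} (hw : w ∈ Dw d P) : VecLp d P :=
  vecLp (fun j => weakPartial P j w) (memLp_weakPartial_of_mem_Dw hw)

lemma coeFn_gradField {w : Ω → ℝ} (hw : w ∈ Dw d P) : gradField hw =ᵐ[P] grad P w :=
  coeFn_vecLp _ _

lemma norm_sq_sqrt {f w : Ω → ℝ} (hf : f ∈ Fw d P) (hw : w ∈ Dw d P) (η : Euc d) :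
    ‖mulOp (memLp_sqrt hf) (constField P η - gradField hw)‖ ^ 2 = wdist P η f w := by
  rw [norm_sq_mulOp (φ := fun ω => η - grad P w ω)]
  · refine integral_congr_ae ?_
    filter_upwards [ae_pos_of_mem_Fw hf] with ω h
    rw [Real.sq_sqrt h.le, mul_comm]
  · filter_upwards [Lp.coeFn_sub (constField P η) (gradField hw), coeFn_constField (P := P) η,
      coeFn_gradField hw] with ω h1 h2 h3
    rw [h1, Pi.sub_apply, h2, h3]

lemma inv_sqrt_sqrt {f : Ω → ℝ} (hf : f ∈ Fw d P) (a : VecLp d P) :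
    mulOp (memLp_inv_sqrt hf) (mulOp (memLp_sqrt hf) a) = a := by
  refine mulOp_mulOp _ _ ?_ a
  filter_upwards [ae_pos_of_mem_Fw hf] with ω h
  exact inv_mul_cancel₀ (Real.sqrt_pos.2 h).ne'

lemma sqrt_inv_sqrt {f : Ω → ℝ} (hf : f ∈ Fw d P) (a : VecLp d P) :
    mulOp (memLp_sqrt hf) (mulOp (memLp_inv_sqrt hf) a) = a := by
  refine mulOp_mulOp _ _ ?_ a
  filter_upwards [ae_pos_of_mem_Fw hf] with ω h
  exact mul_inv_cancel₀ (Real.sqrt_pos.2 h).ne'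

/-- Integration by parts moves the derivatives onto the smooth bounded field, whose divergence is
zero; hence `w` may be any element of `𝔻_w`. -/
lemma inner_gradField_eq_zero {a : VecLp d P} (ha : a ∈ solSub d P) {w : Ω → ℝ}
    (hw : w ∈ Dw d P) : inner ℝ a (gradField hw) = 0 := by
  obtain ⟨s, hs, hs0, h⟩ := ha
  rw [gradField, inner_eq_sum h (coord_vecLp _ (memLp_weakPartial_of_mem_Dw hw))]
  have e : ∀ j, ∫ ω, s j ω * weakPartial P j w ω ∂P = - ∫ ω, w ω * pd j (s j) ω ∂P := fun j => by
    obtain ⟨C, hC⟩ := exists_bound_of_mem_Ds (hs j)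
    obtain ⟨C', hC'⟩ := exists_bound_pd_of_mem_Ds (hs j) j
    rw [← (isWeakPartial_of_mem_Dw hw j).integral_mul (hw.2.1.integrable one_le_two)
      ((memLp_weakPartial_of_mem_Dw hw j).integrable one_le_two) (hs j).1.1
      (contDiff_of_mem_Ds (hs j)) (C := max C C') (fun ω => (hC ω).trans (le_max_left _ _))
      (fun ω => (hC' ω).trans (le_max_right _ _))]
    simp_rw [mul_comm]
  simp_rw [e]
  rw [Finset.sum_neg_distrib, ← integral_finsetSum _ fun j _ =>
    integrable_mul_of_memLp hw.2.1 (pd_mem_Ds (hs j) j).1.2.1]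
  simp_rw [← Finset.mul_sum, hs0]
  simp

lemma memLp_of_mem_PhiS {y : Euc d} {φ : Ω → Euc d} (hφ : φ ∈ PhiS P y) : MemLp φ 2 P :=
  MemLp.of_eval_piLp fun j => (hφ.1 j).1.2.1

lemma toLp_mem_solSub {y : Euc d} {φ : Ω → Euc d} (hφ : φ ∈ PhiS P y) :
    (memLp_of_mem_PhiS hφ).toLp φ ∈ solSub d P := by
  refine ⟨fun j ω => φ ω j, hφ.1, hφ.2.1, fun j => ?_⟩
  filter_upwards [(memLp_of_mem_PhiS hφ).coeFn_toLp] with ω h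
  rw [h]

/-- Weak duality between solenoidal fields and gradients. -/
lemma inner_sq_le {y : Euc d} {φ : Ω → Euc d} (hφ : φ ∈ PhiS P y) {f w : Ω → ℝ}
    (hf : f ∈ Fw d P) (hw : w ∈ Dw d P) (η : Euc d) :
    inner ℝ y η ^ 2 ≤ energy P f φ * wdist P η f w := by
  set a := (memLp_of_mem_PhiS hφ).toLp φ
  have ha : a =ᵐ[P] φ := (memLp_of_mem_PhiS hφ).coeFn_toLp
  have haS : a ∈ solSub d P := toLp_mem_solSub hφ
  rw [← norm_sq_inv_sqrt hf ha, ← norm_sq_sqrt hf hw η, ← mul_pow]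
  -- The weights `f^{-1/2}` and `f^{1/2}` cancel, the gradient drops out, and only the mean of `φ`
  -- remains.
  have e : inner ℝ (mulOp (memLp_inv_sqrt hf) a)
      (mulOp (memLp_sqrt hf) (constField P η - gradField hw)) = inner ℝ y η := by
    rw [inner_mulOp, inv_sqrt_sqrt hf, inner_sub_right, inner_gradField_eq_zero haS, sub_zero,
      real_inner_comm, inner_constField η ha, hφ.2.2, real_inner_comm]
  rw [← e, ← sq_abs]
  exact pow_le_pow_left₀ (abs_nonneg _) (abs_real_inner_le_norm _ _) 2

lemma integral_eq_zero_of_mem_orthogonal_const {a : VecLp d P} {φ : Ω → Euc d} (ha : a =ᵐ[P] φ)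
    (h : a ∈ (LinearMap.range (constField P : Euc d →L[ℝ] VecLp d P).toLinearMap)ᗮ) :
    ∫ ω, φ ω ∂P = 0 := by
  have := (Submodule.mem_orthogonal _ _).1 h (constField P (∫ ω, φ ω ∂P)) ⟨_, rfl⟩
  rw [inner_constField _ ha] at this
  exact inner_self_eq_zero.1 this

/-- Strong duality between solenoidal fields and gradients. -/
lemma exists_dual_pair {f : Ω → ℝ} (hf : f ∈ Fw d P) (y : Euc d) :
    ∃ (ξ : Euc d) (q : ℝ), inner ℝ y ξ = q ∧
      (∀ ε > 0, ∃ φ ∈ PhiS P y, energy P f φ < q + ε) ∧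
      ∀ ε > 0, ∃ w ∈ Ds d P, wdist P ξ f w < q + ε := by
  set T := mulOp (memLp_inv_sqrt hf) with hT
  set S := mulOp (memLp_sqrt hf) with hS
  set S₀ := solSub d P ⊓ (LinearMap.range (constField P : Euc d →L[ℝ] VecLp d P).toLinearMap)ᗮ
    with hS₀
  -- Minimising the energy over `Φ_y^s` is finding the distance from `f^{-1/2} y` to `B`, as
  -- solenoidal fields of mean `y` are `y` minus elements of `S₀`. The residual `r` attains it on
  -- the closure.
  set B := (S₀.map T.toLinearMap).topologicalClosure with hB
  have : CompleteSpace B := (Submodule.isClosed_topologicalClosure _).completeSpace_coe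
  set z := T (constField P y)
  set b := B.starProjection z
  have hb : b ∈ B := Submodule.starProjection_apply_mem _ _
  set r := z - b with hr
  have hrB : ∀ a ∈ B, inner ℝ a r = 0 := fun a ha =>
    (Submodule.mem_orthogonal _ _).1 (Submodule.sub_starProjection_mem_orthogonal z) a ha
  have hu : T r ∈ S₀ᗮ := (Submodule.mem_orthogonal _ _).2 fun a ha => by
    rw [← inner_mulOp]
    exact hrB _ (Submodule.le_topologicalClosure _ ⟨a, ha, rfl⟩)
  obtain ⟨ξ, hξ⟩ := exists_constField_of_orthogonal hu
  have hq : inner ℝ y ξ = ‖r‖ ^ 2 := by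
    have h1 : inner ℝ (constField P y) (T r - constField P ξ) = 0 :=
      (Submodule.mem_orthogonal _ _).1 hξ _ (constField_mem_solSub y)
    rw [inner_sub_right, inner_constField_constField, sub_eq_zero, ← inner_mulOp] at h1
    rw [← h1, ← real_inner_self_eq_norm_sq]
    have h2 := hrB b hb
    change inner ℝ z r = inner ℝ r r
    conv_rhs => rw [hr, inner_sub_left, h2, sub_zero]
  refine ⟨ξ, ‖r‖ ^ 2, hq, fun ε hε => ?_, fun ε hε => ?_⟩
  · have ho : IsOpen {x : VecLp d P | ‖z - x‖ ^ 2 < ‖r‖ ^ 2 + ε} :=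
      isOpen_lt (by fun_prop) continuous_const
    have hmem : b ∈ {x : VecLp d P | ‖z - x‖ ^ 2 < ‖r‖ ^ 2 + ε} := by
      simp only [Set.mem_ofPred_eq, ← hr]; linarith
    obtain ⟨_, hx, a, ha, rfl⟩ := mem_closure_iff.1 hb _ ho hmem
    obtain ⟨s, hs, hs0, h⟩ := ha.1
    have has : a =ᵐ[P] fun ω => WithLp.toLp 2 fun j => s j ω := by
      filter_upwards [ae_all_iff.2 h] with ω h1
      ext j
      exact h1 j
    have hmean := integral_eq_zero_of_mem_orthogonal_const has ha.2
    have has' : (constField P y - a : VecLp d P) =ᵐ[P]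
        fun ω => y - WithLp.toLp 2 fun j => s j ω := by
      filter_upwards [Lp.coeFn_sub (constField P y) a, coeFn_constField (P := P) y, has]
        with ω h1 h2 h3
      rw [h1, Pi.sub_apply, h2, h3]
    have hD : ∀ j, (fun _ => y j : Ω → ℝ) + (-1 : ℝ) • s j ∈ Ds d P := fun j =>
      add_mem_Ds (const_mem_Ds _) (smul_mem_Ds _ (hs j))
    have hφ : ∀ j, (fun ω => (y - WithLp.toLp 2 fun j => s j ω : Euc d) j) =
        (fun _ => y j : Ω → ℝ) + (-1 : ℝ) • s j := fun j => by
      ext ω; simp [sub_eq_add_neg]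
    refine ⟨fun ω => y - WithLp.toLp 2 fun j => s j ω, ⟨fun j => ?_, fun ω => ?_, ?_⟩, ?_⟩
    · rw [hφ]; exact hD j
    · have e : ∀ j, pd j (fun ω => (y - WithLp.toLp 2 fun j => s j ω : Euc d) j) ω =
          - pd j (s j) ω := fun j => by
        rw [hφ, pd_add j (contDiff_of_mem_Ds (const_mem_Ds (P := P) _))
          (contDiff_of_mem_Ds (smul_mem_Ds _ (hs j))), pd_smul j _ (contDiff_of_mem_Ds (hs j)),
          pd_of_invariant j fun _ _ => rfl]
        simp
      change ∑ j, pd j (fun ω => (y - WithLp.toLp 2 fun j => s j ω : Euc d) j) ω = 0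
      simp_rw [e, Finset.sum_neg_distrib, hs0, neg_zero]
    · rw [integral_sub (integrable_const y)
        (((Lp.memLp a).ae_eq has).integrable one_le_two), hmean]
      simp
    · rw [← norm_sq_inv_sqrt hf has', map_sub]
      exact hx
  -- By the Helmholtz decomposition `-g` is a limit of smooth gradients, and `ξ - (-g) = f^{-1/2} r`
  -- has weighted norm exactly `‖r‖`. Both problems therefore share the value `‖r‖²`.
  · set g := T r - constField P ξ with hg
    have hg' : -g ∈ (gradSub d P).topologicalClosure :=
      (gradSub d P).topologicalClosure.neg_mem (mem_closure_gradSub hξ)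
    have ho : IsOpen {x : VecLp d P | ‖S (constField P ξ - x)‖ ^ 2 < ‖r‖ ^ 2 + ε} :=
      isOpen_lt (by fun_prop) continuous_const
    have hmem : -g ∈ {x : VecLp d P | ‖S (constField P ξ - x)‖ ^ 2 < ‖r‖ ^ 2 + ε} := by
      have e : constField P ξ - -g = T r := by rw [hg]; abel
      simp only [Set.mem_ofPred_eq, e]
      rw [sqrt_inv_sqrt hf]; linarith
    obtain ⟨x, hx, w, hw, h⟩ := mem_closure_iff.1 hg' _ ho hmem
    have hxw : x = gradField hw.1 := by
      refine Lp.ext ?_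
      filter_upwards [ae_all_iff.2 h, coeFn_gradField hw.1,
        ae_all_iff.2 fun j => weakPartial_of_mem_Ds hw j] with ω h1 h2 h3
      rw [h2]
      ext j
      rw [h1 j]
      exact (h3 j).symm
    refine ⟨w, hw, ?_⟩
    rw [← norm_sq_sqrt hf hw.1, ← hxw]
    exact hx

/-! ### The functionals `H` and `J` -/

lemma wdist_nonneg {f : Ω → ℝ} (hf : f ∈ Fw d P) (η : Euc d) (w : Ω → ℝ) : 0 ≤ wdist P η f w := by
  refine integral_nonneg_of_ae ?_
  filter_upwards [ae_pos_of_mem_Fw hf] with ω h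
  exact mul_nonneg (sq_nonneg _) h.le

lemma energy_nonneg {f : Ω → ℝ} (hf : f ∈ Fw d P) (φ : Ω → Euc d) : 0 ≤ energy P f φ := by
  refine integral_nonneg_of_ae ?_
  filter_upwards [ae_pos_of_mem_Fw hf] with ω h
  exact div_nonneg (sq_nonneg _) h.le

/-- Since `f` is bounded, the weighted distance is continuous under `L²` convergence of gradients.
Hence `H` does not depend on the dense family `D`. -/
lemma H_le {D : Set (Ω → ℝ)} (hD : D ∈ DenseSpaces d P) {f w : Ω → ℝ} (hf : f ∈ Fw d P)
    (hw : w ∈ Dw d P) (η : Euc d) : H P D (fun _ => η) f ≤ wdist P η f w := by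
  have hbdd : BddBelow (Set.range fun w : D => wdist P η f (w : Ω → ℝ)) :=
    ⟨0, by rintro _ ⟨w, rfl⟩; exact wdist_nonneg hf η w⟩
  choose g hgD hg using fun n : ℕ => hD.2 w hw (ENNReal.ofReal (1 / ((n : ℝ) + 1)))
    (by rw [gt_iff_lt, ENNReal.ofReal_pos]; positivity)
  have hgw : ∀ n, g n ∈ Dw d P := fun n => hD.1 (hgD n)
  have h0 : Tendsto (fun n => nablaNorm d P (g n - w)) atTop (𝓝 0) := by
    refine tendsto_of_tendsto_of_tendsto_of_le_of_le tendsto_const_nhds ?_ (fun _ => zero_le)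
      fun n => (hg n).le
    simpa using ENNReal.tendsto_ofReal (tendsto_one_div_add_atTop_nhds_zero_nat (𝕜 := ℝ))
  have h1 := ((tendsto_nablaNorm_iff hw hgw).1 h0).2
  have h2 : Tendsto (fun n => gradField (hgw n)) atTop (𝓝 (gradField hw)) := by
    rw [tendsto_iff_norm_sub_tendsto_zero]
    have e : ∀ n, ‖gradField (hgw n) - gradField hw‖ ^ 2 =
        ∑ i : Fin d, ∫ ω, (weakPartial P i (g n) ω - weakPartial P i w ω) ^ 2 ∂P := fun n => by
      have hc : ∀ j, (fun ω => (gradField (hgw n) - gradField hw) ω j) =ᵐ[P]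
          (weakPartial P j (g n) - weakPartial P j w) := fun j =>
        (coord_sub _ _ j).trans ((coord_vecLp _ (memLp_weakPartial_of_mem_Dw (hgw n)) j).sub
          (coord_vecLp _ (memLp_weakPartial_of_mem_Dw hw) j))
      rw [← real_inner_self_eq_norm_sq, inner_eq_sum hc hc]
      simp_rw [Pi.sub_apply, ← sq]
    have h3 : Tendsto (fun n => ‖gradField (hgw n) - gradField hw‖ ^ 2) atTop (𝓝 0) := by
      simp_rw [e]
      simpa using tendsto_finsetSum Finset.univ fun i _ => h1 i
    have h4 := (Real.continuous_sqrt.tendsto 0).comp h3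
    simpa [Function.comp_def] using h4
  have h5 : Tendsto (fun n => wdist P η f (g n)) atTop (𝓝 (wdist P η f w)) := by
    simp_rw [fun n => (norm_sq_sqrt hf (hgw n) η).symm, ← norm_sq_sqrt hf hw η]
    exact ((((mulOp (memLp_sqrt hf)).continuous.tendsto _).comp (h2.const_sub _)).norm).pow 2
  exact ge_of_tendsto h5 (.of_forall fun n => ciInf_le hbdd ⟨g n, hgD n⟩)

lemma grad_smul_of_mem_Ds {w : Ω → ℝ} (hw : w ∈ Ds d P) (c : ℝ) :
    grad P (c • w) =ᵐ[P] fun ω => c • (grad P w ω : Euc d) := by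
  filter_upwards [ae_all_iff.2 fun j => weakPartial_of_mem_Ds hw j,
    ae_all_iff.2 fun j => weakPartial_of_mem_Ds (smul_mem_Ds c hw) j] with ω h1 h2
  ext j
  change weakPartial P j (c • w) ω = c * weakPartial P j w ω
  rw [h1, h2, pd_smul j c (contDiff_of_mem_Ds hw)]
  rfl

lemma wdist_smul {f w : Ω → ℝ} (hw : w ∈ Ds d P) (c : ℝ) (η : Euc d) :
    wdist P (c • η) f (c • w) = c ^ 2 * wdist P η f w := by
  unfold wdist
  rw [← integral_const_mul]
  refine integral_congr_ae ?_
  filter_upwards [grad_smul_of_mem_Ds hw c] with ω h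
  rw [h, ← smul_sub, norm_smul, mul_pow, Real.norm_eq_abs, sq_abs, mul_assoc]

lemma zero_mem_Dw : (0 : Ω → ℝ) ∈ Dw d P := (zero_mem_Ds).1

lemma wdist_zero {f : Ω → ℝ} (hf : f ∈ Fw d P) (η : Euc d) : wdist P η f 0 = ‖η‖ ^ 2 := by
  have h : ∀ᵐ ω ∂P, grad P (0 : Ω → ℝ) ω = (0 : Euc d) := by
    filter_upwards [ae_all_iff.2 fun j : Fin d => weakPartial_of_mem_Ds (P := P) zero_mem_Ds j]
      with ω h
    ext j
    change weakPartial P j 0 ω = 0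
    rw [h, pd_zero]; rfl
  unfold wdist
  rw [integral_congr_ae (g := fun ω => ‖η‖ ^ 2 * f ω)
    (by filter_upwards [h] with ω hω; rw [hω, sub_zero]), integral_const_mul, hf.2.1, mul_one]

/-- Weak duality with `w = 0` and `η = y`, using `E f = 1`. -/
lemma norm_sq_le_energy {y : Euc d} (hy : y ≠ 0) {φ : Ω → Euc d} (hφ : φ ∈ PhiS P y) {f : Ω → ℝ}
    (hf : f ∈ Fw d P) : ‖y‖ ^ 2 ≤ energy P f φ := by
  have h := inner_sq_le hφ hf zero_mem_Dw y
  rw [wdist_zero hf, real_inner_self_eq_norm_sq, sq (‖y‖ ^ 2)] at h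
  exact le_of_mul_le_mul_right h (by positivity)

lemma const_mem_PhiS (y : Euc d) : (fun _ => y : Ω → Euc d) ∈ PhiS P y := by
  refine ⟨fun j => const_mem_Ds _, fun ω => ?_, by simp⟩
  refine Finset.sum_eq_zero fun j _ => ?_
  have := congrFun (pd_of_invariant (Ω := Ω) (h := fun _ => y j) j fun _ _ => rfl) ω
  exact this

/-- `inf_{φ ∈ Φ_y^s} ∫ |φ|² / f`. -/
noncomputable def minEnergy (P : Measure Ω) (y : Euc d) (f : Ω → ℝ) : ℝ :=
  ⨅ φ : PhiS P y, energy P f (φ : Ω → Euc d)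

lemma minEnergy_le {y : Euc d} {φ : Ω → Euc d} (hφ : φ ∈ PhiS P y) {f : Ω → ℝ}
    (hf : f ∈ Fw d P) : minEnergy P y f ≤ energy P f φ :=
  ciInf_le (f := fun φ : PhiS P y => energy P f (φ : Ω → Euc d))
    ⟨0, by rintro _ ⟨φ, rfl⟩; exact energy_nonneg hf _⟩ ⟨φ, hφ⟩

lemma le_minEnergy {y : Euc d} {f : Ω → ℝ} {c : ℝ} (h : ∀ φ ∈ PhiS P y, c ≤ energy P f φ) :
    c ≤ minEnergy P y f := by
  have : Nonempty (PhiS P y) := ⟨⟨_, const_mem_PhiS y⟩⟩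
  exact le_ciInf fun φ => h _ φ.2

lemma norm_sq_le_minEnergy {y : Euc d} (hy : y ≠ 0) {f : Ω → ℝ} (hf : f ∈ Fw d P) :
    ‖y‖ ^ 2 ≤ minEnergy P y f := le_minEnergy fun _ hφ => norm_sq_le_energy hy hφ hf

/-- Weak duality gives `1 / energy ≤ J` for each field. The pair from `exists_dual_pair` closes the
gap: after normalising `ξ`, the quotient in `J` is at most `(q / ‖ξ‖²) / (q / ‖ξ‖)² = 1 / q`. -/
theorem J_eq_inv_minEnergy {D : Set (Ω → ℝ)} (hD : D ∈ DenseSpaces d P) {y : Euc d} (hy : y ≠ 0)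
    {f : Ω → ℝ} (hf : f ∈ Fw d P) : J P D y f = (minEnergy P y f)⁻¹ := by
  have hy0 : 0 < ‖y‖ := norm_pos_iff.2 hy
  have hDne : Nonempty D := by
    obtain ⟨g, hg, -⟩ := hD.2 0 zero_mem_Dw 1 one_pos
    exact ⟨⟨g, hg⟩⟩
  -- A real infimum over an empty index set would default to `0`; here `y / ‖y‖` is an admissible
  -- direction.
  have hne : Nonempty {η : Euc d // ‖η‖ = 1 ∧ inner ℝ y η ≠ 0} := by
    refine ⟨⟨‖y‖⁻¹ • y, ?_, ?_⟩⟩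
    · rw [norm_smul, norm_inv, norm_norm, inv_mul_cancel₀ hy0.ne']
    · rw [real_inner_smul_right, real_inner_self_eq_norm_sq]
      positivity
  have hH : ∀ φ ∈ PhiS P y, ∀ η : Euc d,
      inner ℝ y η ^ 2 ≤ energy P f φ * H P D (fun _ => η) f := by
    intro φ hφ η
    have hE : 0 < energy P f φ := (by positivity : 0 < ‖y‖ ^ 2).trans_le
      (norm_sq_le_energy hy hφ hf)
    rw [← div_le_iff₀' hE]
    refine le_ciInf fun w => ?_
    rw [div_le_iff₀' hE]
    exact inner_sq_le hφ hf (hD.1 w.2) η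
  have hJ : ∀ φ ∈ PhiS P y, (energy P f φ)⁻¹ ≤ J P D y f := by
    intro φ hφ
    have hE : 0 < energy P f φ := (by positivity : 0 < ‖y‖ ^ 2).trans_le
      (norm_sq_le_energy hy hφ hf)
    refine le_ciInf fun η => ?_
    have h1 : 0 < inner ℝ y (η : Euc d) ^ 2 := by have := η.2.2; positivity
    rw [le_div_iff₀ h1, inv_mul_le_iff₀ hE]
    exact hH φ hφ η
  have hQ : 0 < minEnergy P y f := (by positivity : 0 < ‖y‖ ^ 2).trans_le
    (norm_sq_le_minEnergy hy hf)
  obtain ⟨ξ, q, hξ, hφq, hwq⟩ := exists_dual_pair hf y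
  have hq0 : ‖y‖ ^ 2 ≤ q := le_of_forall_pos_le_add fun ε hε => by
    obtain ⟨φ, hφ, h⟩ := hφq ε hε
    exact (norm_sq_le_energy hy hφ hf).trans h.le
  have hq : 0 < q := (by positivity : 0 < ‖y‖ ^ 2).trans_le hq0
  have hξ0 : 0 < ‖ξ‖ := norm_pos_iff.2 fun h => by rw [h, inner_zero_right] at hξ; linarith
  have hJq : J P D y f ≤ q⁻¹ := by
    have h1 : H P D (fun _ => ‖ξ‖⁻¹ • ξ) f ≤ ‖ξ‖⁻¹ ^ 2 * q := by
      refine le_of_forall_pos_le_add fun ε hε => ?_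
      -- The factor `‖ξ‖²` cancels the one produced by rescaling `w` along with `ξ`.
      obtain ⟨w, hw, h⟩ := hwq (‖ξ‖ ^ 2 * ε) (by positivity)
      refine (H_le hD hf (smul_mem_Ds ‖ξ‖⁻¹ hw).1 _).trans ?_
      rw [wdist_smul hw]
      calc ‖ξ‖⁻¹ ^ 2 * wdist P ξ f w ≤ ‖ξ‖⁻¹ ^ 2 * (q + ‖ξ‖ ^ 2 * ε) := by gcongr
        _ = _ := by field_simp
    have h2 : inner ℝ y (‖ξ‖⁻¹ • ξ) = ‖ξ‖⁻¹ * q := by rw [real_inner_smul_right, hξ]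
    have hn : ‖ξ‖⁻¹ * q ≠ 0 := by positivity
    have hbdd : BddBelow (Set.range fun η : {η : Euc d // ‖η‖ = 1 ∧ inner ℝ y η ≠ 0} =>
        H P D (fun _ => (η : Euc d)) f / (inner ℝ y (η : Euc d)) ^ 2) := by
      refine ⟨0, ?_⟩
      rintro _ ⟨η, rfl⟩
      exact div_nonneg (le_ciInf fun w : D => wdist_nonneg hf _ _) (sq_nonneg _)
    refine (ciInf_le hbdd ⟨‖ξ‖⁻¹ • ξ, by
      rw [norm_smul, norm_inv, norm_norm, inv_mul_cancel₀ hξ0.ne'], by rw [h2]; exact hn⟩).trans ?_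
    simp only [h2]
    rw [div_le_iff₀ (by positivity)]
    calc _ ≤ _ := h1
      _ = _ := by field_simp
  have hQq : minEnergy P y f = q := by
    refine le_antisymm (le_of_forall_pos_le_add fun ε hε => ?_) (le_minEnergy fun φ hφ => ?_)
    · obtain ⟨φ, hφ, h⟩ := hφq ε hε
      exact (minEnergy_le hφ hf).trans h.le
    · have hE : 0 < energy P f φ := (by positivity : 0 < ‖y‖ ^ 2).trans_le
        (norm_sq_le_energy hy hφ hf)
      exact (inv_le_inv₀ hE hq).1 ((hJ φ hφ).trans hJq)
  rw [hQq]
  refine le_antisymm hJq ?_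
  have hJ0 : 0 < J P D y f := (inv_pos.2 ((by positivity : 0 < ‖y‖ ^ 2).trans_le
    (norm_sq_le_energy hy (const_mem_PhiS y) hf))).trans_le (hJ _ (const_mem_PhiS y))
  rw [inv_le_comm₀ hq hJ0]
  refine le_of_forall_pos_le_add fun ε hε => ?_
  obtain ⟨φ, hφ, h⟩ := hφq ε hε
  have hE : 0 < energy P f φ := (by positivity : 0 < ‖y‖ ^ 2).trans_le
    (norm_sq_le_energy hy hφ hf)
  exact ((inv_le_comm₀ hE hJ0).1 (hJ φ hφ)).trans h.le

end Duality

/-! ### Independence of the density family and the variational formula. -/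

section VariationalFormula

variable {d : ℕ} {Ω : Type*} [MeasurableSpace Ω] [AddAction (Euc d) Ω]
  [MeasurableVAdd₂ (Euc d) Ω] {P : Measure Ω} [IsProbabilityMeasure P]
  [VAddInvariantMeasure (Euc d) Ω P]

lemma energy_eq_sum {f : Ω → ℝ} (hf : f ∈ Fw d P) {y : Euc d} {φ : Ω → Euc d}
    (hφ : φ ∈ PhiS P y) : energy P f φ = ∑ j, ∫ ω, φ ω j ^ 2 / f ω ∂P := by
  obtain ⟨c, hc, hcf⟩ := hf.2.2.1
  unfold energy
  rw [← integral_finsetSum _ fun j _ => integrable_sq_div (hφ.1 j).1.2.1 hf.1.2.1.1 hc hcf]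
  simp_rw [EuclideanSpace.real_norm_sq_eq, Finset.sum_div]

lemma tendsto_energy {f : Ω → ℝ} {g : ℕ → Ω → ℝ} (hf : f ∈ Fw d P) (hg : ∀ n, g n ∈ Fw d P)
    (h0 : Tendsto (fun n => nablaNorm d P (g n - f)) atTop (𝓝 0)) {c : ℝ} (hc : 0 < c)
    (hgc : ∀ᵐ ω ∂P, ∀ n, c < g n ω) {y : Euc d} {φ : Ω → Euc d} (hφ : φ ∈ PhiS P y) :
    Tendsto (fun n => energy P (g n) φ) atTop (𝓝 (energy P f φ)) := by
  simp_rw [fun n => energy_eq_sum (hg n) hφ, energy_eq_sum hf hφ]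
  obtain ⟨c', hc', hcf⟩ := hf.2.2.1
  refine tendsto_finsetSum _ fun j _ => ?_
  obtain ⟨C, hC⟩ := exists_bound_of_mem_Ds (hφ.1 j)
  refine tendsto_integral_sq_div (c := min c c') (a := fun _ ω => φ ω j) (fun _ => (hφ.1 j).1.2.1)
    (memLp_of_abs_le (hφ.1 j).1.1 hC _) (fun n => (hg n).1.2.1) hf.1.2.1 (lt_min hc hc')
    (fun n => ?_) ?_ (by simp)
    ((tendsto_nablaNorm_iff hf.1 fun n => (hg n).1).1 h0).1
  · filter_upwards [hgc] with ω h using (min_le_left _ _).trans_lt (h n)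
  · filter_upwards [hcf] with ω h using (min_le_right _ _).trans_lt h

/-- A lower bound of `K(f) inf_φ ∫ |φ|² / f` on a density family is a lower bound on `𝔽_w`. -/
lemma le_K_mul_minEnergy {V : Ω → ℝ} (hV : MemLp V 2 P) {F : Set (Ω → ℝ)}
    (hF : F ∈ DensityFamilies d P) (hK : ∀ f ∈ Fw d P, 0 ≤ K d P V f) {y : Euc d} {m : ℝ}
    (hm : ∀ g ∈ F, m ≤ K d P V g * minEnergy P y g) {f : Ω → ℝ} (hf : f ∈ Fw d P)
    (hKf : 0 < K d P V f) : m ≤ K d P V f * minEnergy P y f := by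
  rw [← div_le_iff₀' hKf]
  -- With `φ` fixed, both factors converge along the approximating densities, so no continuity of
  -- `minEnergy` itself is needed.
  refine le_minEnergy fun φ hφ => ?_
  rw [div_le_iff₀' hKf]
  obtain ⟨g, hgF, h0, c, hc, hgc⟩ := hF.2 f hf
  have hg : ∀ n, g n ∈ Fw d P := fun n => hF.1 (hgF n)
  refine ge_of_tendsto ((tendsto_K hV hf hg h0 hc hgc).mul (tendsto_energy hf hg h0 hc hgc hφ))
    (.of_forall fun n => (hm _ (hgF n)).trans ?_)
  exact mul_le_mul_of_nonneg_left (minEnergy_le hφ (hg n)) (hK _ (hg n))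

lemma Gam_eq (V : Ω → ℝ) (y : Euc d) :
    Gam P V y = 2 * ⨅ f : Fs d P, Real.sqrt (K d P V f * (minEnergy P y f / 2)) := by
  unfold Gam
  congr 1
  refine iInf_congr fun f => ?_
  congr 2
  rw [minEnergy, div_eq_inv_mul, Real.mul_iInf_of_nonneg (by norm_num)]
  refine iInf_congr fun φ => ?_
  rw [energy, ← integral_const_mul]
  refine integral_congr_ae (.of_forall fun ω => ?_)
  dsimp only
  rw [mul_comm 2, ← div_div, div_eq_inv_mul _ (2 : ℝ)]

lemma Gam_nonneg (V : Ω → ℝ) (y : Euc d) : 0 ≤ Gam P V y :=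
  mul_nonneg zero_le_two (Real.iInf_nonneg fun _ => Real.sqrt_nonneg _)

lemma Gam_sq_le {V : Ω → ℝ} {y : Euc d} {f : Ω → ℝ} (hf : f ∈ Fs d P)
    (h : 0 ≤ K d P V f * minEnergy P y f) :
    Gam P V y ^ 2 ≤ 2 * (K d P V f * minEnergy P y f) := by
  have h1 : Gam P V y ≤ 2 * Real.sqrt (K d P V f * (minEnergy P y f / 2)) := by
    rw [Gam_eq]
    exact mul_le_mul_of_nonneg_left (ciInf_le ⟨0, by rintro _ ⟨f, rfl⟩; exact Real.sqrt_nonneg _⟩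
      (⟨f, hf⟩ : Fs d P)) zero_le_two
  refine (pow_le_pow_left₀ (Gam_nonneg V y) h1 2).trans_eq ?_
  rw [mul_pow, Real.sq_sqrt (by linarith)]
  ring

lemma le_Gam_sq {V : Ω → ℝ} {y : Euc d} {m : ℝ} (hm0 : 0 ≤ m)
    (hm : ∀ f ∈ Fs d P, m ≤ 2 * (K d P V f * minEnergy P y f)) : m ≤ Gam P V y ^ 2 := by
  have : Nonempty (Fs d P) := ⟨⟨_, one_mem_Fs⟩⟩
  have h1 : Real.sqrt m ≤ Gam P V y := by
    rw [Gam_eq, ← div_le_iff₀' two_pos]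
    refine le_ciInf fun f => Real.le_sqrt_of_sq_le ?_
    rw [div_pow, Real.sq_sqrt hm0]
    linarith [hm f f.2]
  rw [← Real.sq_sqrt hm0]
  exact pow_le_pow_left₀ (Real.sqrt_nonneg _) h1 2

/-- The infimum of `2 k - l² / q` vanishes exactly when `l²` is the infimum of `2 k q`. -/
lemma isGLB_sub_div_iff {ι : Type*} {F : Set ι} {k q : ι → ℝ} {κ q₀ m l : ℝ}
    (hκ : 0 < κ) (hq₀ : 0 < q₀) (hk : ∀ f ∈ F, κ ≤ k f) (hq : ∀ f ∈ F, q₀ ≤ q f)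
    (hm : IsGLB ((fun f => 2 * (k f * q f)) '' F) m) :
    IsGLB ((fun f => 2 * k f - l ^ 2 * (q f)⁻¹) '' F) 0 ↔ l ^ 2 = m := by
  have hm' : ∀ f ∈ F, m ≤ 2 * (k f * q f) := fun f hf => hm.1 ⟨f, hf, rfl⟩
  have hqp : ∀ f ∈ F, 0 < q f := fun f hf => hq₀.trans_le (hq f hf)
  have e : ∀ f ∈ F, 2 * k f - l ^ 2 * (q f)⁻¹ = (2 * (k f * q f) - l ^ 2) / q f := fun f hf => by
    have := (hqp f hf).ne'
    field_simp
  constructor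
  · intro h
    have h1 : l ^ 2 ≤ m := by
      refine hm.2 ?_
      rintro _ ⟨f, hf, rfl⟩
      have h2 : 0 ≤ 2 * k f - l ^ 2 * (q f)⁻¹ := h.1 ⟨f, hf, rfl⟩
      rw [e f hf, le_div_iff₀ (hqp f hf)] at h2
      linarith
    -- If `l² < m`, then `1 / q ≤ 2k / m` keeps every value at or above `2κ (1 - l² / m) > 0`,
    -- contradicting the infimum `0`. This is where the lower bound on `k` is indispensable.
    refine h1.antisymm (not_lt.1 fun hlt => ?_)
    have hmp : 0 < m := (sq_nonneg l).trans_lt hlt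
    have hr : l ^ 2 / m < 1 := (div_lt_one hmp).2 hlt
    have h3 : 2 * κ * (1 - l ^ 2 / m) ≤ 0 := by
      refine h.2 ?_
      rintro _ ⟨f, hf, rfl⟩
      have h4 : (q f)⁻¹ ≤ 2 * k f / m := by
        rw [inv_le_iff_one_le_mul₀ (hqp f hf), div_mul_eq_mul_div, one_le_div hmp]
        linarith [hm' f hf]
      calc 2 * κ * (1 - l ^ 2 / m) ≤ 2 * k f * (1 - l ^ 2 / m) := by
            have := hk f hf
            have : 0 ≤ 1 - l ^ 2 / m := by linarith
            gcongr
        _ = 2 * k f - l ^ 2 * (2 * k f / m) := by ring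
        _ ≤ 2 * k f - l ^ 2 * (q f)⁻¹ := by gcongr
    have : 0 < 2 * κ * (1 - l ^ 2 / m) := mul_pos (by positivity) (by linarith)
    linarith
  · rintro rfl
    refine ⟨?_, fun b hb => le_of_forall_pos_le_add fun ε hε => ?_⟩
    · rintro _ ⟨f, hf, rfl⟩
      change 0 ≤ 2 * k f - l ^ 2 * (q f)⁻¹
      rw [e f hf]
      exact div_nonneg (by linarith [hm' f hf]) (hqp f hf).le
    -- The tolerance `ε * q₀` becomes at most `ε` after division by `q f ≥ q₀`.
    · obtain ⟨_, ⟨f, hf, rfl⟩, -, h⟩ := hm.exists_between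
        (lt_add_of_pos_right (l ^ 2) (mul_pos hε hq₀))
      refine (hb ⟨f, hf, rfl⟩ : b ≤ 2 * k f - l ^ 2 * (q f)⁻¹).trans ?_
      rw [e f hf, zero_add, div_le_iff₀ (hqp f hf)]
      have := mul_le_mul_of_nonneg_left (hq f hf) hε.le
      dsimp only at h
      linarith

/-- The transfer lemma is used twice: from `𝔽_s` to `𝔽_w` for the lower bound, and from `F` to `𝔽_w`
for its optimality. Both families have the same infimum because `𝔽_w` contains them. -/
lemma isGLB_Gam_sq {V : Ω → ℝ} (hV : MemLp V 2 P) {F : Set (Ω → ℝ)}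
    (hF : F ∈ DensityFamilies d P) {κ : ℝ} (hκ : 0 < κ) (hK : ∀ f ∈ Fw d P, κ ≤ K d P V f)
    {y : Euc d} (hy : y ≠ 0) :
    IsGLB ((fun f => 2 * (K d P V f * minEnergy P y f)) '' F) (Gam P V y ^ 2) := by
  have hKp : ∀ f ∈ Fw d P, 0 < K d P V f := fun f hf => hκ.trans_le (hK f hf)
  have hKQ : ∀ f ∈ Fw d P, 0 ≤ K d P V f * minEnergy P y f := fun f hf =>
    mul_nonneg (hKp f hf).le ((sq_nonneg _).trans (norm_sq_le_minEnergy hy hf))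
  constructor
  · rintro _ ⟨f, hf, rfl⟩
    have := le_K_mul_minEnergy hV Fs_mem_DensityFamilies (fun f hf => (hKp f hf).le) (y := y)
      (m := Gam P V y ^ 2 / 2)
      (fun g hg => by linarith [Gam_sq_le hg (hKQ g (Fs_subset_Fw hg))]) (hF.1 hf)
      (hKp f (hF.1 hf))
    change _ ≤ 2 * _
    linarith
  · intro b hb
    -- `le_Gam_sq` takes a square root and so needs a nonnegative bound.
    rcases le_total b 0 with h | h
    · exact h.trans (sq_nonneg _)
    refine le_Gam_sq h fun f hf => ?_
    have := le_K_mul_minEnergy hV hF (fun f hf => (hKp f hf).le) (y := y) (m := b / 2)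
      (fun g hg => by
        have : b ≤ 2 * (K d P V g * minEnergy P y g) := hb ⟨g, hg, rfl⟩
        linarith) (Fs_subset_Fw hf) (hKp f (Fs_subset_Fw hf))
    linarith

end VariationalFormula

end LyapunovVar

theorem proposition3p14 {d : ℕ} {Ω : Type*} [MeasurableSpace Ω]
    [AddAction (LyapunovVar.Euc d) Ω] [MeasurableVAdd₂ (LyapunovVar.Euc d) Ω]
    (P : Measure Ω) [IsProbabilityMeasure P] [VAddInvariantMeasure (LyapunovVar.Euc d) Ω P]
    (V : Ω → ℝ) (hV_nonneg : 0 ≤ᵐ[P] V) (hV : MemLp V 2 P)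
    (F : Set (Ω → ℝ)) (hF : F ∈ LyapunovVar.DensityFamilies d P)
    (D : Set (Ω → ℝ)) (hD : D ∈ LyapunovVar.DenseSpaces d P)
    (y : LyapunovVar.Euc d) (hy : y ≠ 0)
    (hσ : 0 < LyapunovVar.sigma P V (0 : LyapunovVar.Euc d)) :
    0 ≤ LyapunovVar.Gam P V y ∧
      ∀ l : ℝ, 0 ≤ l →
        (IsGLB ((fun f => 2 * LyapunovVar.K d P V f - l ^ 2 * LyapunovVar.J P D y f) '' F) 0 ↔
          l = LyapunovVar.Gam P V y) := by
  refine ⟨LyapunovVar.Gam_nonneg V y, fun l hl => ?_⟩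
  obtain ⟨κ, hκ, hK⟩ := LyapunovVar.exists_K_lower_bound hV hσ
  have e : (fun f => 2 * LyapunovVar.K d P V f - l ^ 2 * LyapunovVar.J P D y f) '' F =
      (fun f => 2 * LyapunovVar.K d P V f - l ^ 2 * (LyapunovVar.minEnergy P y f)⁻¹) '' F :=
    Set.image_congr fun f hf => by rw [LyapunovVar.J_eq_inv_minEnergy hD hy (hF.1 hf)]
  have hy0 : 0 < ‖y‖ ^ 2 := pow_pos (norm_pos_iff.2 hy) 2
  rw [e, LyapunovVar.isGLB_sub_div_iff hκ hy0 (fun f hf => hK f (hF.1 hf))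
    (fun f hf => LyapunovVar.norm_sq_le_minEnergy hy (hF.1 hf))
    (LyapunovVar.isGLB_Gam_sq hV hF hκ hK hy)]
  exact pow_left_inj₀ hl (LyapunovVar.Gam_nonneg V y) two_ne_zero
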